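/- **Setting.** Pure AdS$_3$ in global coordinates, $ds^2=-(r^2+1)dt^2+\frac{dr^2}{r^2+1}+r^2d\phi^2$, is completed conformally by its boundary cylinder with metric $-dt^2+d\phi^2$. $J^\pm$ denotes causal future/past in the completed spacetime and $\hat J^\pm$ causal future/past in the boundary. Let $n\ge 2$ and $m=\lceil n/2\rceil$. For $x,\theta>0$ consider the boundary points (coordinates $(t,\phi)$, $\phi$ modulo $2\pi$) $c_i=(-x,(i-1)\theta)$, $1\le i\le n$, $r_m=(\frac{n-1}2\theta,\frac{n-1}2\theta)$, and, for $i\ne m$, $r_i=(\pi-\frac\theta2,\phi_i)$, where for $n=2m-1$ odd $\phi_i=-\pi+(i-1+\frac n2)\theta$ if $i<m$ and $\phi_i=\pi+(i-1-\frac n2)\theta$ if $i>m$, and for $n=2m$ even $\phi_i=-\pi+(i+\frac{n-1}2)\theta$ if $i<m$ and $\phi_i=\pi+(i-\frac{n+1}2)\theta$ if $i>m$. Put $\hat V_j=\hat J^+(c_j)\cap\bigcap_i\hat J^-(r_i)$, $\hat W_j=\bigcap_i\hat J^+(c_i)\cap \hat J^-(r_j)$ and $J_{jk\to all}=J^+(c_j)\cap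 J^+(c_k)\cap\bigcap_iJ^-(r_i)$. The 2-to-all causal graph $\Gamma$ has vertices $1,\dots,n$ and an edge $jk$ ($j\neq k$) whenever $J_{jk\to all}\ne\emptyset$. Let $\gamma_{m,m+1}$ be the intersection of the past light sheets of $r_m$ and $r_{m+1}$. Call the inputs *disjoint* if $0<x<\theta$ and $(n-1)\theta+x<2\pi$. A *candidate RT surface* is a family of pairwise disjoint geodesics of the time slice that join the right endpoint of the $i$-th of the $n$ intervals $[(i-1)\theta-\frac x2,(i-1)\theta+\frac x2]$ to the left endpoint of the $\sigma(i)$-th one, for a permutation $\sigma$ of $\{1,\dots,n\}$; its length is the sum of the regularized lengths $2\log(\frac2\epsilon|\sin\frac{\Delta\phi}2|)$. The entanglement wedge of $\hat V_1\cup\dots\cup\hat V_n$ is called connected if one candidate is strictly shorter than all the others and its homology region (the part of its complement in the slice that is connected to the intervals) is connected. **Theorem.** Let $n\ge2$. 0. If the inputs are disjoint, then all $\hat V_j,\hat W_j$ are nonempty and there is no 2-to-all and no all-to-2 scattering in the boundary: $\hat J^+(c_j)\cap\hat J^+(c_k)\cap\bigcap_i\hat J^-(r_i)=\emptyset$ and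 $\bigcap_i\hat J^+(c_i)\cap\hat J^-(r_j)\cap\hat J^-(r_k)=\emptyset$ for $j\neq k$. Moreover $\hat V_j$ is the causal diamond with tips $c_j$ and $(0,(j-1)\theta)$. 1. (Large spacing.) Let $0<x\le\theta$, $(n-1)\theta+x\le2\pi$ and $\frac{2\pi}n\le\theta\le\pi$ (the last bound is automatic for $n\ge3$). Then $\Gamma$ is connected if and only if $\theta\le2x$. If $\theta\le 2x$, all the regions $J_{jk\to all}$ are nonempty; and for every pair $j<k$ with $(j,k)\neq(1,n)$, $J_{jk\to all}\neq\emptyset$ if and only if $\theta\le 2x$. 2. (Small spacing.) Let $0<\theta<\frac{2\pi}n$ and $S=\sqrt{1+\Big(\frac{2\sin\frac{(n-1)\theta}2}{\sin\frac{n\theta}2}\Big)^2}$. Then $\tan\frac{n\theta}4-S\tan\frac\theta2\tan^2\frac{(n-2)\theta}4>0$, and the equation $$\tan\Big(x+\tfrac{n-2}4\theta\Big)=\frac{\tan^2\frac{(n-2)\theta}4+S\tan\frac\theta2\tan\frac{n\theta}4}{\tan\frac{n\theta}4-S\tan\frac\theta2\tan^2\frac{(n-2)\theta}4}$$ has exactly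 one solution $x_0\in(0,\theta]$. For all $x\in(0,\theta]$ the following are equivalent: $\Gamma$ is connected; $J^+(c_1)\cap J^+(c_2)\cap J^-(\gamma_{m,m+1})\ne\emptyset$; $J^+(c_1)\cap J^+(c_2)\cap J^-(r_m)\cap J^-(r_{m+1})\neq\emptyset$; $x\ge x_0$. 3. (Phases.) If the inputs are disjoint, then $\sigma(i)=i+1$ (cyclically), $\sigma=\mathrm{id}$ and $\sigma=(1\,n)$ define candidate RT surfaces (fully connected, fully disconnected, and connected only between $\hat V_1$ and $\hat V_n$), of lengths $2\log[(\frac2\epsilon)^nL]$ with, respectively, $L=\sin^{n-1}\frac{\theta-x}2\,\sin\frac{(n-1)\theta+x}2$, $L=\sin^n\frac x2$, and $L=\sin^{n-2}\frac x2\,\sin\frac{(n-1)\theta+x}2\,\sin\frac{(n-1)\theta-x}2$. 4. (No converse.) Let $n\ge3$. If $\theta>\frac{2\pi}n$, the inputs are disjoint and $\Gamma$ is connected, then the entanglement wedge of $\hat V_1\cup\dots\cup\hat V_n$ is connected; but for every $\theta$ with $\frac{2\pi}n<\theta<\frac{4\pi}{2n-1}$ there is an $x$ with disjoint inputs for which the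 entanglement wedge is connected and $\Gamma$ is not. If $n\ge4$, there are also $0<x<\theta<\frac{2\pi}n$ for which the entanglement wedge is connected and $\Gamma$ is not. In particular, for every $n\ge3$ the $n$-to-$n$ connected wedge theorem has no converse: there are disjoint inputs for which the nonemptiness and no-boundary-scattering conditions of part 0 hold and the entanglement wedge is connected, but $\Gamma$ is not connected. -/

import Mathlib

open Set

namespace AdS3

noncomputable section

/-! ### The conformally completed spacetime

Pure AdS₃ in global coordinates has the metric
`-(r² + 1) dt² + dr² / (r² + 1) + r² dφ²`.  The map `(t, r, φ) ↦ (t, slicePoint r φ)` identifies it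
with `ℝ` times the open upper unit hemisphere and turns the metric into `(r² + 1) (-dt² + |dn|²)`
(see `adsMetric_eq_conformal`), so that `ℝ` times the closed hemisphere, with the conformal metric
`-dt² + |dn|²`, is the spacetime together with its asymptotic boundary.  The boundary is `ℝ` times
the equator, with the metric `-dt² + dφ²`. -/

/-- The ambient Euclidean space of the hemisphere. -/
abbrev E3 : Type := EuclideanSpace ℝ (Fin 3)

/-- A point `(t, n)` of `ℝ × E3`; the spacetime consists of those with `n ∈ hemisphere`. -/
abbrev Event : Type := ℝ × E3

/-- The closed upper unit hemisphere: a time slice together with its asymptotic boundary. -/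
def hemisphere : Set E3 := {p | ‖p‖ = 1 ∧ 0 ≤ p 2}

/-- The equator: the asymptotic boundary of a time slice. -/
def equator : Set E3 := {p | ‖p‖ = 1 ∧ p 2 = 0}

/-- The point of the open hemisphere with global coordinates `(r, φ)`. -/
def slicePoint (r φ : ℝ) : E3 :=
  !₂[r * Real.cos φ / √(1 + r ^ 2), r * Real.sin φ / √(1 + r ^ 2), 1 / √(1 + r ^ 2)]

/-- The metric of pure AdS₃ in global coordinates, at radius `r`, as a quadratic form. -/
def adsMetric (r dt dr dφ : ℝ) : ℝ :=
  -(r ^ 2 + 1) * dt ^ 2 + dr ^ 2 / (r ^ 2 + 1) + r ^ 2 * dφ ^ 2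

/-- Along any curve the AdS₃ metric is `r² + 1` times the conformal metric `-dt² + |dn|²`. -/
theorem adsMetric_eq_conformal {r φ : ℝ → ℝ} {s r' φ' : ℝ} (t' : ℝ)
    (hr : HasDerivAt r r' s) (hφ : HasDerivAt φ φ' s) :
    ∃ n' : E3, HasDerivAt (fun u => slicePoint (r u) (φ u)) n' s ∧
      adsMetric (r s) t' r' φ' = (r s ^ 2 + 1) * (-t' ^ 2 + ‖n'‖ ^ 2) := by
  have hpos : 0 < 1 + r s ^ 2 := by positivity
  have hw : 0 < √(1 + r s ^ 2) := Real.sqrt_pos.mpr hpos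
  have hw2 : √(1 + r s ^ 2) ^ 2 = 1 + r s ^ 2 := Real.sq_sqrt hpos.le
  have hsq : HasDerivAt (fun u => √(1 + r u ^ 2)) (r s * r' / √(1 + r s ^ 2)) s := by
    have h := ((hr.fun_pow 2).const_add 1).sqrt hpos.ne'
    refine h.congr_deriv ?_
    field_simp
    norm_num
    ring
  have h0 := (hr.fun_mul hφ.cos).fun_div hsq hw.ne'
  have h1 := (hr.fun_mul hφ.sin).fun_div hsq hw.ne'
  have h2 := (hasDerivAt_const s (1 : ℝ)).fun_div hsq hw.ne'
  have hv : HasDerivAt (fun u => ![r u * Real.cos (φ u) / √(1 + r u ^ 2),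
      r u * Real.sin (φ u) / √(1 + r u ^ 2), 1 / √(1 + r u ^ 2)]) ![_, _, _] s :=
    hasDerivAt_pi.2 (Fin.forall_fin_succ.2 ⟨h0, Fin.forall_fin_succ.2 ⟨h1,
      Fin.forall_fin_succ.2 ⟨h2, fun i => i.elim0⟩⟩⟩)
  refine ⟨_, (PiLp.hasFDerivAt_toLp (𝕜 := ℝ) 2 _).comp_hasDerivAt s hv, ?_⟩
  rw [EuclideanSpace.norm_sq_eq, Fin.sum_univ_three]
  have key : ∀ X Y Z w q : ℝ, 0 < w → w ^ 2 = q →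
      ((X * w - Y * (Z / w)) / w ^ 2) ^ 2 = (X * q - Y * Z) ^ 2 / q ^ 3 := by
    rintro X Y Z w q h rfl
    field_simp
  change adsMetric (r s) t' r' φ' = (r s ^ 2 + 1) * (-t' ^ 2 +
    (‖((r' * Real.cos (φ s) + r s * (-Real.sin (φ s) * φ')) * √(1 + r s ^ 2) -
          r s * Real.cos (φ s) * (r s * r' / √(1 + r s ^ 2))) / √(1 + r s ^ 2) ^ 2‖ ^ 2 +
      ‖((r' * Real.sin (φ s) + r s * (Real.cos (φ s) * φ')) * √(1 + r s ^ 2) -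
          r s * Real.sin (φ s) * (r s * r' / √(1 + r s ^ 2))) / √(1 + r s ^ 2) ^ 2‖ ^ 2 +
      ‖(0 * √(1 + r s ^ 2) - 1 * (r s * r' / √(1 + r s ^ 2))) / √(1 + r s ^ 2) ^ 2‖ ^ 2))
  simp only [Real.norm_eq_abs, sq_abs]
  rw [key _ _ _ _ _ hw hw2, key _ _ _ _ _ hw hw2, key _ _ _ _ _ hw hw2, adsMetric,
    add_comm (r s ^ 2) 1]
  field_simp
  linear_combination (-(r s ^ 2 * φ' ^ 2 * (1 + r s ^ 2) ^ 2 + r' ^ 2)) * Real.sin_sq_add_cos_sq (φ s)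

/-! ### Causal structure -/

/-- A future-directed causal `C¹` curve `s ↦ (t s, n s)`, `s ∈ [0, 1]`, for the metric
`-dt² + |dn|²` on `ℝ × K`.  `K = hemisphere` gives the completed bulk, `K = equator` the boundary. -/
def IsCausalCurve (K : Set E3) (t : ℝ → ℝ) (n : ℝ → E3) : Prop :=
  ContDiff ℝ 1 t ∧ ContDiff ℝ 1 n ∧ ∀ s ∈ Icc (0 : ℝ) 1, n s ∈ K ∧ ‖deriv n s‖ ≤ deriv t s

/-- A future-directed timelike `C¹` curve in `ℝ × K`. -/
def IsTimelikeCurve (K : Set E3) (t : ℝ → ℝ) (n : ℝ → E3) : Prop :=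
  ContDiff ℝ 1 t ∧ ContDiff ℝ 1 n ∧ ∀ s ∈ Icc (0 : ℝ) 1, n s ∈ K ∧ ‖deriv n s‖ < deriv t s

/-- `q` is in the causal future of `p` in `ℝ × K`. -/
def CausallyPrecedes (K : Set E3) (p q : Event) : Prop :=
  ∃ (t : ℝ → ℝ) (n : ℝ → E3), IsCausalCurve K t n ∧ (t 0, n 0) = p ∧ (t 1, n 1) = q

/-- `q` is in the chronological future of `p` in `ℝ × K`. -/
def ChronologicallyPrecedes (K : Set E3) (p q : Event) : Prop :=
  ∃ (t : ℝ → ℝ) (n : ℝ → E3), IsTimelikeCurve K t n ∧ (t 0, n 0) = p ∧ (t 1, n 1) = q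

/-- The causal future `J⁺(p)` in `ℝ × K`. -/
def causalFuture (K : Set E3) (p : Event) : Set Event := {q | CausallyPrecedes K p q}

/-- The causal past `J⁻(p)` in `ℝ × K`. -/
def causalPast (K : Set E3) (p : Event) : Set Event := {q | CausallyPrecedes K q p}

/-- The causal past `J⁻(S)` of a set in `ℝ × K`. -/
def causalPastSet (K : Set E3) (S : Set Event) : Set Event := {q | ∃ p ∈ S, CausallyPrecedes K q p}

/-- The past light sheet of `p` in the completed bulk. -/
def pastLightSheet (p : Event) : Set Event :=
  {q | CausallyPrecedes hemisphere q p ∧ ¬ ChronologicallyPrecedes hemisphere q p}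

/-- The curve `γ_{pq}` along which the past light sheets of `p` and `q` intersect. -/
def ridge (p q : Event) : Set Event := pastLightSheet p ∩ pastLightSheet q

/-- The point of the equator with angle `φ`. -/
def circlePoint (φ : ℝ) : E3 := !₂[Real.cos φ, Real.sin φ, 0]

/-- The boundary event with coordinates `(t, φ)`. -/
def boundaryEvent (t φ : ℝ) : Event := (t, circlePoint φ)

/-! ### Scattering of `n` inputs to `n` outputs -/

section Scattering

variable {n : ℕ} (c r : Fin n → Event)

/-- The scattering region `J_{j,k → 1,…,n}` for causal relations in `ℝ × K`. -/
def twoToAll (K : Set E3) (j k : Fin n) : Set Event :=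
  causalFuture K (c j) ∩ causalFuture K (c k) ∩ ⋂ i, causalPast K (r i)

/-- The scattering region `J_{1,…,n → j,k}` for causal relations in `ℝ × K`. -/
def allToTwo (K : Set E3) (j k : Fin n) : Set Event :=
  (⋂ i, causalFuture K (c i)) ∩ causalPast K (r j) ∩ causalPast K (r k)

/-- The boundary input region `V̂_j`. -/
def inputRegion (j : Fin n) : Set Event :=
  causalFuture equator (c j) ∩ ⋂ i, causalPast equator (r i)

/-- The boundary output region `Ŵ_j`. -/
def outputRegion (j : Fin n) : Set Event :=
  (⋂ i, causalFuture equator (c i)) ∩ causalPast equator (r j)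

/-- The assumptions of the `n`-to-`n` connected wedge theorem on the boundary points: the input and
output regions are nonempty, and 2-to-all and all-to-2 scattering are impossible in the boundary. -/
structure BoundaryHypotheses : Prop where
  input_nonempty : ∀ j, (inputRegion c r j).Nonempty
  output_nonempty : ∀ j, (outputRegion c r j).Nonempty
  no_twoToAll : ∀ j k, j ≠ k → twoToAll c r equator j k = ∅
  no_allToTwo : ∀ j k, j ≠ k → allToTwo c r equator j k = ∅

/-- The 2-to-all causal graph: `j` and `k` are adjacent if the bulk region `J_{j,k → 1,…,n}` is
nonempty. -/
def causalGraph : SimpleGraph (Fin n) where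
  Adj j k := j ≠ k ∧ (twoToAll c r hemisphere j k).Nonempty
  symm := ⟨fun j k h => ⟨h.1.symm, by
    have h2 := h.2
    rwa [twoToAll, inter_comm (causalFuture hemisphere (c j))] at h2⟩⟩
  loopless := ⟨fun _ h => h.1 rfl⟩

end Scattering

/-! ### The equally spaced configuration -/

/-- The input point `c_i`, `1 ≤ i ≤ n`. -/
def inputPoint (θ x : ℝ) (i : ℕ) : Event := boundaryEvent (-x) (((i : ℝ) - 1) * θ)

/-- The output point `r_i`, `1 ≤ i ≤ n`; here `m = ⌈n / 2⌉`, that is, `n = 2m - 1` or `n = 2m`. -/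
def outputPoint (n : ℕ) (θ : ℝ) (i : ℕ) : Event :=
  if i = (n + 1) / 2 then boundaryEvent (((n : ℝ) - 1) / 2 * θ) (((n : ℝ) - 1) / 2 * θ)
  else if n % 2 = 1 then
    if i < (n + 1) / 2 then
      boundaryEvent (Real.pi - θ / 2) (-Real.pi + ((i : ℝ) - 1 + n / 2) * θ)
    else boundaryEvent (Real.pi - θ / 2) (Real.pi + ((i : ℝ) - 1 - n / 2) * θ)
  else
    if i < (n + 1) / 2 then
      boundaryEvent (Real.pi - θ / 2) (-Real.pi + ((i : ℝ) + ((n : ℝ) - 1) / 2) * θ)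
    else boundaryEvent (Real.pi - θ / 2) (Real.pi + ((i : ℝ) - ((n : ℝ) + 1) / 2) * θ)

/-- The input points, indexed by `Fin n` (the index `j` stands for the label `j + 1`). -/
def inputs (n : ℕ) (θ x : ℝ) (j : Fin n) : Event := inputPoint θ x ((j : ℕ) + 1)

/-- The output points, indexed by `Fin n` (the index `j` stands for the label `j + 1`). -/
def outputs (n : ℕ) (θ : ℝ) (j : Fin n) : Event := outputPoint n θ ((j : ℕ) + 1)

/-- The 2-to-all causal graph of the equally spaced configuration. -/
def spacedGraph (n : ℕ) (θ x : ℝ) : SimpleGraph (Fin n) :=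
  causalGraph (inputs n θ x) (outputs n θ)

/-- The number `√(1 + (2 sin((n-1)θ/2) / sin(nθ/2))²)`. -/
def thresholdRoot (n : ℕ) (θ : ℝ) : ℝ :=
  √(1 + (2 * Real.sin (((n : ℝ) - 1) * θ / 2) / Real.sin (n * θ / 2)) ^ 2)

/-- The numerator of the threshold equation for small spacing. -/
def thresholdNum (n : ℕ) (θ : ℝ) : ℝ :=
  Real.tan (((n : ℝ) - 2) * θ / 4) ^ 2 +
    thresholdRoot n θ * Real.tan (θ / 2) * Real.tan (n * θ / 4)

/-- The denominator of the threshold equation for small spacing. -/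
def thresholdDen (n : ℕ) (θ : ℝ) : ℝ :=
  Real.tan (n * θ / 4) -
    thresholdRoot n θ * Real.tan (θ / 2) * Real.tan (((n : ℝ) - 2) * θ / 4) ^ 2

/-! ### Ryu–Takayanagi surfaces and the entanglement wedge

The input regions are the causal developments of the intervals of width `x` centred at
`0, θ, …, (n-1)θ` in the time slice `t = -x/2`. -/

/-- The angle of the left endpoint of the `i`-th interval. -/
def leftEnd {n : ℕ} (θ x : ℝ) (i : Fin n) : ℝ := (i : ℝ) * θ - x / 2

/-- The angle of the right endpoint of the `i`-th interval. -/
def rightEnd {n : ℕ} (θ x : ℝ) (i : Fin n) : ℝ := (i : ℝ) * θ + x / 2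

/-- The geodesic of the time slice with boundary endpoints at the angles `α` and `β`: the
half-circle of the hemisphere that lies above the chord between the endpoints. -/
def sliceGeodesic (α β : ℝ) : Set E3 :=
  {p | p ∈ hemisphere ∧ ∃ s ∈ Icc (0 : ℝ) 1,
    p 0 = (1 - s) * Real.cos α + s * Real.cos β ∧ p 1 = (1 - s) * Real.sin α + s * Real.sin β}

/-- The length of that geodesic, with the cutoff `ε` near the boundary. -/
def regularizedLength (ε α β : ℝ) : ℝ := 2 * Real.log (2 / ε * |Real.sin ((β - α) / 2)|)

section RT

variable {n : ℕ} (θ x : ℝ) (σ : Equiv.Perm (Fin n))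

/-- The geodesic of the candidate surface `σ` that starts at the right endpoint of the `i`-th
interval; it ends at the left endpoint of the `σ i`-th one. -/
def candidateGeodesic (i : Fin n) : Set E3 := sliceGeodesic (rightEnd θ x i) (leftEnd θ x (σ i))

/-- The geodesics of `σ` are pairwise disjoint, so that their union is a candidate RT surface
(extremal and homologous to the union of the intervals). -/
def IsRTCandidate : Prop :=
  ∀ i j, i ≠ j → Disjoint (candidateGeodesic θ x σ i) (candidateGeodesic θ x σ j)

/-- The total regularized length of the candidate surface `σ`. -/
def candidateLength (ε : ℝ) : ℝ :=
  ∑ i, regularizedLength ε (rightEnd θ x i) (leftEnd θ x (σ i))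

/-- The complement of the candidate surface `σ` in the time slice. -/
def surfaceComplement : Set E3 := {p | p ∈ hemisphere ∧ ∀ i, p ∉ candidateGeodesic θ x σ i}

/-- The homology region of the candidate surface `σ`: the part of its complement that is connected
to one of the intervals.  The corresponding entanglement wedge is its domain of dependence. -/
def homologyRegion : Set E3 :=
  {p | ∃ (i : Fin n) (α : ℝ), α ∈ Ioo (leftEnd θ x i) (rightEnd θ x i) ∧
    JoinedIn (surfaceComplement θ x σ) (circlePoint α) p}

/-- The surface `σ` is the RT surface of the union of the intervals, and the only one: it is
strictly shorter than any other candidate. -/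
def IsUniqueRT : Prop :=
  IsRTCandidate θ x σ ∧ ∀ τ : Equiv.Perm (Fin n), IsRTCandidate θ x τ → τ ≠ σ →
    ∀ ε > 0, candidateLength θ x σ ε < candidateLength θ x τ ε

end RT

/-- The entanglement wedge of `V̂_1 ∪ ⋯ ∪ V̂_n` is connected. -/
def EntanglementWedgeConnected (n : ℕ) (θ x : ℝ) : Prop :=
  ∃ σ : Equiv.Perm (Fin n), IsUniqueRT θ x σ ∧ IsConnected (homologyRegion θ x σ)

end

end AdS3

open AdS3

open AdS3
open InnerProductGeometry Filter Topology

/-! The completed spacetime is conformal to `ℝ` times a closed hemisphere. The hemisphere and its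
equator each contain a shortest great-circle arc between any two of their points, so causal
precedence means that the angle between the positions is at most the elapsed time
(`causallyPrecedes_iff`). All conditions become inequalities on the sinusoid `φ ↦ proj p φ`, the
cosine of the distance from `p` to the boundary point at angle `φ`. The outputs other than the
middle one are antipodal to the `n - 1` midpoints of adjacent inputs, so lying in their pasts means
being at distance at least `t + θ / 2` from every midpoint (`InPastOfOutputs`).

Boundary: each input region is a causal diamond of duration `x`, and each output region lies in one.
Different diamonds are too far apart to meet.

Large spacing: if `θ ≤ 2 * x`, the pole of the hemisphere at time `π / 2 - θ / 2` scatters every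
pair to all outputs. If `2 * x < θ`, the sinusoid would be at least `cos (t + x)` at two input
angles and at most the smaller `cos (t + θ / 2)` at every midpoint; interpolation excludes this
unless the pair consists of the two end inputs (`not_mem_twoToAll_of_lt`).

Small spacing: the extremal event lies above the first midpoint, on the light cones of the middle
output and of the output antipodal to that midpoint. Its translates above the other midpoints also
reach all outputs, because they are no farther from the middle one. Conversely
(`false_of_lt_criticalSize`), before the critical time the values at two inputs are averaged; after
it, an input is interpolated with the middle output. Either way the obstruction is a sinusoid in
`t`, positive at two times less than `π` apart and hence between them. Half-angle identities turn
the threshold into the tangent equation (`threshold_eq`).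

Entanglement: lengths are logarithms of products of half chords. If `2 * π ≤ n * θ` and `θ ≤ 2 * x`,
the cyclic shift minimises every factor; only the identity can tie, and it does not when `2 * π < n
* θ`. Strict inequalities between finitely many continuous products are open, so they persist for
`x` slightly below `θ / 2`, where the graph is disconnected. For small spacing one perturbs from `θ
= 2 * π / n`, `x = π / n`, where shift and identity tie: concavity of the sine favours the shift,
while a first-order expansion keeps `x` below the threshold. -/

/-! ### Causal relations as comparisons of angle and time -/

theorem angle_eq_arccos_inner {p q : E3} (hp : ‖p‖ = 1) (hq : ‖q‖ = 1) :
    angle p q = Real.arccos (inner ℝ p q) := by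
  simp [angle, hp, hq]

theorem cos_angle_eq_inner {p q : E3} (hp : ‖p‖ = 1) (hq : ‖q‖ = 1) :
    Real.cos (angle p q) = inner ℝ p q := by
  simp [cos_angle, hp, hq]

/-- A curve on the unit sphere is at least as long as the angle between its endpoints. -/
theorem angle_le_of_norm_deriv_le {t : ℝ → ℝ} {n : ℝ → E3} (ht : ContDiff ℝ 1 t)
    (hn : ContDiff ℝ 1 n)
    (h : ∀ s ∈ Icc (0 : ℝ) 1, ‖n s‖ = 1 ∧ ‖deriv n s‖ ≤ deriv t s) :
    angle (n 0) (n 1) ≤ t 1 - t 0 := by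
  have h0 : ‖n 0‖ = 1 := (h 0 (by simp)).1
  have h1 : ‖n 1‖ = 1 := (h 1 (by simp)).1
  have hdt : Differentiable ℝ t := ht.differentiable one_ne_zero
  have hdn : Differentiable ℝ n := hn.differentiable one_ne_zero
  -- The factor `l < 1` keeps the argument of `arccos` away from `±1`, where it is not
  -- differentiable. The limit `l → 1` is taken at the end.
  have key : ∀ l ∈ Ioo (0 : ℝ) 1,
      Real.arccos (l * inner ℝ (n 0) (n 1)) ≤ t 1 - t 0 + Real.arccos (l * 1) := by
    intro l hl
    have habs : ∀ s ∈ Icc (0 : ℝ) 1, |l * inner ℝ (n 0) (n s)| < 1 := by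
      intro s hs
      have := abs_real_inner_le_norm (n 0) (n s)
      rw [h0, (h s hs).1, one_mul] at this
      rw [abs_mul, abs_of_pos hl.1]
      nlinarith [hl.1, hl.2, abs_nonneg (inner ℝ (n 0) (n s))]
    have hder : ∀ s ∈ Icc (0 : ℝ) 1, HasDerivAt
        (fun s => t s - Real.arccos (l * inner ℝ (n 0) (n s)))
        (deriv t s - -(1 / √(1 - (l * inner ℝ (n 0) (n s)) ^ 2)) *
          (l * inner ℝ (n 0) (deriv n s))) s := by
      intro s hs
      have hb := abs_lt.1 (habs s hs)
      have hin : HasDerivAt (fun s => l * inner ℝ (n 0) (n s))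
          (l * inner ℝ (n 0) (deriv n s)) s := by
        have := ((hasDerivAt_const s (n 0)).inner ℝ (hdn s).hasDerivAt).const_mul l
        simpa using this
      exact (hdt s).hasDerivAt.fun_sub (HasDerivAt.comp (h₂ := Real.arccos)
        (h := fun s => l * inner ℝ (n 0) (n s)) s
        (Real.hasDerivAt_arccos hb.1.ne' hb.2.ne) hin)
    have hmono : MonotoneOn (fun s => t s - Real.arccos (l * inner ℝ (n 0) (n s)))
        (Icc 0 1) := by
      refine monotoneOn_of_deriv_nonneg (convex_Icc 0 1)
        (fun s hs => (hder s hs).continuousAt.continuousWithinAt)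
        (fun s hs => (hder s (interior_subset hs)).differentiableAt.differentiableWithinAt) ?_
      intro s hs
      have hs' := interior_subset hs
      rw [(hder s hs').deriv]
      rw [interior_Icc] at hs
      have horth : inner ℝ (n s) (deriv n s) = 0 := by
        have e1 : HasDerivAt (fun u => ‖n u‖ ^ 2) (2 * inner ℝ (n s) (deriv n s)) s :=
          (hdn s).hasDerivAt.norm_sq
        have e2 : HasDerivAt (fun u => ‖n u‖ ^ 2) 0 s := by
          refine (hasDerivAt_const s (1 : ℝ)).congr_of_eventuallyEq ?_
          filter_upwards [Icc_mem_nhds hs.1 hs.2] with u hu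
          simp [(h u hu).1]
        have := e1.unique e2
        linarith
      set f := inner ℝ (n 0) (n s) with hf
      have hns : ‖n s‖ = 1 := (h s hs').1
      have hb := abs_lt.1 (habs s hs')
      have hpos : 0 < 1 - (l * f) ^ 2 := by nlinarith
      -- The velocity is tangent to the sphere, so only the tangential part of `n 0`, of norm `√(1 -
      -- f ^ 2)`, contributes.
      have hfl : |inner ℝ (n 0) (deriv n s)| ≤ √(1 - f ^ 2) * deriv t s := by
        have e : inner ℝ (n 0) (deriv n s) = inner ℝ (n 0 - f • n s) (deriv n s) := by
          rw [inner_sub_left, real_inner_smul_left, horth]; ring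
        have e2 : ‖n 0 - f • n s‖ = √(1 - f ^ 2) := by
          rw [← Real.sqrt_sq (norm_nonneg (n 0 - f • n s)), norm_sub_sq_real, norm_smul, h0, hns,
            inner_smul_right, ← hf, Real.norm_eq_abs]
          congr 1
          rw [mul_one, sq_abs]; ring
        rw [e]
        refine (abs_real_inner_le_norm _ _).trans ?_
        rw [e2]
        exact mul_le_mul_of_nonneg_left (h s hs').2 (Real.sqrt_nonneg _)
      have hdt0 : 0 ≤ deriv t s := (norm_nonneg _).trans (h s hs').2
      have hsq : l * √(1 - f ^ 2) ≤ √(1 - (l * f) ^ 2) := by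
        have : l * √(1 - f ^ 2) = √(l ^ 2 * (1 - f ^ 2)) := by
          rw [Real.sqrt_mul (sq_nonneg l), Real.sqrt_sq hl.1.le]
        rw [this]
        apply Real.sqrt_le_sqrt
        nlinarith [hl.1, hl.2]
      have hw := Real.sqrt_pos.2 hpos
      set w := √(1 - (l * f) ^ 2)
      have hfin : -(deriv t s * w) ≤ l * inner ℝ (n 0) (deriv n s) := by
        have := neg_abs_le (inner ℝ (n 0) (deriv n s))
        have h3 := mul_le_mul_of_nonneg_left hfl hl.1.le
        have h4 := mul_le_mul_of_nonneg_right hsq hdt0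
        nlinarith [mul_le_mul_of_nonneg_left this hl.1.le]
      have : deriv t s - -(1 / w) * (l * inner ℝ (n 0) (deriv n s)) =
          (deriv t s * w + l * inner ℝ (n 0) (deriv n s)) / w := by
        field_simp
        ring
      rw [this]
      exact div_nonneg (by linarith) hw.le
    have := hmono (left_mem_Icc.2 zero_le_one) (right_mem_Icc.2 zero_le_one) zero_le_one
    simp only [real_inner_self_eq_norm_sq, h0] at this
    norm_num at this ⊢
    linarith
  rw [angle_eq_arccos_inner h0 h1]
  have hlim1 : Tendsto (fun l : ℝ => Real.arccos (l * inner ℝ (n 0) (n 1))) (𝓝[<] 1)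
      (𝓝 (Real.arccos (1 * inner ℝ (n 0) (n 1)))) :=
    ((Real.continuous_arccos.comp (continuous_id.mul continuous_const)).tendsto 1).mono_left
      nhdsWithin_le_nhds
  have hlim2 : Tendsto (fun l : ℝ => t 1 - t 0 + Real.arccos (l * 1)) (𝓝[<] 1)
      (𝓝 (t 1 - t 0 + Real.arccos (1 * 1))) :=
    ((continuous_const.add (Real.continuous_arccos.comp
      (continuous_id.mul continuous_const))).tendsto 1).mono_left nhdsWithin_le_nhds
  have := le_of_tendsto_of_tendsto hlim1 hlim2
    (by filter_upwards [Ioo_mem_nhdsLT (zero_lt_one' ℝ)] with l hl using key l hl)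
  simpa using this

/-- A set of unit vectors that contains a shortest great-circle arc between any two points. -/
def IsGeodesicallyConvex (K : Set E3) : Prop :=
  (∀ p ∈ K, ‖p‖ = 1) ∧ ∀ p ∈ K, ∀ q ∈ K, ∃ e : E3, ‖e‖ = 1 ∧ inner ℝ p e = 0 ∧
    q = Real.cos (angle p q) • p + Real.sin (angle p q) • e ∧
    ∀ s ∈ Icc (0 : ℝ) 1, Real.cos (s * angle p q) • p + Real.sin (s * angle p q) • e ∈ K

theorem norm_cos_smul_add_sin_smul {p e : E3} (hp : ‖p‖ = 1) (he : ‖e‖ = 1)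
    (hpe : inner ℝ p e = 0) (a : ℝ) : ‖Real.cos a • p + Real.sin a • e‖ = 1 := by
  have : ‖Real.cos a • p + Real.sin a • e‖ ^ 2 = 1 := by
    rw [norm_add_sq_real, norm_smul, norm_smul, inner_smul_left, inner_smul_right, hp, he, hpe]
    simp only [Real.norm_eq_abs, mul_one, sq_abs, mul_zero]
    nlinarith [Real.sin_sq_add_cos_sq a]
  exact (pow_eq_one_iff_of_nonneg (norm_nonneg _) two_ne_zero).1 this

/-- The last clause is spherical interpolation: between the endpoints both coefficients are
nonnegative, so the arc stays in any cone that contains `p` and `q`. -/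
theorem exists_orthonormal_of_angle {p q : E3} (hp : ‖p‖ = 1) (hq : ‖q‖ = 1)
    (h : 0 < Real.sin (angle p q)) :
    ∃ e : E3, ‖e‖ = 1 ∧ inner ℝ p e = 0 ∧
      q = Real.cos (angle p q) • p + Real.sin (angle p q) • e ∧
      ∀ b, Real.cos b • p + Real.sin b • e = (Real.sin (angle p q))⁻¹ •
        (Real.sin (angle p q - b) • p + Real.sin b • q) := by
  set a := angle p q with ha
  have hc : inner ℝ p q = Real.cos a := (cos_angle_eq_inner hp hq).symm
  refine ⟨(Real.sin a)⁻¹ • (q - Real.cos a • p), ?_, ?_, ?_, ?_⟩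
  · rw [norm_smul, norm_inv, Real.norm_eq_abs, abs_of_pos h]
    have : ‖q - Real.cos a • p‖ ^ 2 = Real.sin a ^ 2 := by
      rw [norm_sub_sq_real, norm_smul, inner_smul_right, real_inner_comm, hc, hp, hq]
      simp only [Real.norm_eq_abs, mul_one, sq_abs]
      nlinarith [Real.sin_sq_add_cos_sq a]
    have h2 : ‖q - Real.cos a • p‖ = Real.sin a := by
      rw [← abs_of_nonneg (norm_nonneg (q - Real.cos a • p)), ← abs_of_pos h]
      exact (sq_eq_sq_iff_abs_eq_abs _ _).1 this
    rw [h2, inv_mul_cancel₀ h.ne']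
  · rw [inner_smul_right, inner_sub_right, inner_smul_right, hc, real_inner_self_eq_norm_sq, hp]
    ring
  · rw [smul_smul, mul_inv_cancel₀ h.ne', one_smul]; abel
  · intro b
    rw [Real.sin_sub, smul_sub, smul_add, smul_sub]
    simp only [smul_smul]
    have e : (Real.sin a)⁻¹ * (Real.sin a * Real.cos b - Real.cos a * Real.sin b) =
        Real.cos b - Real.sin b * ((Real.sin a)⁻¹ * Real.cos a) := by
      field_simp
    rw [e]
    module

/-- For an angle strictly between `0` and `π` the arc consists of nonnegative combinations of its
endpoints. Antipodal endpoints must lie on the equator, which itself provides a half-circle. -/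
theorem isGeodesicallyConvex_of {K : Set E3} (h1 : ∀ p ∈ K, ‖p‖ = 1)
    (hcone : ∀ p ∈ K, ∀ q ∈ K, ∀ a b : ℝ, 0 ≤ a → 0 ≤ b → ‖a • p + b • q‖ = 1 →
      a • p + b • q ∈ K)
    (heq : equator ⊆ K) (hanti : ∀ p ∈ K, -p ∈ K → p ∈ equator) : IsGeodesicallyConvex K := by
  refine ⟨h1, fun p hp q hq => ?_⟩
  rcases (angle_nonneg p q).eq_or_lt with h0 | hpos
  · have hpq : q = p := by
      have := (cos_angle_eq_inner (h1 p hp) (h1 q hq))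
      rw [← h0, Real.cos_zero] at this
      exact ((inner_eq_one_iff_of_norm_eq_one (h1 p hp) (h1 q hq)).1 this.symm).symm
    -- The arc is constant here, so any unit vector orthogonal to `p` serves as direction.
    obtain ⟨e, he, hpe⟩ : ∃ e : E3, ‖e‖ = 1 ∧ inner ℝ p e = 0 := by
      by_cases hz : p 0 = 0 ∧ p 1 = 0
      · refine ⟨circlePoint 0, ?_, ?_⟩
        · simp [circlePoint, EuclideanSpace.norm_eq, Fin.sum_univ_three]
        · simp [circlePoint, PiLp.inner_apply, Fin.sum_univ_three, hz.1]
      · have hne : (!₂[-p 1, p 0, 0] : E3) ≠ 0 := by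
          intro h
          apply hz
          constructor
          · simpa using congrArg (fun v : E3 => v 1) h
          · simpa using congrArg (fun v : E3 => v 0) h
        refine ⟨‖(!₂[-p 1, p 0, 0] : E3)‖⁻¹ • !₂[-p 1, p 0, 0], ?_, ?_⟩
        · rw [norm_smul, norm_inv, norm_norm, inv_mul_cancel₀ (norm_ne_zero_iff.2 hne)]
        · rw [inner_smul_right]
          have : inner ℝ p (!₂[-p 1, p 0, 0] : E3) = 0 := by
            simp [PiLp.inner_apply, Fin.sum_univ_three]
            ring
          rw [this, mul_zero]
    refine ⟨e, he, hpe, ?_, ?_⟩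
    · rw [← h0]; simp [hpq]
    · intro s _
      rw [← h0]; simpa using hp
  rcases (angle_le_pi p q).eq_or_lt with hpi | hlt
  · have hq' : q = -p := by
      have := (cos_angle_eq_inner (h1 p hp) (h1 q hq))
      rw [hpi, Real.cos_pi] at this
      have h2 : inner ℝ p (-q) = 1 := by rw [inner_neg_right, ← this]; norm_num
      have := (inner_eq_one_iff_of_norm_eq_one (h1 p hp) (by rw [norm_neg]; exact h1 q hq)).1 h2
      rw [this, neg_neg]
    obtain ⟨hpn, hp2⟩ := hanti p hp (hq' ▸ hq)
    have hsum : p 0 ^ 2 + p 1 ^ 2 = 1 := by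
      have : ‖p‖ ^ 2 = 1 := by rw [hpn]; norm_num
      rw [EuclideanSpace.norm_sq_eq, Fin.sum_univ_three, hp2] at this
      simpa using this
    have he : ‖(!₂[-p 1, p 0, 0] : E3)‖ = 1 := by
      rw [EuclideanSpace.norm_eq, Fin.sum_univ_three]
      simp
      linarith
    have hpe : inner ℝ p (!₂[-p 1, p 0, 0] : E3) = 0 := by
      simp [PiLp.inner_apply, Fin.sum_univ_three]
      ring
    refine ⟨!₂[-p 1, p 0, 0], he, hpe, ?_, fun s hs => heq ⟨?_, ?_⟩⟩
    · rw [hpi]; simp [hq']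
    · exact norm_cos_smul_add_sin_smul hpn he hpe _
    · simp [hp2]
  · have hs : 0 < Real.sin (angle p q) := Real.sin_pos_of_pos_of_lt_pi hpos hlt
    obtain ⟨e, he, hpe, hqe, hb⟩ := exists_orthonormal_of_angle (h1 p hp) (h1 q hq) hs
    refine ⟨e, he, hpe, hqe, fun s hs' => ?_⟩
    have hn := norm_cos_smul_add_sin_smul (h1 p hp) he hpe (s * angle p q)
    rw [hb, smul_add, smul_smul, smul_smul] at hn ⊢
    refine hcone p hp q hq _ _ ?_ ?_ hn
    · refine mul_nonneg (inv_nonneg.2 hs.le) (Real.sin_nonneg_of_nonneg_of_le_pi ?_ ?_)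
      · nlinarith [hs'.2]
      · nlinarith [hs'.1]
    · refine mul_nonneg (inv_nonneg.2 hs.le) (Real.sin_nonneg_of_nonneg_of_le_pi ?_ ?_)
      · nlinarith [hs'.1]
      · nlinarith [hs'.2]

theorem isGeodesicallyConvex_hemisphere : IsGeodesicallyConvex hemisphere := by
  refine isGeodesicallyConvex_of (fun p hp => hp.1) ?_ (fun p hp => ⟨hp.1, hp.2.ge⟩) ?_
  · intro p hp q hq a b ha hb h
    refine ⟨h, ?_⟩
    have := hp.2
    have := hq.2
    simp only [PiLp.add_apply, PiLp.smul_apply, smul_eq_mul]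
    positivity
  · intro p hp hq
    have := hq.2
    simp only [PiLp.neg_apply] at this
    exact ⟨hp.1, le_antisymm (by linarith) hp.2⟩

theorem isGeodesicallyConvex_equator : IsGeodesicallyConvex equator := by
  refine isGeodesicallyConvex_of (fun p hp => hp.1) ?_ Subset.rfl (fun p hp _ => hp)
  intro p hp q hq a b ha hb h
  refine ⟨h, ?_⟩
  simp [hp.2, hq.2]

theorem exists_great_circle {K : Set E3} (hK : IsGeodesicallyConvex K) {p q : E3} (hp : p ∈ K)
    (hq : q ∈ K) (t t' : ℝ) : ∃ (τ : ℝ → ℝ) (n : ℝ → E3), ContDiff ℝ 1 τ ∧ ContDiff ℝ 1 n ∧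
      (∀ s ∈ Icc (0 : ℝ) 1, n s ∈ K ∧ ‖deriv n s‖ = angle p q ∧ deriv τ s = t' - t) ∧
      (τ 0, n 0) = (t, p) ∧ (τ 1, n 1) = (t', q) := by
  obtain ⟨e, he, hpe, hqe, hmem⟩ := hK.2 p hp q hq
  set a := angle p q with ha
  have hd : ∀ s : ℝ, HasDerivAt (fun s : ℝ => Real.cos (s * a) • p + Real.sin (s * a) • e)
      (a • (Real.cos (s * a + Real.pi / 2) • p + Real.sin (s * a + Real.pi / 2) • e)) s := by
    intro s
    have hs : HasDerivAt (fun s : ℝ => s * a) a s := by simpa using (hasDerivAt_id s).mul_const a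
    refine ((hs.cos.smul_const p).add (hs.sin.smul_const e)).congr_deriv ?_
    rw [Real.cos_add_pi_div_two, Real.sin_add_pi_div_two]
    module
  refine ⟨fun s => t + s * (t' - t), fun s => Real.cos (s * a) • p + Real.sin (s * a) • e,
    by fun_prop, ?_, ?_, ?_, ?_⟩
  · exact ((Real.contDiff_cos.comp (contDiff_id.mul contDiff_const)).smul contDiff_const).add
      ((Real.contDiff_sin.comp (contDiff_id.mul contDiff_const)).smul contDiff_const)
  · intro s hs
    refine ⟨hmem s hs, ?_, ?_⟩
    · rw [(hd s).deriv, norm_smul, norm_cos_smul_add_sin_smul (hK.1 p hp) he hpe, mul_one,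
        Real.norm_eq_abs, abs_of_nonneg (angle_nonneg p q)]
    · have : HasDerivAt (fun s : ℝ => t + s * (t' - t)) (t' - t) s := by
        simpa using ((hasDerivAt_id s).mul_const (t' - t)).const_add t
      exact this.deriv
  · simp
  · simp only [one_mul, ← hqe]
    congr 1
    ring

/-- A causal curve is at least as long as the angle; conversely the great-circle arc run at constant
speed is causal as soon as enough time is available. -/
theorem causallyPrecedes_iff {K : Set E3} (hK : IsGeodesicallyConvex K) {t t' : ℝ} {p q : E3} :
    CausallyPrecedes K (t, p) (t', q) ↔ p ∈ K ∧ q ∈ K ∧ angle p q ≤ t' - t := by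
  constructor
  · rintro ⟨τ, n, ⟨hτ, hn, h⟩, h0, h1⟩
    obtain ⟨rfl, rfl⟩ := Prod.mk.inj h0
    obtain ⟨rfl, rfl⟩ := Prod.mk.inj h1
    exact ⟨(h 0 (by simp)).1, (h 1 (by simp)).1,
      angle_le_of_norm_deriv_le hτ hn fun s hs => ⟨hK.1 _ (h s hs).1, (h s hs).2⟩⟩
  · rintro ⟨hp, hq, h⟩
    obtain ⟨τ, n, hτ, hn, h2, h0, h1⟩ := exists_great_circle hK hp hq t t'
    exact ⟨τ, n, ⟨hτ, hn, fun s hs => ⟨(h2 s hs).1, by rw [(h2 s hs).2.1, (h2 s hs).2.2]; exact h⟩⟩,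
      h0, h1⟩

theorem chronologicallyPrecedes_iff {K : Set E3} (hK : IsGeodesicallyConvex K) {t t' : ℝ}
    {p q : E3} :
    ChronologicallyPrecedes K (t, p) (t', q) ↔ p ∈ K ∧ q ∈ K ∧ angle p q < t' - t := by
  constructor
  · rintro ⟨τ, n, ⟨hτ, hn, h⟩, h0, h1⟩
    obtain ⟨rfl, rfl⟩ := Prod.mk.inj h0
    obtain ⟨rfl, rfl⟩ := Prod.mk.inj h1
    refine ⟨(h 0 (by simp)).1, (h 1 (by simp)).1, ?_⟩
    -- By compactness the excess of the time rate over the speed has a positive minimum `δ`. The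
    -- curve with time `τ s - δ * s` is still causal, and the length bound applied to it gains the
    -- strict inequality.
    have hcont : Continuous fun s => deriv τ s - ‖deriv n s‖ :=
      (hτ.continuous_deriv le_rfl).sub (hn.continuous_deriv le_rfl).norm
    obtain ⟨s₀, hs₀, hmin⟩ := isCompact_Icc.exists_isMinOn (nonempty_Icc.2 (zero_le_one' ℝ))
      hcont.continuousOn
    set δ := deriv τ s₀ - ‖deriv n s₀‖ with hδ
    have hδpos : 0 < δ := sub_pos.2 (h s₀ hs₀).2
    have := angle_le_of_norm_deriv_le (t := fun s => τ s - δ * s) (n := n) (by fun_prop) hn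
      (fun s hs => ⟨hK.1 _ (h s hs).1, by
        have e : HasDerivAt (fun s => τ s - δ * s) (deriv τ s - δ) s := by
          simpa using (hτ.differentiable one_ne_zero s).hasDerivAt.fun_sub
            ((hasDerivAt_id s).const_mul δ)
        rw [e.deriv]
        have := isMinOn_iff.1 hmin s hs
        linarith⟩)
    simp only [mul_one, mul_zero] at this
    linarith
  · rintro ⟨hp, hq, h⟩
    obtain ⟨τ, n, hτ, hn, h2, h0, h1⟩ := exists_great_circle hK hp hq t t'
    exact ⟨τ, n, ⟨hτ, hn, fun s hs => ⟨(h2 s hs).1, by rw [(h2 s hs).2.1, (h2 s hs).2.2]; exact h⟩⟩,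
      h0, h1⟩

theorem mem_ridge_iff {t s s' : ℝ} {p q q' : E3} (hq : q ∈ hemisphere) (hq' : q' ∈ hemisphere) :
    (t, p) ∈ ridge (s, q) (s', q') ↔
      p ∈ hemisphere ∧ angle p q = s - t ∧ angle p q' = s' - t := by
  simp only [ridge, pastLightSheet, mem_inter_iff, mem_ofPred_eq,
    causallyPrecedes_iff isGeodesicallyConvex_hemisphere,
    chronologicallyPrecedes_iff isGeodesicallyConvex_hemisphere]
  constructor
  · rintro ⟨⟨⟨h1, -, h2⟩, h3⟩, ⟨-, -, h4⟩, h5⟩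
    exact ⟨h1, le_antisymm h2 (not_lt.1 fun h => h3 ⟨h1, hq, h⟩),
      le_antisymm h4 (not_lt.1 fun h => h5 ⟨h1, hq', h⟩)⟩
  · rintro ⟨h1, h2, h3⟩
    exact ⟨⟨⟨h1, hq, h2.le⟩, fun h => h.2.2.ne h2⟩, ⟨h1, hq', h3.le⟩, fun h => h.2.2.ne h3⟩

theorem causallyPrecedes_trans {K : Set E3} (hK : IsGeodesicallyConvex K) {a b c : Event}
    (h : CausallyPrecedes K a b) (h' : CausallyPrecedes K b c) : CausallyPrecedes K a c := by
  obtain ⟨ta, pa⟩ := a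
  obtain ⟨tb, pb⟩ := b
  obtain ⟨tc, pc⟩ := c
  rw [causallyPrecedes_iff hK] at *
  exact ⟨h.1, h'.2.1, by linarith [angle_le_angle_add_angle pa pb pc, h.2.2, h'.2.2]⟩

/-! ### Distances to boundary points -/

/-- The inner product of `p` with the point of the equator at angle `φ`. -/
noncomputable def proj (p : E3) (φ : ℝ) : ℝ := p 0 * Real.cos φ + p 1 * Real.sin φ

theorem equator_subset_hemisphere : equator ⊆ hemisphere := fun _ hp => ⟨hp.1, hp.2.ge⟩

theorem circlePoint_mem_equator (φ : ℝ) : circlePoint φ ∈ equator := by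
  refine ⟨?_, by simp [circlePoint]⟩
  simp [circlePoint, EuclideanSpace.norm_eq, Fin.sum_univ_three]

theorem norm_circlePoint (φ : ℝ) : ‖circlePoint φ‖ = 1 := (circlePoint_mem_equator φ).1

theorem inner_circlePoint (p : E3) (φ : ℝ) : inner ℝ p (circlePoint φ) = proj p φ := by
  simp [circlePoint, PiLp.inner_apply, Fin.sum_univ_three, proj]
  ring

theorem angle_circlePoint {p : E3} (hp : ‖p‖ = 1) (φ : ℝ) :
    angle p (circlePoint φ) = Real.arccos (proj p φ) := by
  rw [angle_eq_arccos_inner hp (norm_circlePoint φ), inner_circlePoint]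

theorem abs_proj_le_one {p : E3} (hp : ‖p‖ = 1) (φ : ℝ) : |proj p φ| ≤ 1 := by
  have := abs_real_inner_le_norm p (circlePoint φ)
  rwa [inner_circlePoint, hp, norm_circlePoint, one_mul] at this

theorem proj_add_pi (p : E3) (φ : ℝ) : proj p (φ + Real.pi) = -proj p φ := by
  simp only [proj, Real.cos_add_pi, Real.sin_add_pi]
  ring

theorem proj_add_two_pi (p : E3) (φ : ℝ) : proj p (φ + 2 * Real.pi) = proj p φ := by
  simp [proj]

theorem proj_circlePoint (ψ φ : ℝ) : proj (circlePoint ψ) φ = Real.cos (ψ - φ) := by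
  simp [proj, circlePoint, Real.cos_sub]

theorem arccos_proj_add_pi (p : E3) (φ : ℝ) :
    Real.arccos (proj p (φ + Real.pi)) = Real.pi - Real.arccos (proj p φ) := by
  rw [proj_add_pi, Real.arccos_neg]

section Membership

variable {K : Set E3} (hK : IsGeodesicallyConvex K) (hE : equator ⊆ K)

include hK hE

theorem mem_causalFuture_boundaryEvent {t s φ : ℝ} {p : E3} :
    (t, p) ∈ causalFuture K (boundaryEvent s φ) ↔
      p ∈ K ∧ Real.arccos (proj p φ) ≤ t - s := by
  simp only [causalFuture, boundaryEvent, mem_ofPred_eq, causallyPrecedes_iff hK]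
  constructor
  · rintro ⟨-, h1, h2⟩
    rw [angle_comm, angle_circlePoint (hK.1 p h1)] at h2
    exact ⟨h1, h2⟩
  · rintro ⟨h1, h2⟩
    rw [← angle_circlePoint (hK.1 p h1), angle_comm] at h2
    exact ⟨hE (circlePoint_mem_equator φ), h1, h2⟩

theorem mem_causalPast_boundaryEvent {t s φ : ℝ} {p : E3} :
    (t, p) ∈ causalPast K (boundaryEvent s φ) ↔
      p ∈ K ∧ Real.arccos (proj p φ) ≤ s - t := by
  simp only [causalPast, boundaryEvent, mem_ofPred_eq, causallyPrecedes_iff hK]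
  constructor
  · rintro ⟨h1, -, h2⟩
    rw [angle_circlePoint (hK.1 p h1)] at h2
    exact ⟨h1, h2⟩
  · rintro ⟨h1, h2⟩
    rw [← angle_circlePoint (hK.1 p h1)] at h2
    exact ⟨h1, hE (circlePoint_mem_equator φ), h2⟩

end Membership

/-! ### Outputs as antipodes of midpoints between inputs -/

theorem circlePoint_neg_pi_add (φ : ℝ) : circlePoint (-Real.pi + φ) = circlePoint (φ + Real.pi) := by
  have : φ + Real.pi = -Real.pi + φ + 2 * Real.pi := by ring
  rw [this]
  simp [circlePoint]

/-- The midpoint of two adjacent inputs that is antipodal to the `i`-th output lies between the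
inputs with (zero-based) indices `antipodeIndex n i` and `antipodeIndex n i + 1`. -/
def antipodeIndex (n i : ℕ) : ℕ := if i + 1 < (n + 1) / 2 then i + n / 2 else i - (n + 1) / 2

theorem outputPoint_middle (n : ℕ) (θ : ℝ) : outputPoint n θ ((n + 1) / 2) =
    boundaryEvent (((n : ℝ) - 1) / 2 * θ) (((n : ℝ) - 1) / 2 * θ) := by
  simp [outputPoint]

theorem outputPoint_eq_antipode {n i : ℕ} (θ : ℝ) (h : i + 1 ≠ (n + 1) / 2) :
    outputPoint n θ (i + 1) = boundaryEvent (Real.pi - θ / 2)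
      (((antipodeIndex n i : ℕ) + 1 / 2) * θ + Real.pi) := by
  rw [outputPoint, if_neg h]
  by_cases hodd : n % 2 = 1
  · obtain ⟨k, rfl⟩ : ∃ k, n = 2 * k + 1 := ⟨n / 2, by omega⟩
    rw [if_pos hodd]
    split_ifs with hi
    · rw [antipodeIndex, if_pos hi, show (2 * k + 1) / 2 = k by omega]
      simp only [boundaryEvent, circlePoint_neg_pi_add]
      congr 3
      push_cast
      ring
    · rw [antipodeIndex, if_neg hi, show (2 * k + 1 + 1) / 2 = k + 1 by omega]
      have : k + 1 ≤ i := by omega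
      simp only [boundaryEvent]
      congr 2
      push_cast [this]
      ring
  · obtain ⟨k, rfl⟩ : ∃ k, n = 2 * k := ⟨n / 2, by omega⟩
    rw [if_neg hodd]
    split_ifs with hi
    · rw [antipodeIndex, if_pos hi, show (2 * k) / 2 = k by omega]
      simp only [boundaryEvent, circlePoint_neg_pi_add]
      congr 3
      push_cast
      ring
    · rw [antipodeIndex, if_neg hi, show (2 * k + 1) / 2 = k by omega]
      have : k ≤ i := by omega
      simp only [boundaryEvent]
      congr 2
      push_cast [this]
      ring

/-- Together with the next two lemmas this makes `antipodeIndex` a bijection from the outputs other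
than the middle one to the `n - 1` midpoints, so conditions on outputs can be indexed by midpoints.
-/
theorem antipodeIndex_lt {n i : ℕ} (hi : i < n) (h : i + 1 ≠ (n + 1) / 2) :
    antipodeIndex n i + 1 < n := by
  unfold antipodeIndex
  split_ifs <;> omega

theorem exists_antipodeIndex_eq {n k : ℕ} (hk : k + 1 < n) :
    ∃ i < n, i + 1 ≠ (n + 1) / 2 ∧ antipodeIndex n i = k := by
  by_cases h : k < n / 2
  · refine ⟨k + (n + 1) / 2, by omega, by omega, ?_⟩
    unfold antipodeIndex
    split_ifs <;> omega
  · refine ⟨k - n / 2, by omega, by omega, ?_⟩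
    unfold antipodeIndex
    split_ifs <;> omega

theorem antipodeIndex_injOn {n i j : ℕ} (hi : i < n) (hj : j < n) (hi' : i + 1 ≠ (n + 1) / 2)
    (hj' : j + 1 ≠ (n + 1) / 2) (h : antipodeIndex n i = antipodeIndex n j) : i = j := by
  unfold antipodeIndex at h
  split_ifs at h <;> omega

/-- The event `(t, p)` is in the past of all outputs. -/
structure InPastOfOutputs (n : ℕ) (θ t : ℝ) (p : E3) : Prop where
  middle : Real.arccos (proj p (((n : ℝ) - 1) / 2 * θ)) ≤ ((n : ℝ) - 1) / 2 * θ - t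
  antipode : ∀ k : ℕ, k + 1 < n → t + θ / 2 ≤ Real.arccos (proj p (((k : ℝ) + 1 / 2) * θ))

section Membership

variable {K : Set E3} (hK : IsGeodesicallyConvex K) (hE : equator ⊆ K) {n : ℕ} {θ x t : ℝ} {p : E3}

include hK hE

theorem mem_causalFuture_inputs {j : Fin n} :
    (t, p) ∈ causalFuture K (inputs n θ x j) ↔
      p ∈ K ∧ Real.arccos (proj p ((j : ℝ) * θ)) ≤ t + x := by
  simp only [inputs, inputPoint, mem_causalFuture_boundaryEvent hK hE]
  push_cast
  rw [add_sub_cancel_right, sub_neg_eq_add]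

theorem mem_causalPast_antipode {i : ℕ} (h : i + 1 ≠ (n + 1) / 2) :
    (t, p) ∈ causalPast K (outputPoint n θ (i + 1)) ↔
      p ∈ K ∧ t + θ / 2 ≤ Real.arccos (proj p (((antipodeIndex n i : ℕ) + 1 / 2) * θ)) := by
  rw [outputPoint_eq_antipode θ h, mem_causalPast_boundaryEvent hK hE, arccos_proj_add_pi]
  constructor
  · rintro ⟨h1, h2⟩
    exact ⟨h1, by linarith⟩
  · rintro ⟨h1, h2⟩
    exact ⟨h1, by linarith⟩

theorem mem_causalPast_middle :
    (t, p) ∈ causalPast K (outputPoint n θ ((n + 1) / 2)) ↔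
      p ∈ K ∧ Real.arccos (proj p (((n : ℝ) - 1) / 2 * θ)) ≤ ((n : ℝ) - 1) / 2 * θ - t := by
  rw [outputPoint_middle, mem_causalPast_boundaryEvent hK hE]

/-- The distances to a midpoint and to its antipode add up to `π`, so being close to an output
becomes being far from a midpoint. -/
theorem forall_mem_causalPast_outputs_iff (hn : 2 ≤ n) (hp : p ∈ K) :
    (∀ i, (t, p) ∈ causalPast K (outputs n θ i)) ↔ InPastOfOutputs n θ t p := by
  constructor
  · intro h
    constructor
    · have h0 := h ⟨(n + 1) / 2 - 1, by omega⟩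
      simp only [outputs] at h0
      rw [show (n + 1) / 2 - 1 + 1 = (n + 1) / 2 by omega] at h0
      exact ((mem_causalPast_middle hK hE).1 h0).2
    · intro k hk
      obtain ⟨i, hi, hi', rfl⟩ := exists_antipodeIndex_eq hk
      exact ((mem_causalPast_antipode hK hE hi').1 (h ⟨i, hi⟩)).2
  · intro h i
    by_cases hi : (i : ℕ) + 1 = (n + 1) / 2
    · simp only [outputs]
      rw [hi, mem_causalPast_middle hK hE]
      exact ⟨hp, h.middle⟩
    · exact (mem_causalPast_antipode hK hE hi).2 ⟨hp, h.antipode _ (antipodeIndex_lt i.2 hi)⟩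

theorem mem_twoToAll_iff (hn : 2 ≤ n) {j k : Fin n} :
    (t, p) ∈ twoToAll (inputs n θ x) (outputs n θ) K j k ↔
      p ∈ K ∧ Real.arccos (proj p ((j : ℝ) * θ)) ≤ t + x ∧
        Real.arccos (proj p ((k : ℝ) * θ)) ≤ t + x ∧ InPastOfOutputs n θ t p := by
  simp only [twoToAll, mem_inter_iff, mem_iInter, mem_causalFuture_inputs hK hE]
  constructor
  · rintro ⟨⟨⟨h1, h2⟩, -, h3⟩, h4⟩
    exact ⟨h1, h2, h3, (forall_mem_causalPast_outputs_iff hK hE hn h1).1 h4⟩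
  · rintro ⟨h1, h2, h3, h4⟩
    exact ⟨⟨⟨h1, h2⟩, h1, h3⟩, (forall_mem_causalPast_outputs_iff hK hE hn h1).2 h4⟩

end Membership

theorem mem_inputRegion_iff {n : ℕ} {θ x t : ℝ} {p : E3} (hn : 2 ≤ n) {j : Fin n} :
    (t, p) ∈ inputRegion (inputs n θ x) (outputs n θ) j ↔
      p ∈ equator ∧ Real.arccos (proj p ((j : ℝ) * θ)) ≤ t + x ∧ InPastOfOutputs n θ t p := by
  have hK := isGeodesicallyConvex_equator
  simp only [inputRegion, mem_inter_iff, mem_iInter, mem_causalFuture_inputs hK Subset.rfl]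
  constructor
  · rintro ⟨⟨h1, h2⟩, h4⟩
    exact ⟨h1, h2, (forall_mem_causalPast_outputs_iff hK Subset.rfl hn h1).1 h4⟩
  · rintro ⟨h1, h2, h4⟩
    exact ⟨⟨h1, h2⟩, (forall_mem_causalPast_outputs_iff hK Subset.rfl hn h1).2 h4⟩

/-! ### Input and output regions in the boundary -/

theorem arccos_cos_eq_abs {y : ℝ} (h : |y| ≤ Real.pi) : Real.arccos (Real.cos y) = |y| := by
  rw [← Real.cos_abs, Real.arccos_cos (abs_nonneg y) h]

theorem arccos_cos_le_abs (y : ℝ) : Real.arccos (Real.cos y) ≤ |y| := by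
  rcases le_total |y| Real.pi with h | h
  · exact (arccos_cos_eq_abs h).le
  · exact (Real.arccos_le_pi _).trans h

theorem min_le_arccos_cos {y : ℝ} (h0 : 0 ≤ y) (h1 : y ≤ 2 * Real.pi) :
    min y (2 * Real.pi - y) ≤ Real.arccos (Real.cos y) := by
  rcases le_total y Real.pi with h | h
  · rw [Real.arccos_cos h0 h]
    exact min_le_left _ _
  · rw [← Real.cos_two_pi_sub, Real.arccos_cos (by linarith) (by linarith)]
    exact min_le_right _ _

theorem exists_eq_circlePoint {p : E3} (hp : p ∈ equator) (ψ : ℝ) :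
    ∃ s, |s| ≤ Real.pi ∧ p = circlePoint (ψ + s) := by
  obtain ⟨hn, h2⟩ := hp
  have hsum : p 0 ^ 2 + p 1 ^ 2 = 1 := by
    have : ‖p‖ ^ 2 = 1 := by rw [hn]; norm_num
    rw [EuclideanSpace.norm_sq_eq, Fin.sum_univ_three, h2] at this
    simpa using this
  obtain ⟨φ, hc, hs⟩ : ∃ φ, Real.cos φ = p 0 ∧ Real.sin φ = p 1 := by
    have hz : ‖(⟨p 0, p 1⟩ : ℂ)‖ = 1 := by
      rw [Complex.norm_def, Complex.normSq_apply]
      simp only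
      rw [← sq, ← sq, hsum, Real.sqrt_one]
    refine ⟨Complex.arg ⟨p 0, p 1⟩, ?_, ?_⟩
    · rw [Complex.cos_arg (by intro h; rw [h] at hz; simp at hz), hz, div_one]
    · rw [Complex.sin_arg, hz, div_one]
  have hmem := toIocMod_mem_Ioc Real.two_pi_pos (-Real.pi) (φ - ψ)
  have heq := toIocMod_add_toIocDiv_zsmul Real.two_pi_pos (-Real.pi) (φ - ψ)
  refine ⟨toIocMod Real.two_pi_pos (-Real.pi) (φ - ψ), abs_le.2 ⟨hmem.1.le, by linarith [hmem.2]⟩,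
    ?_⟩
  set s := toIocMod Real.two_pi_pos (-Real.pi) (φ - ψ)
  set k := toIocDiv Real.two_pi_pos (-Real.pi) (φ - ψ)
  have e : φ = ψ + s + k * (2 * Real.pi) := by
    rw [zsmul_eq_mul] at heq
    linarith
  rw [e] at hc hs
  rw [Real.cos_add_int_mul_two_pi] at hc
  rw [Real.sin_add_int_mul_two_pi] at hs
  ext i
  fin_cases i <;> simp [circlePoint, hc, hs, h2]

theorem arccos_proj_le_add {p : E3} (hp : ‖p‖ = 1) (φ ψ : ℝ) :
    Real.arccos (proj p φ) ≤ Real.arccos (proj p ψ) + Real.arccos (Real.cos (φ - ψ)) := by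
  have := angle_le_angle_add_angle p (circlePoint ψ) (circlePoint φ)
  rw [angle_circlePoint hp, angle_circlePoint hp, angle_circlePoint (norm_circlePoint ψ),
    proj_circlePoint, ← Real.cos_neg, neg_sub] at this
  exact this

theorem arccos_cos_sub_le_add {p : E3} (hp : ‖p‖ = 1) (φ ψ : ℝ) :
    Real.arccos (Real.cos (φ - ψ)) ≤ Real.arccos (proj p φ) + Real.arccos (proj p ψ) := by
  have := angle_le_angle_add_angle (circlePoint φ) p (circlePoint ψ)
  rwa [angle_comm _ p, angle_circlePoint hp, angle_circlePoint hp,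
    angle_circlePoint (norm_circlePoint φ), proj_circlePoint] at this

theorem proj_neg (p : E3) (φ : ℝ) : proj (-p) φ = -proj p φ := by
  simp [proj]
  ring

section Boundary

variable {n : ℕ} {θ x t : ℝ} {p : E3}

/-- Distinct inputs, or distinct midpoints of adjacent inputs, are more than `x` apart. -/
theorem lt_arccos_cos_mul {d : ℝ} (hx0 : 0 < x) (hx : x < θ)
    (h : ((n : ℝ) - 1) * θ + x < 2 * Real.pi) (h1 : 1 ≤ |d|) (h2 : |d| ≤ n - 1) :
    x < Real.arccos (Real.cos (d * θ)) := by
  have hθ : 0 < θ := hx0.trans hx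
  rw [← Real.cos_abs, abs_mul, abs_of_pos hθ]
  have e1 : θ ≤ |d| * θ := by nlinarith
  have e2 : |d| * θ ≤ ((n : ℝ) - 1) * θ := by nlinarith
  refine lt_of_lt_of_le ?_ (min_le_arccos_cos (by linarith) (by linarith))
  exact lt_min (by linarith) (by linarith)

theorem one_le_abs_sub_of_ne {j k : ℕ} (h : j ≠ k) : (1 : ℝ) ≤ |(j : ℝ) - k| := by
  have : (1 : ℤ) ≤ |(j : ℤ) - k| := Int.one_le_abs (by omega)
  exact_mod_cast this

theorem abs_sub_le_of_lt {j k m : ℕ} (hj : j < m) (hk : k < m) : |(j : ℝ) - k| ≤ m - 1 := by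
  have h1 : (j : ℝ) + 1 ≤ m := by exact_mod_cast hj
  have h2 : (k : ℝ) + 1 ≤ m := by exact_mod_cast hk
  rw [abs_le]
  constructor <;> linarith [(j.cast_nonneg : (0 : ℝ) ≤ j), (k.cast_nonneg : (0 : ℝ) ≤ k)]

/-- With `s` the signed displacement from the input, the nearest midpoint on the side of `s` gives
either `|s| ≤ -t` or a displacement of at least `t + θ`; the latter is excluded by `x < θ`. An end
input has no midpoint on its outer side; there the middle output takes over, and the wrapped
alternative is excluded by `(n - 1) * θ + x < 2 * π`. -/
theorem arccos_proj_input_le_neg (hx0 : 0 < x) (hx : x < θ)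
    (h : ((n : ℝ) - 1) * θ + x < 2 * Real.pi) {j : ℕ} (hj : j < n) (hp : p ∈ equator)
    (hC : Real.arccos (proj p ((j : ℝ) * θ)) ≤ t + x) (hR : InPastOfOutputs n θ t p) :
    Real.arccos (proj p ((j : ℝ) * θ)) ≤ -t := by
  obtain ⟨s, hs, rfl⟩ := exists_eq_circlePoint hp (j * θ)
  rw [proj_circlePoint, add_sub_cancel_left, arccos_cos_eq_abs hs] at hC ⊢
  have hmid := hR.middle
  rw [proj_circlePoint] at hmid
  have hanti : ∀ k : ℕ, k + 1 < n → t + θ / 2 ≤ |s + (j - k - 1 / 2) * θ| := by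
    intro k hk
    refine (hR.antipode k hk).trans ?_
    rw [proj_circlePoint]
    refine (arccos_cos_le_abs _).trans (le_of_eq ?_)
    congr 1
    ring
  have hθ : 0 < θ := hx0.trans hx
  rcases le_total 0 s with h0 | h0
  · rw [abs_of_nonneg h0] at hs hC ⊢
    by_cases hl : j + 1 < n
    · have := hanti j hl
      rw [show s + ((j : ℝ) - j - 1 / 2) * θ = s - θ / 2 by ring] at this
      rcases le_total (θ / 2) s with h3 | h3
      · rw [abs_of_nonneg (by linarith)] at this
        linarith
      · rw [abs_of_nonpos (by linarith)] at this
        linarith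
    · have hjn : (j : ℝ) = n - 1 := by
        have : j + 1 = n := by omega
        rw [← this]; push_cast; ring
      have hn1 : 0 ≤ ((n : ℝ) - 1) * θ := by rw [← hjn]; positivity
      rw [hjn, show ((n : ℝ) - 1) * θ + s - ((n : ℝ) - 1) / 2 * θ = ((n : ℝ) - 1) * θ / 2 + s by
        ring] at hmid
      have := (min_le_arccos_cos (y := ((n : ℝ) - 1) * θ / 2 + s) (by linarith)
        (by linarith)).trans hmid
      rcases min_le_iff.1 this with h4 | h4 <;> linarith
  · rw [abs_of_nonpos h0] at hs hC ⊢
    by_cases hl : 0 < j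
    · obtain ⟨k, rfl⟩ : ∃ k, j = k + 1 := ⟨j - 1, by omega⟩
      have := hanti k hj
      rw [show s + (((k + 1 : ℕ) : ℝ) - k - 1 / 2) * θ = s + θ / 2 by push_cast; ring] at this
      rcases le_total 0 (s + θ / 2) with h3 | h3
      · rw [abs_of_nonneg (by linarith)] at this
        linarith
      · rw [abs_of_nonpos (by linarith)] at this
        linarith
    · have hj0 : j = 0 := by omega
      have hn1 : 0 ≤ ((n : ℝ) - 1) * θ := by
        have : (1 : ℝ) ≤ n := by exact_mod_cast (by omega : 1 ≤ n)
        nlinarith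
      rw [hj0, show ((0 : ℕ) : ℝ) * θ + s - ((n : ℝ) - 1) / 2 * θ =
        -(((n : ℝ) - 1) * θ / 2 - s) by push_cast; ring, Real.cos_neg] at hmid
      have := (min_le_arccos_cos (y := ((n : ℝ) - 1) * θ / 2 - s) (by linarith)
        (by linarith)).trans hmid
      rcases min_le_iff.1 this with h4 | h4 <;> linarith

/-- The upper tip `(0, j * θ)` of the diamond precedes every output: it is within `(n - 1) / 2 * θ`
of the middle position and at least `θ / 2` from every midpoint. The triangle inequality carries
this to the past of the tip. -/
theorem inPastOfOutputs_of_arccos_proj_input_le_neg (hθ : 0 < θ)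
    (h : ((n : ℝ) - 1) * θ ≤ 2 * Real.pi) {j : ℕ} (hj : j < n) (hp : p ∈ equator)
    (hC : Real.arccos (proj p ((j : ℝ) * θ)) ≤ -t) : InPastOfOutputs n θ t p := by
  have hj1 : (j : ℝ) + 1 ≤ n := by exact_mod_cast hj
  have hj0 : (0 : ℝ) ≤ j := j.cast_nonneg
  constructor
  · refine (arccos_proj_le_add hp.1 _ (j * θ)).trans ?_
    have : Real.arccos (Real.cos (((n : ℝ) - 1) / 2 * θ - j * θ)) ≤ ((n : ℝ) - 1) / 2 * θ := by
      refine (arccos_cos_le_abs _).trans ?_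
      rw [abs_le]
      constructor <;> nlinarith
    linarith
  · intro k hk
    have hk1 : (k : ℝ) + 2 ≤ n := by exact_mod_cast hk
    have hk0 : (0 : ℝ) ≤ k := k.cast_nonneg
    have h1 := arccos_proj_le_add (norm_circlePoint (j * θ)) (((k : ℝ) + 1 / 2) * θ) (j * θ)
    have h2 := arccos_cos_sub_le_add hp.1 (((k : ℝ) + 1 / 2) * θ) (j * θ)
    have h3 : θ / 2 ≤ Real.arccos (Real.cos (((k : ℝ) + 1 / 2) * θ - j * θ)) := by
      rw [← Real.cos_abs, ← sub_mul, abs_mul, abs_of_pos hθ]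
      have e1 : (1 : ℝ) / 2 ≤ |(k : ℝ) + 1 / 2 - j| := by
        rcases le_or_gt j k with h | h
        · have : (j : ℝ) ≤ k := by exact_mod_cast h
          rw [abs_of_nonneg] <;> linarith
        · have : (k : ℝ) + 1 ≤ j := by exact_mod_cast h
          rw [abs_of_nonpos] <;> linarith
      have e2 : |(k : ℝ) + 1 / 2 - j| ≤ n - 1 - 1 / 2 := by
        rw [abs_le]
        constructor <;> linarith
      refine le_trans (le_min ?_ ?_) (min_le_arccos_cos (by positivity) ?_) <;> nlinarith
    linarith

/-- The time-reversed diamond statement for the middle output. On either side of the output, the end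
input on the opposite side gives the bound, and the route around the circle is too long. -/
theorem arccos_proj_middle_le (hx0 : 0 < x) (hn : 2 ≤ n)
    (h : ((n : ℝ) - 1) * θ + x < 2 * Real.pi) (hθ : 0 < θ) (hp : p ∈ equator)
    (h0 : Real.arccos (proj p (((0 : ℕ) : ℝ) * θ)) ≤ t + x)
    (h1 : Real.arccos (proj p (((n - 1 : ℕ) : ℝ) * θ)) ≤ t + x)
    (hR : Real.arccos (proj p (((n : ℝ) - 1) / 2 * θ)) ≤ ((n : ℝ) - 1) / 2 * θ - t) :
    Real.arccos (proj p (((n : ℝ) - 1) / 2 * θ)) ≤ t + x - ((n : ℝ) - 1) / 2 * θ := by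
  obtain ⟨s, hs, rfl⟩ := exists_eq_circlePoint hp (((n : ℝ) - 1) / 2 * θ)
  have hn2 : (2 : ℝ) ≤ n := by exact_mod_cast hn
  have hB : 0 ≤ ((n : ℝ) - 1) / 2 * θ := mul_nonneg (by linarith) hθ.le
  rw [proj_circlePoint] at h0 h1 hR ⊢
  rw [add_sub_cancel_left, arccos_cos_eq_abs hs] at hR ⊢
  rw [Nat.cast_zero, zero_mul, sub_zero] at h0
  rw [Nat.cast_sub (by omega : 1 ≤ n), Nat.cast_one, show ((n : ℝ) - 1) / 2 * θ + s -
    ((n : ℝ) - 1) * θ = -(((n : ℝ) - 1) / 2 * θ - s) by ring, Real.cos_neg] at h1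
  rcases le_total 0 s with h2 | h2
  · rw [abs_of_nonneg h2] at hs hR ⊢
    have := (min_le_arccos_cos (by linarith) (by linarith)).trans h0
    rcases min_le_iff.1 this with h4 | h4 <;> linarith
  · rw [abs_of_nonpos h2] at hs hR ⊢
    have := (min_le_arccos_cos (by linarith) (by linarith)).trans h1
    rcases min_le_iff.1 this with h4 | h4 <;> linarith

/-- The analogous bound for an output antipodal to a midpoint: the two inputs adjacent to that
midpoint already confine the event to a diamond of duration `x` below the output. -/
theorem pi_sub_arccos_proj_le (hx : x < θ) (hθ : 0 < θ) (hθ' : θ ≤ 2 * Real.pi) {k : ℕ}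
    (hp : p ∈ equator)
    (h0 : Real.arccos (proj p ((k : ℝ) * θ)) ≤ t + x)
    (h1 : Real.arccos (proj p (((k + 1 : ℕ) : ℝ) * θ)) ≤ t + x)
    (hR : t + θ / 2 ≤ Real.arccos (proj p (((k : ℝ) + 1 / 2) * θ))) :
    Real.pi - Real.arccos (proj p (((k : ℝ) + 1 / 2) * θ)) ≤ t + x - Real.pi + θ / 2 := by
  obtain ⟨s, hs, rfl⟩ := exists_eq_circlePoint hp (((k : ℝ) + 1 / 2) * θ)
  rw [proj_circlePoint] at h0 h1 hR ⊢
  rw [add_sub_cancel_left, arccos_cos_eq_abs hs] at hR ⊢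
  rw [show ((k : ℝ) + 1 / 2) * θ + s - k * θ = θ / 2 + s by ring] at h0
  rw [show ((k : ℝ) + 1 / 2) * θ + s - ((k + 1 : ℕ) : ℝ) * θ = -(θ / 2 - s) by push_cast; ring,
    Real.cos_neg] at h1
  rcases le_total 0 s with h2 | h2
  · rw [abs_of_nonneg h2] at hs hR ⊢
    have := (min_le_arccos_cos (by linarith) (by linarith)).trans h0
    rcases min_le_iff.1 this with h4 | h4 <;> linarith
  · rw [abs_of_nonpos h2] at hs hR ⊢
    have := (min_le_arccos_cos (by linarith) (by linarith)).trans h1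
    rcases min_le_iff.1 this with h4 | h4 <;> linarith

theorem neg_mem_equator {p : E3} (hp : p ∈ equator) : -p ∈ equator :=
  ⟨by rw [norm_neg]; exact hp.1, by simp [hp.2]⟩

theorem inputRegion_eq (hn : 2 ≤ n) (hx0 : 0 < x) (hx : x < θ)
    (h : ((n : ℝ) - 1) * θ + x < 2 * Real.pi) (j : Fin n) :
    inputRegion (inputs n θ x) (outputs n θ) j = causalFuture equator (inputs n θ x j) ∩
      causalPast equator (boundaryEvent 0 ((j : ℝ) * θ)) := by
  have hK := isGeodesicallyConvex_equator
  ext ⟨t, p⟩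
  rw [mem_inputRegion_iff hn, mem_inter_iff, mem_causalFuture_inputs hK Subset.rfl,
    mem_causalPast_boundaryEvent hK Subset.rfl, zero_sub]
  constructor
  · rintro ⟨h1, h2, h3⟩
    exact ⟨⟨h1, h2⟩, h1, arccos_proj_input_le_neg hx0 hx h j.2 h1 h2 h3⟩
  · rintro ⟨⟨h1, h2⟩, -, h3⟩
    exact ⟨h1, h2, inPastOfOutputs_of_arccos_proj_input_le_neg (hx0.trans hx) (by linarith) j.2
      h1 h3⟩

/-- At most one output can lie in the future of a boundary event that is in the future of all
inputs. -/
theorem not_mem_causalPast_of_forall_mem_causalFuture (hn : 2 ≤ n) (hx0 : 0 < x) (hx : x < θ)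
    (h : ((n : ℝ) - 1) * θ + x < 2 * Real.pi) (hp : p ∈ equator)
    (hC : ∀ j : Fin n, Real.arccos (proj p ((j : ℝ) * θ)) ≤ t + x) {j k : Fin n} (hjk : j ≠ k)
    (hj : (t, p) ∈ causalPast equator (outputs n θ j)) :
    (t, p) ∉ causalPast equator (outputs n θ k) := by
  intro hk
  have hK := isGeodesicallyConvex_equator
  have hθ : 0 < θ := hx0.trans hx
  have hn2 : (2 : ℝ) ≤ n := by exact_mod_cast hn
  have hθ' : θ ≤ 2 * Real.pi := by nlinarith
  have hC' : ∀ i < n, Real.arccos (proj p ((i : ℝ) * θ)) ≤ t + x := fun i hi => hC ⟨i, hi⟩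
  have middle_antipode : ∀ i : Fin n, (i : ℕ) + 1 ≠ (n + 1) / 2 →
      (t, p) ∈ causalPast equator (outputPoint n θ (i + 1)) →
      (t, p) ∉ causalPast equator (outputPoint n θ ((n + 1) / 2)) := by
    intro i hi h1 h2
    have h1' := ((mem_causalPast_antipode hK Subset.rfl hi).1 h1).2
    have h2' := ((mem_causalPast_middle hK Subset.rfl).1 h2).2
    have hlt := antipodeIndex_lt i.2 hi
    -- The event is confined to the diamond below the middle output, and each midpoint is within `(n
    -- - 2) / 2 * θ` of the middle. Hence its distance to the midpoint is at most `t + x - θ / 2`,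
    -- less than the required `t + θ / 2`.
    set l := antipodeIndex n i
    have h3 := arccos_proj_middle_le hx0 hn h hθ hp (hC' 0 (by omega)) (hC' (n - 1) (by omega)) h2'
    have h4 := arccos_proj_le_add hp.1 (((l : ℝ) + 1 / 2) * θ) (((n : ℝ) - 1) / 2 * θ)
    have hl : (l : ℝ) + 2 ≤ n := by exact_mod_cast hlt
    have hl0 : (0 : ℝ) ≤ l := l.cast_nonneg
    have h5 : Real.arccos (Real.cos (((l : ℝ) + 1 / 2) * θ - ((n : ℝ) - 1) / 2 * θ)) ≤
        ((n : ℝ) - 2) / 2 * θ := by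
      refine (arccos_cos_le_abs _).trans ?_
      rw [abs_le]
      constructor <;> nlinarith
    linarith
  by_cases hj' : (j : ℕ) + 1 = (n + 1) / 2
  · have hk' : (k : ℕ) + 1 ≠ (n + 1) / 2 := fun hk' => hjk (Fin.ext (by omega))
    simp only [outputs] at hj
    rw [hj'] at hj
    exact middle_antipode k hk' hk hj
  by_cases hk' : (k : ℕ) + 1 = (n + 1) / 2
  · simp only [outputs] at hk
    rw [hk'] at hk
    exact middle_antipode j hj' hj hk
  have h1 := ((mem_causalPast_antipode hK Subset.rfl hj').1 hj).2
  have h2 := ((mem_causalPast_antipode hK Subset.rfl hk').1 hk).2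
  have hne : antipodeIndex n j ≠ antipodeIndex n k :=
    fun h => hjk (Fin.ext (antipodeIndex_injOn j.2 k.2 hj' hk' h))
  have hlj := antipodeIndex_lt j.2 hj'
  have hlk := antipodeIndex_lt k.2 hk'
  set a := antipodeIndex n j
  set b := antipodeIndex n k
  have h3 := pi_sub_arccos_proj_le hx hθ hθ' hp (hC' a (by omega)) (hC' (a + 1) hlj) h1
  have h4 := arccos_cos_sub_le_add (neg_mem_equator hp).1 (((a : ℝ) + 1 / 2) * θ)
    (((b : ℝ) + 1 / 2) * θ)
  rw [proj_neg, proj_neg, Real.arccos_neg, Real.arccos_neg] at h4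
  have h5 := lt_arccos_cos_mul hx0 hx h (one_le_abs_sub_of_ne hne)
    (abs_sub_le_of_lt (by omega) (by omega))
  rw [show ((a : ℝ) + 1 / 2) * θ - ((b : ℝ) + 1 / 2) * θ = ((a : ℝ) - b) * θ by ring] at h4
  linarith

theorem boundaryHypotheses (hn : 2 ≤ n) (hx0 : 0 < x) (hx : x < θ)
    (h : ((n : ℝ) - 1) * θ + x < 2 * Real.pi) :
    BoundaryHypotheses (inputs n θ x) (outputs n θ) := by
  have hK := isGeodesicallyConvex_equator
  have hθ : 0 < θ := hx0.trans hx
  have hn2 : (2 : ℝ) ≤ n := by exact_mod_cast hn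
  refine ⟨fun j => ?_, fun j => ?_, fun j k hjk => ?_, fun j k hjk => ?_⟩
  · refine ⟨(0, circlePoint (j * θ)), ?_⟩
    rw [inputRegion_eq hn hx0 hx h, mem_inter_iff, mem_causalFuture_inputs hK Subset.rfl,
      mem_causalPast_boundaryEvent hK Subset.rfl, proj_circlePoint, sub_self, Real.cos_zero,
      Real.arccos_one]
    exact ⟨⟨circlePoint_mem_equator _, by linarith⟩, circlePoint_mem_equator _, by linarith⟩
  · by_cases hj : (j : ℕ) + 1 = (n + 1) / 2
    · refine ⟨boundaryEvent (((n : ℝ) - 1) / 2 * θ) (((n : ℝ) - 1) / 2 * θ), mem_iInter.2 ?_, ?_⟩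
      · intro i
        rw [boundaryEvent, mem_causalFuture_inputs hK Subset.rfl, proj_circlePoint]
        refine ⟨circlePoint_mem_equator _, (arccos_cos_le_abs _).trans ?_⟩
        have hi1 : (i : ℝ) + 1 ≤ n := by exact_mod_cast i.2
        have hi0 : (0 : ℝ) ≤ (i : ℕ) := Nat.cast_nonneg _
        rw [abs_le]
        constructor <;> nlinarith
      · simp only [outputs]
        rw [hj, boundaryEvent, mem_causalPast_middle hK Subset.rfl, proj_circlePoint, sub_self,
          Real.cos_zero, Real.arccos_one]
        exact ⟨circlePoint_mem_equator _, le_rfl⟩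
    · set a := antipodeIndex n j with ha
      refine ⟨boundaryEvent (Real.pi - θ / 2) (((a : ℝ) + 1 / 2) * θ + Real.pi),
        mem_iInter.2 ?_, ?_⟩
      · intro i
        rw [boundaryEvent, mem_causalFuture_inputs hK Subset.rfl, proj_circlePoint]
        refine ⟨circlePoint_mem_equator _, ?_⟩
        rw [add_sub_right_comm, Real.cos_add_pi, Real.arccos_neg]
        have hla := antipodeIndex_lt j.2 hj
        have hR := inPastOfOutputs_of_arccos_proj_input_le_neg (n := n) (θ := θ) (t := 0) hθ
          (by linarith) i.2 (circlePoint_mem_equator ((i : ℕ) * θ))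
          (by rw [proj_circlePoint, sub_self, Real.cos_zero, Real.arccos_one, neg_zero])
        have := hR.antipode a hla
        rw [proj_circlePoint, ← Real.cos_neg, neg_sub] at this
        linarith
      · rw [boundaryEvent, outputs, mem_causalPast_antipode hK Subset.rfl hj, proj_circlePoint,
          ← ha, add_sub_cancel_left, Real.cos_pi, Real.arccos_neg_one]
        exact ⟨circlePoint_mem_equator _, by linarith⟩
  · rw [eq_empty_iff_forall_notMem]
    rintro ⟨t, p⟩ hmem
    rw [mem_twoToAll_iff hK Subset.rfl hn] at hmem
    obtain ⟨hp, h1, h2, h3⟩ := hmem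
    -- The distances to the inputs `j` and `k` are at most `t + x` and `-t`, so their sum is at most
    -- `x`, which is less than the separation of the inputs.
    have h4 := arccos_proj_input_le_neg hx0 hx h k.2 hp h2 h3
    have h5 := arccos_cos_sub_le_add hp.1 ((j : ℕ) * θ) ((k : ℕ) * θ)
    have h6 := lt_arccos_cos_mul hx0 hx h (one_le_abs_sub_of_ne (Fin.val_ne_of_ne hjk))
      (abs_sub_le_of_lt j.2 k.2)
    rw [← sub_mul] at h5
    linarith
  · rw [eq_empty_iff_forall_notMem]
    rintro ⟨t, p⟩ ⟨⟨h1, h2⟩, h3⟩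
    rw [mem_iInter] at h1
    have h1' : ∀ i : Fin n, p ∈ equator ∧ Real.arccos (proj p (((i : ℕ) : ℝ) * θ)) ≤ t + x :=
      fun i => (mem_causalFuture_inputs hK Subset.rfl).1 (h1 i)
    exact not_mem_causalPast_of_forall_mem_causalFuture hn hx0 hx h (h1' j).1 (fun i => (h1' i).2)
      hjk h2 h3

end Boundary

/-! ### Interpolation of sinusoids -/

theorem cos_le_of_arccos_le {y u : ℝ} (hy : |y| ≤ 1) (h : Real.arccos y ≤ u)
    (hu : u ≤ Real.pi) : Real.cos u ≤ y := by
  have := Real.cos_le_cos_of_nonneg_of_le_pi (Real.arccos_nonneg y) hu h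
  rwa [Real.cos_arccos (abs_le.1 hy).1 (abs_le.1 hy).2] at this

theorem le_cos_of_le_arccos {y u : ℝ} (hy : |y| ≤ 1) (hu : 0 ≤ u) (h : u ≤ Real.arccos y) :
    y ≤ Real.cos u := by
  have := Real.cos_le_cos_of_nonneg_of_le_pi hu (Real.arccos_le_pi y) h
  rwa [Real.cos_arccos (abs_le.1 hy).1 (abs_le.1 hy).2] at this

theorem arccos_le_of_cos_le {y u : ℝ} (hu : 0 ≤ u) (hu' : u ≤ Real.pi) (h : Real.cos u ≤ y) :
    Real.arccos y ≤ u := by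
  rw [← Real.arccos_cos hu hu']
  exact Real.arccos_le_arccos h

theorem le_arccos_of_le_cos {y u : ℝ} (hu : 0 ≤ u) (hu' : u ≤ Real.pi) (h : y ≤ Real.cos u) :
    u ≤ Real.arccos y := by
  rw [← Real.arccos_cos hu hu']
  exact Real.arccos_le_arccos h

/-- Sinusoids form a two-dimensional space, so two values determine a third. The weights are
nonnegative on arcs of length at most `π`, which makes this the counterpart of linear interpolation.
-/
theorem sin_add_mul_sinusoid (a b ψ α β : ℝ) :
    Real.sin (α + β) * (a * Real.cos ψ + b * Real.sin ψ) =
      Real.sin β * (a * Real.cos (ψ - α) + b * Real.sin (ψ - α)) +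
        Real.sin α * (a * Real.cos (ψ + β) + b * Real.sin (ψ + β)) := by
  simp only [Real.sin_add, Real.cos_add, Real.sin_sub, Real.cos_sub]
  ring

/-- A sinusoid that is at least `c > 0` at the ends of an arc of length at most `π` is at least
`c` on the whole arc. -/
theorem le_proj_of_mem_arc {p : E3} {c ψ α β : ℝ} (hc : 0 < c) (hα : 0 ≤ α) (hβ : 0 ≤ β)
    (hαβ : α + β ≤ Real.pi) (h1 : c ≤ proj p (ψ - α)) (h2 : c ≤ proj p (ψ + β)) :
    c ≤ proj p ψ := by
  rcases hαβ.eq_or_lt with h | h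
  · rw [show ψ + β = ψ - α + Real.pi by linarith, proj_add_pi] at h2
    linarith
  rcases hα.eq_or_lt with h0 | h0
  · simpa [← h0] using h1
  have hs : 0 < Real.sin (α + β) := Real.sin_pos_of_pos_of_lt_pi (by linarith) h
  have hsα : 0 ≤ Real.sin α := Real.sin_nonneg_of_nonneg_of_le_pi hα (by linarith)
  have hsβ : 0 ≤ Real.sin β := Real.sin_nonneg_of_nonneg_of_le_pi hβ (by linarith)
  have key := sin_add_mul_sinusoid (p 0) (p 1) ψ α β
  change Real.sin (α + β) * proj p ψ = Real.sin β * proj p (ψ - α) +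
    Real.sin α * proj p (ψ + β) at key
  -- The weights add up to at least the left-hand factor. This is where `c > 0` is needed: a
  -- negative lower bound would not survive.
  have hle : Real.sin (α + β) ≤ Real.sin α + Real.sin β := by
    rw [Real.sin_add]
    nlinarith [Real.cos_le_one α, Real.cos_le_one β]
  refine le_of_mul_le_mul_left ?_ hs
  rw [key]
  nlinarith

/-- A sinusoid that is positive at the ends of an interval of length less than `π` is positive on
the whole interval. -/
theorem sinusoid_pos_of_mem_Icc {a b s₁ s₂ s : ℝ} (h1 : 0 < a * Real.cos s₁ + b * Real.sin s₁)
    (h2 : 0 < a * Real.cos s₂ + b * Real.sin s₂) (hs1 : s₁ ≤ s) (hs2 : s ≤ s₂)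
    (h : s₂ - s₁ < Real.pi) : 0 < a * Real.cos s + b * Real.sin s := by
  rcases hs1.eq_or_lt with rfl | hs1
  · exact h1
  have key := sin_add_mul_sinusoid a b s (s - s₁) (s₂ - s)
  rw [sub_sub_cancel, add_sub_cancel] at key
  have hs : 0 < Real.sin (s - s₁ + (s₂ - s)) :=
    Real.sin_pos_of_pos_of_lt_pi (by linarith) (by linarith)
  have hα : 0 < Real.sin (s - s₁) := Real.sin_pos_of_pos_of_lt_pi (by linarith) (by linarith)
  have hβ : 0 ≤ Real.sin (s₂ - s) :=
    Real.sin_nonneg_of_nonneg_of_le_pi (by linarith) (by linarith)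
  refine pos_of_mul_pos_right ?_ hs.le
  rw [key]
  exact add_pos_of_nonneg_of_pos (mul_nonneg hβ h1.le) (mul_pos hα h2)

theorem proj_sub_two_pi (p : E3) (φ : ℝ) : proj p (φ - 2 * Real.pi) = proj p φ := by
  simp [proj]

theorem proj_sub_add_proj_add (p : E3) (φ a : ℝ) :
    proj p (φ - a) + proj p (φ + a) = 2 * (proj p φ * Real.cos a) := by
  simp only [proj, Real.cos_add, Real.sin_add, Real.cos_sub, Real.sin_sub]
  ring

/-! ### Large spacing -/

section LargeSpacing

variable {n : ℕ} {θ x t : ℝ} {p : E3}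

/-- The pole is at distance `π / 2` from the whole boundary. Time `π / 2 - θ / 2` is the latest
allowed by the midpoint conditions, and the middle output then amounts to `2 * π ≤ n * θ`. -/
theorem twoToAll_nonempty_of_le (hn : 2 ≤ n) (hx : θ ≤ 2 * x) (hθ : 2 * Real.pi / n ≤ θ)
    (j k : Fin n) : (twoToAll (inputs n θ x) (outputs n θ) hemisphere j k).Nonempty := by
  have hn2 : (2 : ℝ) ≤ n := by exact_mod_cast hn
  have hθ' : 2 * Real.pi ≤ θ * n := (div_le_iff₀ (by linarith)).1 hθ
  have hp : ∀ φ, Real.arccos (proj !₂[(0 : ℝ), 0, 1] φ) = Real.pi / 2 := by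
    intro φ
    simp [proj]
  refine ⟨(Real.pi / 2 - θ / 2, !₂[0, 0, 1]), ?_⟩
  rw [mem_twoToAll_iff isGeodesicallyConvex_hemisphere equator_subset_hemisphere hn, hp, hp]
  refine ⟨?_, by linarith, by linarith, ?_, fun k _ => ?_⟩
  · simp [hemisphere, EuclideanSpace.norm_eq, Fin.sum_univ_three]
  · rw [hp]
    linarith
  · rw [hp]
    linarith

/-- The sinusoid would have to be smaller at the midpoints than at the inputs `j` and `k`. The sign
of the lower bound `cos (t + x)` decides which interpolation gives the contradiction. -/
theorem not_mem_twoToAll_of_lt (hx0 : 0 < x) (hx : x < θ / 2) (hπ : θ < Real.pi)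
    (h : ((n : ℝ) - 1) * θ ≤ 2 * Real.pi) (hp : ‖p‖ = 1) {j k : ℕ} (hjk : j < k) (hk : k < n)
    (hends : ¬ (j = 0 ∧ k = n - 1))
    (hCj : Real.arccos (proj p ((j : ℝ) * θ)) ≤ t + x)
    (hCk : Real.arccos (proj p ((k : ℝ) * θ)) ≤ t + x) : ¬ InPastOfOutputs n θ t p := by
  intro hR
  have hθ : 0 < θ := by linarith
  have ht : 0 ≤ t + x := (Real.arccos_nonneg _).trans hCj
  have htπ : t + θ / 2 ≤ Real.pi :=
    (hR.antipode j (by omega)).trans (Real.arccos_le_pi _)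
  have hA : 0 < Real.cos (θ / 2) := Real.cos_pos_of_mem_Ioo ⟨by linarith, by linarith⟩
  have hlt : Real.cos (t + θ / 2) < Real.cos (t + x) :=
    Real.cos_lt_cos_of_nonneg_of_le_pi ht htπ (by linarith)
  have hR' : ∀ l : ℕ, l + 1 < n → proj p (((l : ℝ) + 1 / 2) * θ) ≤ Real.cos (t + θ / 2) :=
    fun l hl => le_cos_of_le_arccos (abs_proj_le_one hp _) (by linarith) (hR.antipode l hl)
  have hj' := cos_le_of_arccos_le (abs_proj_le_one hp _) hCj (by linarith)
  have hk' := cos_le_of_arccos_le (abs_proj_le_one hp _) hCk (by linarith)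
  rcases le_or_gt (Real.cos (t + x)) 0 with hc | hc
  -- Nonpositive bound: the values at the two midpoints around an interior input average to its
  -- value times `cos (θ / 2)`, and shrinking does not push this below `cos (t + x)`. Since `j` and
  -- `k` are not the two ends, one of them is interior.
  · have interior : ∀ v : ℕ, 0 < v → v + 1 < n → ¬ Real.cos (t + x) ≤ proj p ((v : ℝ) * θ) := by
      intro v hv hvn hle
      obtain ⟨w, rfl⟩ : ∃ w, v = w + 1 := ⟨v - 1, by omega⟩
      have h1 := hR' w (by omega)
      have h2 := hR' (w + 1) hvn
      have h3 := proj_sub_add_proj_add p (((w + 1 : ℕ) : ℝ) * θ) (θ / 2)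
      rw [show ((w + 1 : ℕ) : ℝ) * θ - θ / 2 = ((w : ℝ) + 1 / 2) * θ by push_cast; ring,
        show ((w + 1 : ℕ) : ℝ) * θ + θ / 2 = (((w + 1 : ℕ) : ℝ) + 1 / 2) * θ by ring] at h3
      nlinarith [Real.cos_le_one (θ / 2)]
    by_cases hj0 : j = 0
    · exact interior k (by omega) (by omega) hk'
    · exact interior j (by omega) (by omega) hj'
  · have hjk' : (j : ℝ) + 1 ≤ k := by exact_mod_cast hjk
    have hkn : (k : ℝ) + 1 ≤ n := by exact_mod_cast hk
    have hj0 : (0 : ℝ) ≤ j := j.cast_nonneg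
    rcases le_total (((k : ℝ) - j) * θ) Real.pi with hπ' | hπ'
    -- Positive bound: the shorter arc between the two inputs contains a midpoint. If it is the
    -- direct arc, the midpoint just after `j` serves; otherwise it is the one just after `k`, or
    -- just before `j` when `k` is the last input.
    · have := le_proj_of_mem_arc (p := p) (ψ := ((j : ℝ) + 1 / 2) * θ) (α := θ / 2)
        (β := ((k : ℝ) - j - 1 / 2) * θ) hc (by linarith)
        (mul_nonneg (by linarith) hθ.le) (by linarith)
        (by rwa [show ((j : ℝ) + 1 / 2) * θ - θ / 2 = j * θ by ring])
        (by rwa [show ((j : ℝ) + 1 / 2) * θ + ((k : ℝ) - j - 1 / 2) * θ = k * θ by ring])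
      linarith [hR' j (by omega)]
    · by_cases hkl : k + 1 < n
      · have hkl' : (k : ℝ) + 2 ≤ n := by exact_mod_cast hkl
        have := le_proj_of_mem_arc (p := p) (ψ := ((k : ℝ) + 1 / 2) * θ) (α := θ / 2)
          (β := j * θ + 2 * Real.pi - ((k : ℝ) + 1 / 2) * θ) hc (by linarith)
          (by nlinarith) (by linarith)
          (by rwa [show ((k : ℝ) + 1 / 2) * θ - θ / 2 = k * θ by ring])
          (by rwa [add_sub_cancel, proj_add_two_pi])
        linarith [hR' k hkl]
      · obtain ⟨l, rfl⟩ : ∃ l, j = l + 1 := ⟨j - 1, by omega⟩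
        push_cast at *
        have hl0 : (0 : ℝ) ≤ l := l.cast_nonneg
        have := le_proj_of_mem_arc (p := p) (ψ := ((l : ℝ) + 1 / 2) * θ) (β := θ / 2)
          (α := ((l : ℝ) + 1 / 2) * θ - (k * θ - 2 * Real.pi)) hc
          (by nlinarith) (by linarith) (by linarith)
          (by rwa [sub_sub_cancel, proj_sub_two_pi])
          (by rwa [show ((l : ℝ) + 1 / 2) * θ + θ / 2 = (l + 1) * θ by ring])
        linarith [hR' l (by omega)]

theorem lt_pi_of_three_le (hn : 3 ≤ n) (hx0 : 0 < x) (h : ((n : ℝ) - 1) * θ + x ≤ 2 * Real.pi) :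
    θ < Real.pi := by
  have hn2 : (3 : ℝ) ≤ n := by exact_mod_cast hn
  rcases le_or_gt θ 0 with h0 | h0
  · exact h0.trans_lt Real.pi_pos
  · nlinarith

theorem le_of_twoToAll_nonempty (hx0 : 0 < x) (h : ((n : ℝ) - 1) * θ + x ≤ 2 * Real.pi)
    {j k : Fin n} (hjk : j < k) (hends : ¬ ((j : ℕ) = 0 ∧ (k : ℕ) = n - 1))
    (hne : (twoToAll (inputs n θ x) (outputs n θ) hemisphere j k).Nonempty) : θ ≤ 2 * x := by
  by_contra! hx
  obtain ⟨⟨t, p⟩, hmem⟩ := hne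
  have hjk' : (j : ℕ) < k := hjk
  have hn : 3 ≤ n := by omega
  rw [mem_twoToAll_iff isGeodesicallyConvex_hemisphere equator_subset_hemisphere (by omega)]
    at hmem
  obtain ⟨hp, h1, h2, h3⟩ := hmem
  exact not_mem_twoToAll_of_lt hx0 (by linarith) (lt_pi_of_three_le hn hx0 h) (by linarith) hp.1
    hjk k.2 hends h1 h2 h3

theorem twoToAll_comm (c r : Fin n → Event) (K : Set E3) (j k : Fin n) :
    twoToAll c r K j k = twoToAll c r K k j := by
  rw [twoToAll, inter_comm (causalFuture K (c j)), twoToAll]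

theorem le_of_spacedGraph_connected (hn : 2 ≤ n) (hx0 : 0 < x)
    (h : ((n : ℝ) - 1) * θ + x ≤ 2 * Real.pi) (hθ : 2 * Real.pi / n ≤ θ) (hθ' : θ ≤ Real.pi)
    (hconn : (spacedGraph n θ x).Connected) : θ ≤ 2 * x := by
  have : Nontrivial (Fin n) := Fin.nontrivial_iff_two_le.2 hn
  -- For `n ≥ 3` the vertex with index `1` is not the pair's first end, nor its last, so no edge at
  -- it joins the two end inputs.
  obtain ⟨w, hw⟩ := hconn.preconnected.exists_adj_of_nontrivial (⟨1, by omega⟩ : Fin n)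
  obtain ⟨hne, hmem⟩ := hw
  rcases hn.eq_or_lt with rfl | hn3
  -- For `n = 2` the only pair is the end pair. The inputs are antipodal, so their distances add up
  -- to `π`; the two outputs constrain the distance to the same midpoint from both sides and force
  -- `t ≤ 0`.
  · have hθπ : θ = Real.pi := by
      push_cast at hθ
      linarith
    subst hθπ
    obtain ⟨⟨t, p⟩, hmem⟩ := hmem
    rw [mem_twoToAll_iff isGeodesicallyConvex_hemisphere equator_subset_hemisphere le_rfl] at hmem
    obtain ⟨hp, h1, h2, h3⟩ := hmem
    have hw0 : (w : ℕ) = 0 := by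
      have : (w : ℕ) ≠ 1 := fun h => hne (Fin.ext h.symm)
      omega
    have h4 := h3.middle
    have h5 := h3.antipode 0 (by norm_num)
    rw [hw0] at h2
    have h6 := arccos_proj_add_pi p 0
    norm_num at h1 h2 h4 h5 h6
    linarith
  · rcases lt_or_gt_of_ne hne with hlt | hlt
    · exact le_of_twoToAll_nonempty hx0 h hlt (by simp) hmem
    · rw [twoToAll_comm] at hmem
      refine le_of_twoToAll_nonempty hx0 h hlt ?_ hmem
      simp only [not_and]
      omega

theorem spacedGraph_connected_of_forall_succ (hn : 2 ≤ n)
    (h : ∀ j k : Fin n, (k : ℕ) = j + 1 →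
      (twoToAll (inputs n θ x) (outputs n θ) hemisphere j k).Nonempty) :
    (spacedGraph n θ x).Connected := by
  have : Nonempty (Fin n) := ⟨⟨0, by omega⟩⟩
  have key : ∀ k (hk : k < n), (spacedGraph n θ x).Reachable ⟨0, by omega⟩ ⟨k, hk⟩ := by
    intro k
    induction k with
    | zero => intro _; exact SimpleGraph.Reachable.refl _
    | succ k ih =>
      intro hk
      refine (ih (by omega)).trans (SimpleGraph.Adj.reachable ⟨?_, h _ _ rfl⟩)
      simp
  exact ⟨fun a b => (key a a.2).symm.trans (key b b.2)⟩

theorem spacedGraph_connected_iff_of_large (hn : 2 ≤ n) (hx0 : 0 < x)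
    (h : ((n : ℝ) - 1) * θ + x ≤ 2 * Real.pi) (hθ : 2 * Real.pi / n ≤ θ) (hθ' : θ ≤ Real.pi) :
    (spacedGraph n θ x).Connected ↔ θ ≤ 2 * x :=
  ⟨le_of_spacedGraph_connected hn hx0 h hθ hθ', fun hx =>
    spacedGraph_connected_of_forall_succ hn fun j k _ => twoToAll_nonempty_of_le hn hx hθ j k⟩

end LargeSpacing

/-! ### The critical scattering event -/

/-- The denominator of the tangent of the critical time. -/
noncomputable def criticalDen (A D : ℝ) : ℝ :=
  Real.cos A * Real.sin D + 2 * Real.cos D * Real.sin A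

/-- The time of the critical scattering event above the midpoint of two inputs that are `2 * A`
apart, if the middle output lies above a point at distance `D` from that midpoint. -/
noncomputable def criticalTime (A D : ℝ) : ℝ :=
  Real.arctan (Real.sin A * Real.sin D / criticalDen A D)

/-- The least `x` for which the critical scattering event is in the future of both inputs. -/
noncomputable def criticalSize (A D : ℝ) : ℝ :=
  Real.arccos (Real.cos (criticalTime A D + A) * Real.cos A) - criticalTime A D

section Critical

variable {A D : ℝ} (hA : 0 < A) (hD : 0 ≤ D) (h : D + 2 * A < Real.pi)

include hA hD h

theorem sin_pos_of_small : 0 < Real.sin A := Real.sin_pos_of_pos_of_lt_pi hA (by linarith)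

theorem cos_pos_of_small : 0 < Real.cos A := Real.cos_pos_of_mem_Ioo ⟨by linarith, by linarith⟩

theorem cos_lt_one_of_small : Real.cos A < 1 := by
  have := sin_pos_of_small hA hD h
  nlinarith [Real.sin_sq_add_cos_sq A, Real.cos_le_one A, cos_pos_of_small hA hD h]

/-- Multiplication by `cos A` exhibits the denominator as `sin (D + 2 * A)` plus a nonnegative term.
-/
theorem criticalDen_pos : 0 < criticalDen A D := by
  have hs : 0 < Real.sin (D + 2 * A) := Real.sin_pos_of_pos_of_lt_pi (by linarith) h
  have hsD : 0 ≤ Real.sin D := Real.sin_nonneg_of_nonneg_of_le_pi hD (by linarith)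
  have key : Real.cos A * criticalDen A D = Real.sin (D + 2 * A) + Real.sin D * Real.sin A ^ 2 := by
    rw [criticalDen, Real.sin_add, Real.sin_two_mul, Real.cos_two_mul]
    linear_combination (-Real.sin D) * Real.sin_sq_add_cos_sq A
  refine pos_of_mul_pos_right ?_ (cos_pos_of_small hA hD h).le
  rw [key]
  positivity

theorem criticalTime_nonneg : 0 ≤ criticalTime A D := by
  refine Real.arctan_nonneg.2 (div_nonneg (mul_nonneg (sin_pos_of_small hA hD h).le ?_)
    (criticalDen_pos hA hD h).le)
  exact Real.sin_nonneg_of_nonneg_of_le_pi hD (by linarith)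

theorem criticalTime_pos (hD' : 0 < D) : 0 < criticalTime A D := by
  refine Real.arctan_pos.2 (div_pos (mul_pos (sin_pos_of_small hA hD h) ?_)
    (criticalDen_pos hA hD h))
  exact Real.sin_pos_of_pos_of_lt_pi hD' (by linarith)

omit hA hD h in
theorem cos_criticalTime_pos : 0 < Real.cos (criticalTime A D) := Real.cos_arctan_pos _

theorem sin_criticalTime_mul : Real.sin (criticalTime A D) * criticalDen A D =
    Real.cos (criticalTime A D) * (Real.sin A * Real.sin D) := by
  have h1 : Real.tan (criticalTime A D) = _ := Real.tan_arctan _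
  rw [Real.tan_eq_sin_div_cos, div_eq_div_iff cos_criticalTime_pos.ne'
    (criticalDen_pos hA hD h).ne'] at h1
  linarith

theorem cos_criticalTime_add_mul : Real.cos (criticalTime A D + A) * criticalDen A D =
    Real.cos (criticalTime A D) * Real.sin (D + 2 * A) := by
  have h1 := sin_criticalTime_mul hA hD h
  rw [Real.cos_add, Real.sin_add, Real.sin_two_mul, Real.cos_two_mul]
  rw [sub_mul, mul_right_comm (Real.sin _), h1, criticalDen]
  linear_combination (-Real.cos (criticalTime A D) * Real.sin D) * Real.sin_sq_add_cos_sq A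

theorem sin_criticalTime_add_mul : Real.sin (criticalTime A D + A) * criticalDen A D =
    2 * Real.cos (criticalTime A D) * Real.sin A * Real.sin (D + A) := by
  have h1 := sin_criticalTime_mul hA hD h
  rw [Real.sin_add, Real.sin_add, add_mul, mul_right_comm (Real.sin _), h1, criticalDen]
  ring

theorem cos_criticalTime_add_pos : 0 < Real.cos (criticalTime A D + A) := by
  have hs : 0 < Real.sin (D + 2 * A) := Real.sin_pos_of_pos_of_lt_pi (by linarith) h
  refine pos_of_mul_pos_left ?_ (criticalDen_pos hA hD h).le
  rw [cos_criticalTime_add_mul hA hD h]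
  exact mul_pos cos_criticalTime_pos hs

theorem criticalTime_add_lt : criticalTime A D + A < Real.pi / 2 := by
  by_contra! hle
  have h1 : criticalTime A D < Real.pi / 2 := Real.arctan_lt_pi_div_two _
  have := Real.cos_nonpos_of_pi_div_two_le_of_le hle (by linarith)
  linarith [cos_criticalTime_add_pos hA hD h]

theorem cos_criticalTime_add_criticalSize :
    Real.cos (criticalTime A D + criticalSize A D) =
      Real.cos (criticalTime A D + A) * Real.cos A := by
  have h1 := cos_criticalTime_add_pos hA hD h
  have h2 := cos_pos_of_small hA hD h
  rw [criticalSize, add_sub_cancel, Real.cos_arccos]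
  · linarith [mul_pos h1 h2]
  · nlinarith [Real.cos_le_one (criticalTime A D + A), Real.cos_le_one A]

omit hA hD h in
theorem criticalTime_add_criticalSize_nonneg : 0 ≤ criticalTime A D + criticalSize A D := by
  rw [criticalSize, add_sub_cancel]
  exact Real.arccos_nonneg _

theorem criticalTime_add_criticalSize_lt : criticalTime A D + criticalSize A D < Real.pi / 2 := by
  rw [criticalSize, add_sub_cancel, Real.arccos_lt_pi_div_two]
  exact mul_pos (cos_criticalTime_add_pos hA hD h) (cos_pos_of_small hA hD h)

/-- The defining equation of the critical time: the point above the midpoint at distance `t + A`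
from it, hence lightlike to the antipodal output, is also lightlike to the middle output. Solved for
`tan t` it gives the formula in `criticalTime`. -/
theorem cos_criticalTime_add_mul_cos : Real.cos (criticalTime A D + A) * Real.cos D =
    Real.cos (D + A - criticalTime A D) := by
  have h1 := sin_criticalTime_mul hA hD h
  have h2 := cos_criticalTime_add_mul hA hD h
  refine mul_right_cancel₀ (criticalDen_pos hA hD h).ne' ?_
  rw [mul_right_comm, h2, Real.cos_sub, add_mul, mul_assoc (Real.sin (D + A)), h1, criticalDen,
    mul_right_comm]
  simp only [Real.cos_add, Real.sin_add, Real.sin_two_mul, Real.cos_two_mul]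
  linear_combination (Real.cos (criticalTime A D) * Real.sin D * Real.cos D) *
    Real.sin_sq_add_cos_sq A

/-- At the critical time and size the inequality obtained from one input and the middle output is an
equality. This fixes the sign at the left endpoint in the late-time half of
`false_of_lt_criticalSize`. -/
theorem sin_mul_cos_criticalTime_add : Real.sin D * (Real.cos (criticalTime A D + A) * Real.cos A) =
    Real.sin D * Real.cos (criticalTime A D) -
      2 * Real.sin A * Real.sin (D + A) * Real.sin (criticalTime A D) := by
  have h1 := sin_criticalTime_mul hA hD h
  have h2 := cos_criticalTime_add_mul hA hD h
  refine mul_right_cancel₀ (criticalDen_pos hA hD h).ne' ?_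
  rw [mul_assoc (Real.sin D), mul_right_comm (Real.cos _), h2, sub_mul,
    mul_assoc _ (Real.sin _) (criticalDen A D), h1, criticalDen]
  simp only [Real.sin_add, Real.sin_two_mul, Real.cos_two_mul]
  linear_combination (2 * Real.sin D * Real.cos (criticalTime A D) * (Real.cos A * Real.sin D +
    Real.sin A * Real.cos D)) * Real.sin_sq_add_cos_sq A

theorem lt_criticalSize : A < criticalSize A D := by
  have h0 := criticalTime_nonneg hA hD h
  have h1 := criticalTime_add_lt hA hD h
  have h2 := cos_criticalTime_add_pos hA hD h
  have h3 := cos_criticalTime_add_criticalSize hA hD h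
  have h4 := cos_lt_one_of_small hA hD h
  by_contra! hle
  have := Real.cos_le_cos_of_nonneg_of_le_pi
    (criticalTime_add_criticalSize_nonneg (A := A) (D := D)) (by linarith)
    (by linarith : criticalTime A D + criticalSize A D ≤ criticalTime A D + A)
  nlinarith

theorem criticalSize_lt_two_mul : criticalSize A D < 2 * A := by
  have h0 := criticalTime_nonneg hA hD h
  have h1 := criticalTime_add_lt hA hD h
  have h3 := cos_criticalTime_add_criticalSize hA hD h
  have h4 := criticalTime_add_criticalSize_lt hA hD h
  by_contra! hle
  have := Real.cos_le_cos_of_nonneg_of_le_pi (by linarith) (by linarith)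
    (by linarith : criticalTime A D + 2 * A ≤ criticalTime A D + criticalSize A D)
  rw [h3, show criticalTime A D + 2 * A = criticalTime A D + A + A by ring,
    Real.cos_add (criticalTime A D + A)] at this
  have h5 : 0 < Real.sin (criticalTime A D + A) :=
    Real.sin_pos_of_pos_of_lt_pi (by linarith) (by linarith)
  nlinarith [mul_pos h5 (sin_pos_of_small hA hD h)]

/-- Divided by the companion cosine identity below, this gives `tan (D / 2 - t) * tan (D / 2 + A) =
tan (D / 2) ^ 2` at the critical time `t`. -/
theorem sin_half_sub_criticalTime_mul : Real.sin (D / 2 - criticalTime A D) * criticalDen A D =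
    2 * Real.cos (criticalTime A D) * Real.sin (D / 2) ^ 2 * Real.cos (D / 2 + A) := by
  have h1 := sin_criticalTime_mul hA hD h
  obtain ⟨E, rfl⟩ : ∃ E, D = 2 * E := ⟨D / 2, by ring⟩
  rw [mul_div_cancel_left₀ _ two_ne_zero]
  rw [Real.sin_sub, sub_mul, mul_assoc (Real.cos E), h1, criticalDen, Real.sin_two_mul,
    Real.cos_two_mul', Real.cos_add]
  ring

theorem cos_half_sub_criticalTime_mul : Real.cos (D / 2 - criticalTime A D) * criticalDen A D =
    2 * Real.cos (criticalTime A D) * Real.cos (D / 2) ^ 2 * Real.sin (D / 2 + A) := by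
  have h1 := sin_criticalTime_mul hA hD h
  obtain ⟨E, rfl⟩ : ∃ E, D = 2 * E := ⟨D / 2, by ring⟩
  rw [mul_div_cancel_left₀ _ two_ne_zero]
  rw [Real.cos_sub, add_mul, mul_assoc (Real.sin E), h1, criticalDen, Real.sin_two_mul,
    Real.cos_two_mul', Real.sin_add]
  ring

/-- The claim is equivalent to a comparison of `sin (D / 2 - t)` with `cos (t + x)` at the critical
values. With `E = D / 2` it reduces to `sin E ^ 2` being less than the mean of `sin E` and `sin (E +
2 * A)`. The bound keeps the threshold equation on one branch of the tangent. -/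
theorem criticalSize_add_half_lt : criticalSize A D + D / 2 < Real.pi / 2 := by
  have h3 := cos_criticalTime_add_criticalSize hA hD h
  have hlt : Real.sin (D / 2 - criticalTime A D) <
      Real.cos (criticalTime A D + A) * Real.cos A := by
    refine lt_of_mul_lt_mul_right ?_ (criticalDen_pos hA hD h).le
    rw [sin_half_sub_criticalTime_mul hA hD h, mul_right_comm (Real.cos _),
      cos_criticalTime_add_mul hA hD h]
    obtain ⟨E, rfl⟩ : ∃ E, D = 2 * E := ⟨D / 2, by ring⟩
    rw [mul_div_cancel_left₀ _ two_ne_zero, show 2 * E + 2 * A = 2 * (E + A) by ring,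
      Real.sin_two_mul]
    have hc : 0 < Real.cos (E + A) := Real.cos_pos_of_mem_Ioo ⟨by linarith, by linarith⟩
    have hs : Real.sin E ^ 2 < Real.sin (E + A) * Real.cos A := by
      have e1 : Real.sin (E + A) * Real.cos A = (Real.sin E + Real.sin (E + 2 * A)) / 2 := by
        rw [Real.sin_add, Real.sin_add, Real.sin_two_mul, Real.cos_two_mul]
        ring
      have e2 : Real.sin E < Real.sin (E + 2 * A) := by
        rcases le_total (E + 2 * A) (Real.pi / 2) with h5 | h5
        · exact Real.sin_lt_sin_of_lt_of_le_pi_div_two (by linarith) h5 (by linarith)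
        · rw [← Real.sin_pi_sub (E + 2 * A)]
          exact Real.sin_lt_sin_of_lt_of_le_pi_div_two (by linarith) (by linarith) (by linarith)
      have e3 : 0 ≤ Real.sin E := Real.sin_nonneg_of_nonneg_of_le_pi (by linarith) (by linarith)
      nlinarith [Real.sin_le_one E]
    have := mul_lt_mul_of_pos_left hs (mul_pos (cos_criticalTime_pos (A := A) (D := 2 * E)) hc)
    linarith
  by_contra! hle
  rw [← h3, ← Real.cos_pi_div_two_sub] at hlt
  have h0 := criticalTime_nonneg hA hD h
  have := Real.cos_le_cos_of_nonneg_of_le_pi (by linarith)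
    (by linarith [criticalTime_add_criticalSize_lt hA hD h])
    (by linarith : Real.pi / 2 - (D / 2 - criticalTime A D) ≤ criticalTime A D + criticalSize A D)
  linarith

/-- The quotient under the root is `tan (t + A) / sin A` at the critical time `t`. The square of the
left side then collapses to `1 / (cos (t + A) * cos A) ^ 2 - 1`, and the product in the denominator
is the cosine that defines the critical size. -/
theorem sqrt_mul_tan_eq : √(1 + (2 * Real.sin (D + A) / Real.sin (D + 2 * A)) ^ 2) * Real.tan A =
    Real.tan (criticalTime A D + criticalSize A D) := by
  have hQ := criticalDen_pos hA hD h
  have hs : 0 < Real.sin (D + 2 * A) := Real.sin_pos_of_pos_of_lt_pi (by linarith) h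
  have hsA := sin_pos_of_small hA hD h
  have hcA := cos_pos_of_small hA hD h
  have hc := cos_criticalTime_add_pos hA hD h
  have hct := cos_criticalTime_pos (A := A) (D := D)
  have h0 : 0 ≤ Real.tan (criticalTime A D + criticalSize A D) :=
    Real.tan_nonneg_of_nonneg_of_le_pi_div_two criticalTime_add_criticalSize_nonneg
      (criticalTime_add_criticalSize_lt hA hD h).le
  have h1 : 0 < Real.tan A := by rw [Real.tan_eq_sin_div_cos]; positivity
  have hr : 2 * Real.sin (D + A) / Real.sin (D + 2 * A) =
      Real.sin (criticalTime A D + A) / (Real.cos (criticalTime A D + A) * Real.sin A) := by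
    rw [div_eq_div_iff hs.ne' (by positivity)]
    refine mul_right_cancel₀ hQ.ne' ?_
    have e1 := cos_criticalTime_add_mul hA hD h
    have e2 := sin_criticalTime_add_mul hA hD h
    linear_combination (2 * Real.sin (D + A) * Real.sin A) * e1 - Real.sin (D + 2 * A) * e2
  rw [← Real.sqrt_sq h0, ← Real.sqrt_sq h1.le, ← Real.sqrt_mul (by positivity), hr]
  congr 1
  have hv : 0 < Real.cos (criticalTime A D + criticalSize A D) := by
    rw [cos_criticalTime_add_criticalSize hA hD h]
    positivity
  have ht2 : Real.tan (criticalTime A D + criticalSize A D) ^ 2 =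
      1 / (Real.cos (criticalTime A D + A) * Real.cos A) ^ 2 - 1 := by
    rw [← cos_criticalTime_add_criticalSize hA hD h, Real.tan_eq_sin_div_cos]
    field_simp
    linarith [Real.sin_sq_add_cos_sq (criticalTime A D + criticalSize A D)]
  rw [ht2, Real.tan_eq_sin_div_cos]
  field_simp
  rw [Real.sin_sq, Real.sin_sq]
  ring

/-- The threshold equation in terms of the critical size. -/
theorem threshold_eq : 0 < Real.tan (D / 2 + A) -
      √(1 + (2 * Real.sin (D + A) / Real.sin (D + 2 * A)) ^ 2) * Real.tan A * Real.tan (D / 2) ^ 2 ∧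
    (Real.tan (D / 2) ^ 2 + √(1 + (2 * Real.sin (D + A) / Real.sin (D + 2 * A)) ^ 2) *
        Real.tan A * Real.tan (D / 2 + A)) / (Real.tan (D / 2 + A) -
      √(1 + (2 * Real.sin (D + A) / Real.sin (D + 2 * A)) ^ 2) * Real.tan A * Real.tan (D / 2) ^ 2) =
    Real.tan (criticalSize A D + D / 2) := by
  rw [sqrt_mul_tan_eq hA hD h]
  have hQ := criticalDen_pos hA hD h
  have hx0 := lt_criticalSize hA hD h
  have hs1 : 0 < Real.sin (D / 2 + A) := Real.sin_pos_of_pos_of_lt_pi (by linarith) (by linarith)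
  have hc1 : 0 < Real.cos (D / 2 + A) := Real.cos_pos_of_mem_Ioo ⟨by linarith, by linarith⟩
  have hcE : 0 < Real.cos (D / 2) := Real.cos_pos_of_mem_Ioo ⟨by linarith, by linarith⟩
  have hct := cos_criticalTime_pos (A := A) (D := D)
  have hcv : 0 < Real.cos (criticalTime A D + criticalSize A D) := by
    rw [cos_criticalTime_add_criticalSize hA hD h]
    exact mul_pos (cos_criticalTime_add_pos hA hD h) (cos_pos_of_small hA hD h)
  have e1 := sin_half_sub_criticalTime_mul hA hD h
  have e2 := cos_half_sub_criticalTime_mul hA hD h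
  have hcu : 0 < Real.cos (D / 2 - criticalTime A D) := by
    refine pos_of_mul_pos_left ?_ hQ.le
    rw [e2]
    positivity
  have htan : Real.tan (D / 2) ^ 2 =
      Real.tan (D / 2 - criticalTime A D) * Real.tan (D / 2 + A) := by
    simp only [Real.tan_eq_sin_div_cos]
    rw [div_pow, div_mul_div_comm, div_eq_div_iff (by positivity) (by positivity)]
    refine mul_right_cancel₀ (mul_pos (mul_pos two_pos hct) hQ).ne' ?_
    linear_combination (2 * Real.cos (criticalTime A D)) * (Real.cos (D / 2 + A) *
      Real.sin (D / 2) ^ 2 * e2 - Real.cos (D / 2) ^ 2 * Real.sin (D / 2 + A) * e1)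
  -- With this splitting `u + v` the quotient is the addition formula for the tangent, with the
  -- common factor `tan (D / 2 + A)` cancelling.
  have hsum : criticalSize A D + D / 2 =
      (D / 2 - criticalTime A D) + (criticalTime A D + criticalSize A D) := by ring
  have hcs : 0 < Real.cos (criticalSize A D + D / 2) :=
    Real.cos_pos_of_mem_Ioo ⟨by linarith, criticalSize_add_half_lt hA hD h⟩
  rw [htan, hsum]
  rw [hsum] at hcs
  set u := D / 2 - criticalTime A D
  set v := criticalTime A D + criticalSize A D
  have hden : Real.tan (D / 2 + A) - Real.tan v * (Real.tan u * Real.tan (D / 2 + A)) =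
      Real.tan (D / 2 + A) * (Real.cos (u + v) / (Real.cos u * Real.cos v)) := by
    rw [Real.cos_add, Real.tan_eq_sin_div_cos u, Real.tan_eq_sin_div_cos v]
    field_simp
  have hnum : Real.tan u * Real.tan (D / 2 + A) + Real.tan v * Real.tan (D / 2 + A) =
      Real.tan (D / 2 + A) * (Real.sin (u + v) / (Real.cos u * Real.cos v)) := by
    rw [Real.sin_add, Real.tan_eq_sin_div_cos u, Real.tan_eq_sin_div_cos v]
    field_simp
  have hT : 0 < Real.tan (D / 2 + A) := by
    rw [Real.tan_eq_sin_div_cos]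
    positivity
  rw [hden, hnum]
  refine ⟨by positivity, ?_⟩
  have hne : Real.cos u * Real.cos v ≠ 0 := by positivity
  rw [Real.tan_eq_sin_div_cos (u + v), mul_div_mul_left _ _ hT.ne', div_div_div_cancel_right₀ hne]

theorem tan_add_half_eq_iff {x : ℝ} (hx : 0 < x) (hx' : x ≤ 2 * A) :
    Real.tan (x + D / 2) = Real.tan (criticalSize A D + D / 2) ↔ x = criticalSize A D := by
  refine ⟨fun heq => ?_, fun heq => by rw [heq]⟩
  have hx0 := lt_criticalSize hA hD h
  have h1 := criticalSize_add_half_lt hA hD h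
  have hpos : 0 < Real.tan (criticalSize A D + D / 2) :=
    Real.tan_pos_of_pos_of_lt_pi_div_two (by linarith) h1
  have hlt : x + D / 2 < Real.pi / 2 := by
    by_contra! hle
    -- Beyond `π / 2` the argument is still below `π`, so the tangent is nonpositive; at `π / 2`
    -- itself it has the default value `0`.
    have : Real.tan (x + D / 2) ≤ 0 := by
      rw [Real.tan_eq_sin_div_cos]
      exact div_nonpos_of_nonneg_of_nonpos
        (Real.sin_nonneg_of_nonneg_of_le_pi (by linarith) (by linarith))
        (Real.cos_nonpos_of_pi_div_two_le_of_le hle (by linarith))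
    linarith
  have := Real.injOn_tan ⟨by linarith, hlt⟩ ⟨by linarith, h1⟩ heq
  linarith

/-- Below the critical size there is no scattering event; the second input only matters before the
critical time. -/
theorem false_of_lt_criticalSize {x t : ℝ} {p : E3} (hp : ‖p‖ = 1) (hx0 : 0 < x)
    (hx : x < criticalSize A D) (hC0 : Real.arccos (proj p 0) ≤ t + x)
    (hC1 : t ≤ criticalTime A D → Real.arccos (proj p (2 * A)) ≤ t + x)
    (hmid : Real.arccos (proj p (D + A)) ≤ D + A - t)
    (hanti : t + A ≤ Real.arccos (proj p A)) : False := by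
  have ht0 := criticalTime_nonneg hA hD h
  have htx : 0 ≤ t + x := (Real.arccos_nonneg _).trans hC0
  have hsA := sin_pos_of_small hA hD h
  have hcA := cos_pos_of_small hA hD h
  have h2A := criticalSize_lt_two_mul hA hD h
  have hv := criticalTime_add_criticalSize_lt hA hD h
  have hcos := cos_criticalTime_add_criticalSize hA hD h
  have hcrit : Real.cos (criticalTime A D + criticalSize A D) < Real.cos (criticalTime A D + x) :=
    Real.cos_lt_cos_of_nonneg_of_le_pi (by linarith) (by linarith) (by linarith)
  rcases le_or_gt t (criticalTime A D) with ht | ht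
  · have hC1 := hC1 ht
    have hdist := arccos_cos_sub_le_add hp (2 * A) 0
    rw [sub_zero, Real.arccos_cos (by linarith) (by linarith)] at hdist
    have e1 := le_cos_of_le_arccos (abs_proj_le_one hp _) (by linarith) hanti
    have e2 := cos_le_of_arccos_le (abs_proj_le_one hp _) hC0 (by linarith)
    have e3 := cos_le_of_arccos_le (abs_proj_le_one hp _) hC1 (by linarith)
    have e4 := proj_sub_add_proj_add p A A
    rw [sub_self, ← two_mul] at e4
    -- Averaging the two inputs around the midpoint gives `cos (t + x) ≤ cos A * cos (t + A)`. The
    -- difference is a sinusoid in time, positive at `-x` and, because `x` is below the critical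
    -- size, at the critical time.
    have hg : ∀ s, (Real.cos x - Real.cos A * Real.cos A) * Real.cos s +
        (Real.cos A * Real.sin A - Real.sin x) * Real.sin s =
        Real.cos (s + x) - Real.cos A * Real.cos (s + A) := by
      intro s
      rw [Real.cos_add, Real.cos_add]
      ring
    have := sinusoid_pos_of_mem_Icc (a := Real.cos x - Real.cos A * Real.cos A)
      (b := Real.cos A * Real.sin A - Real.sin x) (s₁ := -x) (s₂ := criticalTime A D) (s := t)
      (by
        rw [hg, neg_add_cancel, Real.cos_zero]
        nlinarith [Real.cos_le_one (-x + A), cos_lt_one_of_small hA hD h])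
      (by rw [hg]; linarith) (by linarith) ht (by linarith)
    rw [hg] at this
    nlinarith
  · rcases hD.eq_or_lt with rfl | hD'
    · rw [zero_add] at hmid
      linarith
    have hsD : 0 < Real.sin D := Real.sin_pos_of_pos_of_lt_pi hD' (by linarith)
    have htB : t ≤ D + A := by linarith [Real.arccos_nonneg (proj p (D + A))]
    have hhalf := criticalSize_add_half_lt hA hD h
    have e1 := le_cos_of_le_arccos (abs_proj_le_one hp _) (by linarith) hanti
    have e2 := cos_le_of_arccos_le (abs_proj_le_one hp _) hC0 (by linarith)
    have e3 := cos_le_of_arccos_le (abs_proj_le_one hp _) hmid (by linarith)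
    -- After the critical time the midpoint value is interpolated between the first input and the
    -- position of the middle output; the second input plays no role.
    have e4 : Real.sin (A + D) * proj p A = Real.sin D * proj p (A - A) +
      Real.sin A * proj p (A + D) := sin_add_mul_sinusoid (p 0) (p 1) A A D
    rw [sub_self, add_comm A D] at e4
    have hsB : 0 < Real.sin (D + A) := Real.sin_pos_of_pos_of_lt_pi (by linarith) (by linarith)
    -- Again a sinusoid in time, now positive at the critical time and at `π`, while the constraints
    -- force it to be nonpositive at `t`.
    have hg : ∀ s, (Real.sin D * (Real.cos x - 1)) * Real.cos s +
        (2 * Real.sin A * Real.sin (D + A) - Real.sin D * Real.sin x) * Real.sin s =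
        Real.sin D * Real.cos (s + x) - (Real.sin D * Real.cos s -
          2 * Real.sin A * Real.sin (D + A) * Real.sin s) := by
      intro s
      rw [Real.cos_add s x]
      ring
    have := sinusoid_pos_of_mem_Icc (a := Real.sin D * (Real.cos x - 1))
      (b := 2 * Real.sin A * Real.sin (D + A) - Real.sin D * Real.sin x)
      (s₁ := criticalTime A D) (s₂ := Real.pi) (s := t)
      (by
        rw [hg, ← sin_mul_cos_criticalTime_add hA hD h, ← hcos, ← mul_sub]
        exact mul_pos hsD (by linarith))
      (by
        have : Real.cos x < 1 := by
          rw [← Real.cos_zero]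
          exact Real.cos_lt_cos_of_nonneg_of_le_pi le_rfl (by linarith) hx0
        rw [Real.cos_pi, Real.sin_pi]
        nlinarith) ht.le (by linarith)
      (by linarith [criticalTime_pos hA hD h hD'])
    rw [hg] at this
    have e5 : Real.sin D * Real.cos t - 2 * Real.sin A * Real.sin (D + A) * Real.sin t =
        Real.sin (D + A) * Real.cos (t + A) - Real.sin A * Real.cos (D + A - t) := by
      rw [Real.cos_sub, Real.cos_add, show Real.sin D = Real.sin (D + A - A) by ring_nf,
        Real.sin_sub (D + A)]
      ring
    nlinarith

end Critical

theorem criticalTime_le_half {A D : ℝ} (hA : 0 < A) (hD : 0 ≤ D) (h : D + 2 * A < Real.pi) :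
    criticalTime A D ≤ D / 2 := by
  by_contra! hlt
  have h1 := criticalTime_add_lt hA hD h
  have h2 : 0 < Real.sin (criticalTime A D - D / 2) :=
    Real.sin_pos_of_pos_of_lt_pi (by linarith) (by linarith)
  have h3 := sin_half_sub_criticalTime_mul hA hD h
  have hc1 : 0 < Real.cos (D / 2 + A) := Real.cos_pos_of_mem_Ioo ⟨by linarith, by linarith⟩
  rw [← neg_sub, Real.sin_neg] at h3
  have h4 := mul_pos h2 (criticalDen_pos hA hD h)
  have h5 : 0 ≤ 2 * Real.cos (criticalTime A D) * Real.sin (D / 2) ^ 2 * Real.cos (D / 2 + A) := by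
    have := cos_criticalTime_pos (A := A) (D := D)
    positivity
  linarith

/-! ### Small spacing -/

section SmallSpacing

variable {n : ℕ} {θ x : ℝ} (hn : 2 ≤ n) (hθ : 0 < θ) (hθn : θ < 2 * Real.pi / n)

/-- The distance between the position of the middle output and the midpoint of the first two
inputs. -/
noncomputable def middleDist (n : ℕ) (θ : ℝ) : ℝ := ((n : ℝ) - 2) * (θ / 2)

/-- The least `x` for which the first two inputs scatter to all outputs. -/
noncomputable def thresholdSize (n : ℕ) (θ : ℝ) : ℝ := criticalSize (θ / 2) (middleDist n θ)

include hn hθ hθn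

omit hθn in
theorem middleDist_nonneg : 0 ≤ middleDist n θ := by
  have : (2 : ℝ) ≤ n := by exact_mod_cast hn
  exact mul_nonneg (by linarith) (by linarith)

omit hθ in
theorem middleDist_add_lt : middleDist n θ + 2 * (θ / 2) < Real.pi := by
  have hn2 : (2 : ℝ) ≤ n := by exact_mod_cast hn
  have := (lt_div_iff₀ (by linarith)).1 hθn
  rw [middleDist]
  linarith

omit hn hθ hθn in
theorem half_mul_eq : ((n : ℝ) - 1) / 2 * θ = middleDist n θ + θ / 2 := by
  rw [middleDist]
  ring

/-- Any partner `k` of the first input is as restrictive as the second input: up to the critical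
time the bound `cos (t + x)` is positive, so it passes to the angle `θ` on the arc from `0` to `k *
θ`. -/
theorem lt_of_arccos_proj_input_le {t : ℝ} {p : E3} (hx0 : 0 < x) (hp : ‖p‖ = 1)
    (hx : x < thresholdSize n θ) {k : ℕ} (hk : 0 < k) (hkn : k < n)
    (hC0 : Real.arccos (proj p (((0 : ℕ) : ℝ) * θ)) ≤ t + x)
    (hCk : Real.arccos (proj p ((k : ℝ) * θ)) ≤ t + x)
    (hmid : Real.arccos (proj p (((n : ℝ) - 1) / 2 * θ)) ≤ ((n : ℝ) - 1) / 2 * θ - t)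
    (hanti : t + θ / 2 ≤ Real.arccos (proj p ((((0 : ℕ) : ℝ) + 1 / 2) * θ))) : False := by
  have hA : 0 < θ / 2 := by linarith
  have hD := middleDist_nonneg hn hθ
  have h := middleDist_add_lt hn hθn
  rw [half_mul_eq] at hmid
  rw [Nat.cast_zero, zero_mul] at hC0
  rw [Nat.cast_zero, zero_add, one_div_mul_eq_div] at hanti
  refine false_of_lt_criticalSize hA hD h hp hx0 hx hC0 (fun ht => ?_) hmid hanti
  rw [mul_div_cancel₀ _ two_ne_zero]
  have hv := criticalTime_add_criticalSize_lt hA hD h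
  have hhalf := criticalSize_add_half_lt hA hD h
  change thresholdSize n θ + _ < _ at hhalf
  change _ + thresholdSize n θ < _ at hv
  have htx : 0 ≤ t + x := (Real.arccos_nonneg _).trans hC0
  have hc : 0 < Real.cos (t + x) := Real.cos_pos_of_mem_Ioo ⟨by linarith, by linarith⟩
  have e0 := cos_le_of_arccos_le (abs_proj_le_one hp _) hC0 (by linarith)
  have ek := cos_le_of_arccos_le (abs_proj_le_one hp _) hCk (by linarith)
  have hk1 : (1 : ℝ) ≤ k := by exact_mod_cast hk
  have hkn' : (k : ℝ) + 1 ≤ n := by exact_mod_cast hkn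
  rcases le_or_gt (k * θ) Real.pi with hkπ | hkπ
  · refine arccos_le_of_cos_le htx (by linarith) ?_
    exact le_proj_of_mem_arc (ψ := θ) (α := θ) (β := (k - 1) * θ) hc hθ.le
      (mul_nonneg (by linarith) hθ.le) (by linarith) (by rwa [sub_self])
      (by rwa [show θ + ((k : ℝ) - 1) * θ = k * θ by ring])
  -- If that arc exceeds `π`, the complementary arc contains the antipode of the middle output's
  -- position. The point would then be too close to this antipode to reach the middle output in
  -- time.
  · exfalso
    have hkB : (k : ℝ) * θ ≤ 2 * (middleDist n θ + θ / 2) := by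
      rw [← half_mul_eq]
      nlinarith
    have htB : t ≤ middleDist n θ + θ / 2 := by
      linarith [Real.arccos_nonneg (proj p (middleDist n θ + θ / 2))]
    have e1 := le_proj_of_mem_arc (p := p) (ψ := middleDist n θ + θ / 2 + Real.pi)
      (α := middleDist n θ + θ / 2 + Real.pi - k * θ)
      (β := Real.pi - (middleDist n θ + θ / 2)) hc
      (by linarith) (by linarith) (by linarith) (by rwa [sub_sub_cancel])
      (by
        rw [show middleDist n θ + θ / 2 + Real.pi + (Real.pi - (middleDist n θ + θ / 2)) =
          0 + 2 * Real.pi by ring, proj_add_two_pi]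
        exact e0)
    rw [proj_add_pi] at e1
    have e2 := cos_le_of_arccos_le (abs_proj_le_one hp _) hmid (by linarith)
    have e3 : Real.cos (Real.pi - (middleDist n θ + θ / 2 - t)) < Real.cos (t + x) :=
      Real.cos_lt_cos_of_nonneg_of_le_pi htx (by linarith) (by linarith)
    rw [Real.cos_pi_sub] at e3
    linarith

theorem thresholdSize_le_of_spacedGraph_connected (hx0 : 0 < x)
    (hconn : (spacedGraph n θ x).Connected) : thresholdSize n θ ≤ x := by
  by_contra! hx
  have : Nontrivial (Fin n) := Fin.nontrivial_iff_two_le.2 hn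
  obtain ⟨k, hk, ⟨t, p⟩, hmem⟩ :=
    hconn.preconnected.exists_adj_of_nontrivial (⟨0, by omega⟩ : Fin n)
  rw [mem_twoToAll_iff isGeodesicallyConvex_hemisphere equator_subset_hemisphere hn] at hmem
  obtain ⟨hp, h1, h2, h3⟩ := hmem
  refine lt_of_arccos_proj_input_le hn hθ hθn hx0 hp.1 hx (Nat.pos_of_ne_zero fun h => ?_) k.2 h1 h2
    h3.middle (h3.antipode 0 (by omega))
  exact hk (Fin.ext h.symm)

/-- The critical scattering event above the midpoint between the inputs with indices `j` and
`j + 1`. -/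
noncomputable def criticalEvent (n : ℕ) (θ : ℝ) (j : ℕ) : Event :=
  (criticalTime (θ / 2) (middleDist n θ),
    !₂[Real.cos (criticalTime (θ / 2) (middleDist n θ) + θ / 2) *
        Real.cos (((j : ℝ) + 1 / 2) * θ),
      Real.cos (criticalTime (θ / 2) (middleDist n θ) + θ / 2) *
        Real.sin (((j : ℝ) + 1 / 2) * θ),
      Real.sin (criticalTime (θ / 2) (middleDist n θ) + θ / 2)])

theorem criticalEvent_mem_hemisphere (j : ℕ) : (criticalEvent n θ j).2 ∈ hemisphere := by
  have hA : 0 < θ / 2 := by linarith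
  have hD := middleDist_nonneg hn hθ
  have h := middleDist_add_lt hn hθn
  have h1 := criticalTime_nonneg hA hD h
  have h2 := criticalTime_add_lt hA hD h
  refine ⟨?_, ?_⟩
  · rw [criticalEvent, EuclideanSpace.norm_eq, Fin.sum_univ_three, Real.sqrt_eq_one]
    simp only [Real.norm_eq_abs, sq_abs, Matrix.cons_val]
    have := Real.sin_sq_add_cos_sq (((j : ℝ) + 1 / 2) * θ)
    have := Real.sin_sq_add_cos_sq (criticalTime (θ / 2) (middleDist n θ) + θ / 2)
    rw [mul_pow, mul_pow, ← mul_add]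
    nlinarith
  · simp only [criticalEvent, PiLp.toLp_apply, Matrix.cons_val]
    exact Real.sin_nonneg_of_nonneg_of_le_pi (by linarith) (by linarith)

omit hn hθ hθn in
theorem proj_criticalEvent (j : ℕ) (φ : ℝ) : proj (criticalEvent n θ j).2 φ =
    Real.cos (criticalTime (θ / 2) (middleDist n θ) + θ / 2) *
      Real.cos (((j : ℝ) + 1 / 2) * θ - φ) := by
  simp only [proj, criticalEvent, PiLp.toLp_apply, Matrix.cons_val, Real.cos_sub]
  ring

theorem arccos_proj_criticalEvent_input_le {j k : ℕ} (hk : k = j ∨ k = j + 1)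
    (hx : thresholdSize n θ ≤ x) (hxθ : x ≤ θ) :
    Real.arccos (proj (criticalEvent n θ j).2 ((k : ℝ) * θ)) ≤
      criticalTime (θ / 2) (middleDist n θ) + x := by
  have hA : 0 < θ / 2 := by linarith
  have hD := middleDist_nonneg hn hθ
  have h := middleDist_add_lt hn hθn
  have h1 := criticalTime_nonneg hA hD h
  have h2 := criticalTime_add_lt hA hD h
  have h3 := criticalTime_add_criticalSize_nonneg (A := θ / 2) (D := middleDist n θ)
  change 0 ≤ _ + thresholdSize n θ at h3
  have h4 := cos_criticalTime_add_criticalSize hA hD h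
  change Real.cos (_ + thresholdSize n θ) = _ at h4
  have h5 : Real.cos (((j : ℝ) + 1 / 2) * θ - k * θ) = Real.cos (θ / 2) := by
    rcases hk with rfl | rfl
    · congr 1
      ring
    · rw [← Real.cos_neg]
      congr 1
      push_cast
      ring
  rw [proj_criticalEvent, h5, ← h4]
  refine arccos_le_of_cos_le (by linarith) (by linarith) ?_
  exact Real.cos_le_cos_of_nonneg_of_le_pi h3 (by linarith) (by linarith)

/-- The first midpoint is among those farthest from the middle position, so the translated event
reaches the middle output. The point lies directly above its own midpoint, so its distance to every
other midpoint is at least as large. -/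
theorem inPastOfOutputs_criticalEvent {j : ℕ} (hj : j + 1 < n) :
    InPastOfOutputs n θ (criticalTime (θ / 2) (middleDist n θ)) (criticalEvent n θ j).2 := by
  have hA : 0 < θ / 2 := by linarith
  have hD := middleDist_nonneg hn hθ
  have h := middleDist_add_lt hn hθn
  have h1 := criticalTime_nonneg hA hD h
  have h2 := criticalTime_add_lt hA hD h
  have h3 := criticalTime_le_half hA hD h
  have h4 := cos_criticalTime_add_pos hA hD h
  have hj2 : (j : ℝ) + 2 ≤ n := by exact_mod_cast hj
  have hj0 : (0 : ℝ) ≤ j := j.cast_nonneg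
  constructor
  · rw [half_mul_eq]
    refine arccos_le_of_cos_le (by linarith) (by linarith) ?_
    rw [← cos_criticalTime_add_mul_cos hA hD h, proj_criticalEvent]
    refine mul_le_mul_of_nonneg_left ?_ h4.le
    rw [← Real.cos_abs (_ - _)]
    refine Real.cos_le_cos_of_nonneg_of_le_pi (abs_nonneg _) (by linarith) ?_
    rw [abs_le, middleDist]
    constructor <;> nlinarith
  · intro k _
    refine le_arccos_of_le_cos (by linarith) (by linarith) ?_
    rw [proj_criticalEvent]
    exact mul_le_of_le_one_right h4.le (Real.cos_le_one _)

theorem spacedGraph_connected_of_thresholdSize_le (hx : thresholdSize n θ ≤ x) (hxθ : x ≤ θ) :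
    (spacedGraph n θ x).Connected := by
  refine spacedGraph_connected_of_forall_succ hn fun j k hjk => ⟨criticalEvent n θ j, ?_⟩
  exact (mem_twoToAll_iff isGeodesicallyConvex_hemisphere equator_subset_hemisphere hn).2
    ⟨criticalEvent_mem_hemisphere hn hθ hθn j,
      arccos_proj_criticalEvent_input_le hn hθ hθn (Or.inl rfl) hx hxθ,
      arccos_proj_criticalEvent_input_le hn hθ hθn (Or.inr hjk) hx hxθ,
      inPastOfOutputs_criticalEvent hn hθ hθn (by omega)⟩

omit hn hθ hθn in
theorem antipodeIndex_middle : antipodeIndex n ((n + 1) / 2) = 0 := by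
  simp [antipodeIndex]

/-- The output after the middle one is antipodal to the first midpoint. Both distances equal the
elapsed times exactly, which excludes chronological precedence. -/
theorem criticalEvent_mem_ridge : criticalEvent n θ 0 ∈
    ridge (outputPoint n θ ((n + 1) / 2)) (outputPoint n θ ((n + 1) / 2 + 1)) := by
  have hA : 0 < θ / 2 := by linarith
  have hD := middleDist_nonneg hn hθ
  have h := middleDist_add_lt hn hθn
  have h1 := criticalTime_nonneg hA hD h
  have h2 := criticalTime_add_lt hA hD h
  have h3 := criticalTime_le_half hA hD h
  have hp := criticalEvent_mem_hemisphere hn hθ hθn 0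
  rw [outputPoint_middle, outputPoint_eq_antipode θ (by omega), antipodeIndex_middle]
  refine (mem_ridge_iff (t := criticalTime (θ / 2) (middleDist n θ))
    (p := (criticalEvent n θ 0).2) (equator_subset_hemisphere (circlePoint_mem_equator _))
    (equator_subset_hemisphere (circlePoint_mem_equator _))).2 ⟨hp, ?_, ?_⟩
  · rw [angle_circlePoint hp.1, half_mul_eq, proj_criticalEvent,
      show (((0 : ℕ) : ℝ) + 1 / 2) * θ - (middleDist n θ + θ / 2) = -middleDist n θ by
        push_cast; ring, Real.cos_neg, cos_criticalTime_add_mul_cos hA hD h,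
      Real.arccos_cos (by linarith) (by linarith)]
  · rw [angle_circlePoint hp.1, arccos_proj_add_pi, proj_criticalEvent, sub_self, Real.cos_zero,
      mul_one, Real.arccos_cos (by linarith) (by linarith)]
    ring

theorem ridge_scattering_nonempty (hx : thresholdSize n θ ≤ x) (hxθ : x ≤ θ) :
    (causalFuture hemisphere (inputPoint θ x 1) ∩ causalFuture hemisphere (inputPoint θ x 2) ∩
      causalPastSet hemisphere (ridge (outputPoint n θ ((n + 1) / 2))
        (outputPoint n θ ((n + 1) / 2 + 1)))).Nonempty := by
  have hK := isGeodesicallyConvex_hemisphere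
  have hp := criticalEvent_mem_hemisphere hn hθ hθn 0
  refine ⟨criticalEvent n θ 0, ⟨?_, ?_⟩, _, criticalEvent_mem_ridge hn hθ hθn, ?_⟩
  · exact (mem_causalFuture_inputs hK equator_subset_hemisphere (j := (⟨0, by omega⟩ : Fin n))).2
      ⟨hp, arccos_proj_criticalEvent_input_le hn hθ hθn (Or.inl rfl) hx hxθ⟩
  · exact (mem_causalFuture_inputs hK equator_subset_hemisphere (j := (⟨1, by omega⟩ : Fin n))).2
      ⟨hp, arccos_proj_criticalEvent_input_le hn hθ hθn (Or.inr rfl) hx hxθ⟩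
  · exact (causallyPrecedes_iff hK (t := (criticalEvent n θ 0).1) (p := (criticalEvent n θ 0).2)
      (t' := (criticalEvent n θ 0).1) (q := (criticalEvent n θ 0).2)).2
      ⟨hp, hp, by
        rw [angle_self (norm_ne_zero_iff.1 (by rw [hp.1]; exact one_ne_zero)), sub_self]⟩

omit hn hθ hθn in
theorem adjacent_scattering_nonempty_of_ridge
    (hne : (causalFuture hemisphere (inputPoint θ x 1) ∩ causalFuture hemisphere (inputPoint θ x 2) ∩
      causalPastSet hemisphere (ridge (outputPoint n θ ((n + 1) / 2))
        (outputPoint n θ ((n + 1) / 2 + 1)))).Nonempty) :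
    (causalFuture hemisphere (inputPoint θ x 1) ∩ causalFuture hemisphere (inputPoint θ x 2) ∩
      causalPast hemisphere (outputPoint n θ ((n + 1) / 2)) ∩
      causalPast hemisphere (outputPoint n θ ((n + 1) / 2 + 1))).Nonempty := by
  obtain ⟨q, hq, r, ⟨hr1, hr2⟩, hqr⟩ := hne
  exact ⟨q, ⟨hq, causallyPrecedes_trans isGeodesicallyConvex_hemisphere hqr hr1.1⟩,
    causallyPrecedes_trans isGeodesicallyConvex_hemisphere hqr hr2.1⟩

theorem thresholdSize_le_of_adjacent_scattering_nonempty (hx0 : 0 < x)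
    (hne : (causalFuture hemisphere (inputPoint θ x 1) ∩ causalFuture hemisphere (inputPoint θ x 2) ∩
      causalPast hemisphere (outputPoint n θ ((n + 1) / 2)) ∩
      causalPast hemisphere (outputPoint n θ ((n + 1) / 2 + 1))).Nonempty) :
    thresholdSize n θ ≤ x := by
  have hK := isGeodesicallyConvex_hemisphere
  by_contra! hx
  obtain ⟨⟨t, p⟩, ⟨⟨h0, h1⟩, h2⟩, h3⟩ := hne
  obtain ⟨hp, h0⟩ := (mem_causalFuture_inputs hK equator_subset_hemisphere
    (j := (⟨0, by omega⟩ : Fin n))).1 h0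
  have h1 := ((mem_causalFuture_inputs hK equator_subset_hemisphere
    (j := (⟨1, by omega⟩ : Fin n))).1 h1).2
  have h2 := ((mem_causalPast_middle hK equator_subset_hemisphere).1 h2).2
  have h3 := ((mem_causalPast_antipode hK equator_subset_hemisphere (by omega)).1 h3).2
  rw [antipodeIndex_middle] at h3
  exact lt_of_arccos_proj_input_le hn hθ hθn hx0 hp.1 hx one_pos (by omega) h0 h1 h2 h3

theorem thresholdDen_pos_and_eq : 0 < thresholdDen n θ ∧
    thresholdNum n θ / thresholdDen n θ = Real.tan (thresholdSize n θ + ((n : ℝ) - 2) / 4 * θ) := by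
  have := threshold_eq (by linarith : 0 < θ / 2) (middleDist_nonneg hn hθ)
    (middleDist_add_lt hn hθn)
  rw [show middleDist n θ + θ / 2 = ((n : ℝ) - 1) * θ / 2 by rw [middleDist]; ring,
    show middleDist n θ + 2 * (θ / 2) = n * θ / 2 by rw [middleDist]; ring,
    show middleDist n θ / 2 + θ / 2 = n * θ / 4 by rw [middleDist]; ring,
    show middleDist n θ / 2 = ((n : ℝ) - 2) * θ / 4 by rw [middleDist]; ring] at this
  rw [show ((n : ℝ) - 2) / 4 * θ = ((n : ℝ) - 2) * θ / 4 by ring]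
  exact this

theorem smallSpacing : 0 < thresholdDen n θ ∧
    ∃ x₀ ∈ Ioc 0 θ,
      (∀ x ∈ Ioc 0 θ, Real.tan (x + ((n : ℝ) - 2) / 4 * θ) =
        thresholdNum n θ / thresholdDen n θ ↔ x = x₀) ∧
      ∀ x ∈ Ioc 0 θ,
        ((spacedGraph n θ x).Connected ↔
          (causalFuture hemisphere (inputPoint θ x 1) ∩
            causalFuture hemisphere (inputPoint θ x 2) ∩
            causalPastSet hemisphere (ridge (outputPoint n θ ((n + 1) / 2))
              (outputPoint n θ ((n + 1) / 2 + 1)))).Nonempty) ∧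
        ((spacedGraph n θ x).Connected ↔
          (causalFuture hemisphere (inputPoint θ x 1) ∩
            causalFuture hemisphere (inputPoint θ x 2) ∩
            causalPast hemisphere (outputPoint n θ ((n + 1) / 2)) ∩
            causalPast hemisphere (outputPoint n θ ((n + 1) / 2 + 1))).Nonempty) ∧
        ((spacedGraph n θ x).Connected ↔ x₀ ≤ x) := by
  have hA : 0 < θ / 2 := by linarith
  have hD := middleDist_nonneg hn hθ
  have h := middleDist_add_lt hn hθn
  obtain ⟨hpos, heq⟩ := thresholdDen_pos_and_eq hn hθ hθn
  have h1 : θ / 2 < thresholdSize n θ := lt_criticalSize hA hD h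
  have h2 : thresholdSize n θ < 2 * (θ / 2) := criticalSize_lt_two_mul hA hD h
  refine ⟨hpos, thresholdSize n θ, ⟨by linarith, by linarith⟩, fun x hx => ?_, fun x hx => ?_⟩
  · rw [heq, show ((n : ℝ) - 2) / 4 * θ = middleDist n θ / 2 by rw [middleDist]; ring]
    exact tan_add_half_eq_iff hA hD h hx.1 (by linarith [hx.2])
  · have a1 := thresholdSize_le_of_spacedGraph_connected hn hθ hθn hx.1
    have a2 := fun h => spacedGraph_connected_of_thresholdSize_le hn hθ hθn h hx.2
    have a3 := fun h => ridge_scattering_nonempty hn hθ hθn h hx.2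
    have a4 := adjacent_scattering_nonempty_of_ridge (n := n) (θ := θ) (x := x)
    have a5 := thresholdSize_le_of_adjacent_scattering_nonempty hn hθ hθn hx.1
    -- All equivalences come from one cycle: connected, threshold reached, ridge scattering,
    -- scattering to the two outputs, threshold reached, connected.
    exact ⟨⟨fun h => a3 (a1 h), fun h => a2 (a5 (a4 h))⟩,
      ⟨fun h => a4 (a3 (a1 h)), fun h => a2 (a5 h)⟩, a1, a2⟩

end SmallSpacing

/-! ### Geodesics of the slice and candidate surfaces -/

theorem cos_lt_cos_of_mem_Ioo {u y : ℝ} (hu : 0 ≤ u) (h1 : u < y) (h2 : y < 2 * Real.pi - u) :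
    Real.cos y < Real.cos u := by
  rcases le_total y Real.pi with h | h
  · exact Real.cos_lt_cos_of_nonneg_of_le_pi hu h h1
  · rw [← Real.cos_two_pi_sub]
    exact Real.cos_lt_cos_of_nonneg_of_le_pi hu (by linarith) (by linarith)

theorem sin_half_le_sin_half {u d : ℝ} (hu : 0 ≤ u) (h1 : u ≤ d) (h2 : d ≤ 2 * Real.pi - u) :
    Real.sin (u / 2) ≤ Real.sin (d / 2) := by
  rcases le_total d Real.pi with h | h
  · exact Real.sin_le_sin_of_le_of_le_pi_div_two (by linarith [Real.pi_pos]) (by linarith)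
      (by linarith)
  · rw [← Real.sin_pi_sub (d / 2)]
    exact Real.sin_le_sin_of_le_of_le_pi_div_two (by linarith [Real.pi_pos]) (by linarith)
      (by linarith)

theorem sin_half_lt_sin_half {u d : ℝ} (hu : 0 ≤ u) (h1 : u < d) (h2 : d < 2 * Real.pi - u) :
    Real.sin (u / 2) < Real.sin (d / 2) := by
  rcases le_total d Real.pi with h | h
  · exact Real.sin_lt_sin_of_lt_of_le_pi_div_two (by linarith [Real.pi_pos]) (by linarith)
      (by linarith)
  · rw [← Real.sin_pi_sub (d / 2)]
    exact Real.sin_lt_sin_of_lt_of_le_pi_div_two (by linarith [Real.pi_pos]) (by linarith)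
      (by linarith)

theorem sliceGeodesic_comm (α β : ℝ) : sliceGeodesic α β = sliceGeodesic β α := by
  have key : ∀ a b : ℝ, sliceGeodesic a b ⊆ sliceGeodesic b a := by
    rintro a b p ⟨hp, s, hs, h0, h1⟩
    exact ⟨hp, 1 - s, ⟨by linarith [hs.2], by linarith [hs.1]⟩, by rw [h0]; ring, by rw [h1]; ring⟩
  exact Subset.antisymm (key _ _) (key _ _)

theorem proj_of_mem_sliceGeodesic {α β : ℝ} {p : E3} (hp : p ∈ sliceGeodesic α β) (μ : ℝ) :
    ∃ s ∈ Icc (0 : ℝ) 1, proj p μ = (1 - s) * Real.cos (α - μ) + s * Real.cos (β - μ) := by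
  obtain ⟨-, s, hs, h0, h1⟩ := hp
  refine ⟨s, hs, ?_⟩
  rw [proj, h0, h1, Real.cos_sub, Real.cos_sub]
  ring

theorem proj_midpoint_of_mem_sliceGeodesic {α β : ℝ} {p : E3} (hp : p ∈ sliceGeodesic α β) :
    proj p ((α + β) / 2) = Real.cos ((β - α) / 2) := by
  obtain ⟨s, -, h⟩ := proj_of_mem_sliceGeodesic hp ((α + β) / 2)
  rw [h, show α - (α + β) / 2 = -((β - α) / 2) by ring, Real.cos_neg,
    show β - (α + β) / 2 = (β - α) / 2 by ring]
  ring

/-- Vertical projection sends geodesics to chords. The first chord lies on a line perpendicular to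
its bisector direction, and both ends of the second lie strictly on one side of this line. -/
theorem disjoint_sliceGeodesic_outside {α β γ δ : ℝ} (hαβ : α ≤ β)
    (hγ : γ ∈ Ioo β (α + 2 * Real.pi)) (hδ : δ ∈ Ioo β (α + 2 * Real.pi)) :
    Disjoint (sliceGeodesic α β) (sliceGeodesic γ δ) := by
  rw [Set.disjoint_left]
  intro p hp hp'
  obtain ⟨s, hs, h⟩ := proj_of_mem_sliceGeodesic hp' ((α + β) / 2)
  rw [proj_midpoint_of_mem_sliceGeodesic hp] at h
  have h1 : Real.cos (γ - (α + β) / 2) < Real.cos ((β - α) / 2) :=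
    cos_lt_cos_of_mem_Ioo (by linarith) (by linarith [hγ.1]) (by linarith [hγ.2])
  have h2 : Real.cos (δ - (α + β) / 2) < Real.cos ((β - α) / 2) :=
    cos_lt_cos_of_mem_Ioo (by linarith) (by linarith [hδ.1]) (by linarith [hδ.2])
  rcases hs.1.eq_or_lt with h0 | h0
  · rw [← h0] at h
    linarith
  · nlinarith [hs.2]

theorem disjoint_sliceGeodesic_inside {α β γ δ : ℝ} (hαβ : β ≤ α + 2 * Real.pi)
    (hγ : γ ∈ Ioo α β) (hδ : δ ∈ Ioo α β) :
    Disjoint (sliceGeodesic γ δ) (sliceGeodesic α β) := by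
  rw [Set.disjoint_right]
  intro p hp hp'
  obtain ⟨s, hs, h⟩ := proj_of_mem_sliceGeodesic hp' ((α + β) / 2)
  rw [proj_midpoint_of_mem_sliceGeodesic hp] at h
  have key : ∀ y ∈ Ioo α β, Real.cos ((β - α) / 2) < Real.cos (y - (α + β) / 2) := by
    intro y hy
    rw [← Real.cos_abs (y - _)]
    refine Real.cos_lt_cos_of_nonneg_of_le_pi (abs_nonneg _) (by linarith) ?_
    rw [abs_lt]
    constructor <;> linarith [hy.1, hy.2]
  have h1 := key γ hγ
  have h2 := key δ hδ
  rcases hs.1.eq_or_lt with h0 | h0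
  · rw [← h0] at h
    linarith
  · nlinarith [hs.2]

theorem finRotate_val {n : ℕ} (i : Fin n) :
    (finRotate n i : ℕ) = if (i : ℕ) + 1 < n then (i : ℕ) + 1 else 0 := by
  obtain ⟨i, hi⟩ := i
  obtain ⟨m, rfl⟩ : ∃ m, n = m + 1 := ⟨n - 1, by omega⟩
  rcases Nat.lt_or_ge i m with h | h
  · rw [finRotate_of_lt h]
    simp [h]
  · obtain rfl : i = m := by omega
    rw [finRotate_last']
    simp

/-- If `i` is not fixed it moves to its successor, which by injectivity cannot be fixed either.
Since the shift is a single cycle, one unfixed point propagates to all. -/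
theorem perm_eq_one_or_finRotate {n : ℕ} (hn : 2 ≤ n) {τ : Equiv.Perm (Fin n)}
    (h : ∀ i, τ i = i ∨ τ i = finRotate n i) : τ = 1 ∨ τ = finRotate n := by
  have hrot : ∀ i : Fin n, finRotate n i ≠ i := by
    intro i hi
    have h1 := congrArg Fin.val hi
    rw [finRotate_val] at h1
    split_ifs at h1 <;> omega
  rw [or_iff_not_imp_left]
  intro hne
  obtain ⟨i₀, hi₀⟩ : ∃ i, τ i ≠ i := by
    by_contra! hall
    exact hne (Equiv.ext hall)
  have hpow : ∀ k : ℕ, τ ((finRotate n ^ k) i₀) ≠ (finRotate n ^ k) i₀ := by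
    intro k
    induction k with
    | zero => simpa using hi₀
    | succ k ih =>
      rw [pow_succ', Equiv.Perm.mul_apply]
      intro heq
      have h1 := (h _).resolve_left ih
      rw [← h1] at heq
      exact ih (τ.injective heq)
  ext1 j
  obtain ⟨k, rfl⟩ := (isCycle_finRotate_of_le hn).exists_pow_eq (hrot i₀) (hrot j)
  exact (h _).resolve_left (hpow k)

section Candidates

variable {n : ℕ} {θ x : ℝ}

theorem isRTCandidate_of_lt {σ : Equiv.Perm (Fin n)}
    (h : ∀ i j, i < j → Disjoint (candidateGeodesic θ x σ i) (candidateGeodesic θ x σ j)) :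
    IsRTCandidate θ x σ := by
  intro i j hij
  rcases lt_or_gt_of_ne hij with hlt | hlt
  · exact h i j hlt
  · exact (h j i hlt).symm

variable (hx0 : 0 < x) (hx : x < θ) (h : ((n : ℝ) - 1) * θ + x < 2 * Real.pi)

include hx0 hx h

omit h in
theorem mul_le_of_lt {j : ℕ} (hj : j < n) : (j : ℝ) * θ ≤ ((n : ℝ) - 1) * θ := by
  have : (j : ℝ) + 1 ≤ n := by exact_mod_cast hj
  nlinarith

theorem disjoint_intervals {i j : ℕ} (hij : i < j) (hj : j < n) :
    Disjoint (sliceGeodesic (i * θ + x / 2) (i * θ - x / 2))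
      (sliceGeodesic (j * θ + x / 2) (j * θ - x / 2)) := by
  rw [sliceGeodesic_comm]
  have h1 : (i : ℝ) * θ + θ ≤ j * θ := by
    have : (i : ℝ) + 1 ≤ j := by exact_mod_cast hij
    nlinarith
  have h2 := mul_le_of_lt hx0 hx hj
  have h3 : 0 ≤ (i : ℝ) * θ := mul_nonneg i.cast_nonneg (by linarith)
  exact disjoint_sliceGeodesic_outside (by linarith) ⟨by linarith, by linarith⟩
    ⟨by linarith, by linarith⟩

theorem isRTCandidate_one : IsRTCandidate θ x (1 : Equiv.Perm (Fin n)) :=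
  isRTCandidate_of_lt fun _ j hij => disjoint_intervals hx0 hx h hij j.2

theorem isRTCandidate_finRotate : IsRTCandidate θ x (finRotate n) := by
  refine isRTCandidate_of_lt fun i j hij => ?_
  have hij' : (i : ℕ) < j := hij
  have h1 : ((i : ℕ) : ℝ) * θ + θ ≤ (j : ℕ) * θ := by
    have : ((i : ℕ) : ℝ) + 1 ≤ (j : ℕ) := by exact_mod_cast hij'
    nlinarith
  have h2 := mul_le_of_lt hx0 hx j.2
  have h3 : 0 ≤ ((i : ℕ) : ℝ) * θ := mul_nonneg (Nat.cast_nonneg _) (by linarith)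
  simp only [candidateGeodesic, rightEnd, leftEnd, finRotate_val]
  rw [if_pos (by omega)]
  split_ifs with hj
  · have h4 := mul_le_of_lt hx0 hx hj
    push_cast at h4 ⊢
    exact disjoint_sliceGeodesic_outside (by linarith) ⟨by linarith, by linarith⟩
      ⟨by linarith, by linarith⟩
  · rw [sliceGeodesic_comm (_ + x / 2) (((0 : ℕ) : ℝ) * θ - x / 2)]
    push_cast
    exact disjoint_sliceGeodesic_inside (by linarith) ⟨by linarith, by linarith⟩
      ⟨by linarith, by linarith⟩

theorem isRTCandidate_swap (hn : 2 ≤ n) {a b : Fin n} (ha : (a : ℕ) = 0)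
    (hb : (b : ℕ) = n - 1) : IsRTCandidate θ x (Equiv.swap a b) := by
  have hval : ∀ i : Fin n, (Equiv.swap a b i : ℕ) =
      if (i : ℕ) = 0 then n - 1 else if (i : ℕ) = n - 1 then 0 else i := by
    intro i
    rw [Equiv.swap_apply_def]
    simp only [Fin.ext_iff, ha, hb]
    split_ifs <;> simp only [ha, hb]
  have hn1 : ((n - 1 : ℕ) : ℝ) = n - 1 := by rw [Nat.cast_sub (by omega)]; simp
  refine isRTCandidate_of_lt fun i j hij => ?_
  have hij' : (i : ℕ) < j := hij
  have hi2 := i.2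
  have hj2 := j.2
  simp only [candidateGeodesic, rightEnd, leftEnd, hval]
  generalize (i : ℕ) = i at *
  generalize (j : ℕ) = j at *
  have h1 : (i : ℝ) * θ + θ ≤ j * θ := by
    have : (i : ℝ) + 1 ≤ j := by exact_mod_cast hij'
    nlinarith
  have h3 : 0 ≤ (i : ℝ) * θ := mul_nonneg (Nat.cast_nonneg _) (by linarith)
  rw [if_neg (by omega : ¬ j = 0)]
  have h4 := mul_le_of_lt hx0 hx hj2
  by_cases hj : j = n - 1
  · rw [if_pos hj]
    rw [sliceGeodesic_comm (_ + x / 2) (((0 : ℕ) : ℝ) * θ - x / 2)]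
    have h5 : (j : ℝ) * θ = (n - 1) * θ := by rw [hj, hn1]
    have h6 : (((n - 1 : ℕ) : ℝ)) * θ = (n - 1) * θ := by rw [hn1]
    refine disjoint_sliceGeodesic_inside ?_ ⟨?_, ?_⟩ ?_
    · push_cast; linarith
    · push_cast; linarith
    · linarith
    · split_ifs
      · rw [h6]; constructor <;> push_cast <;> linarith
      · omega
      · have : 0 < (i : ℝ) * θ :=
          mul_pos (by exact_mod_cast (by omega : 0 < i)) (by linarith)
        constructor <;> push_cast <;> linarith
  · rw [if_neg hj]
    by_cases hi : i = 0
    · rw [if_pos hi]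
      have h6 : (((n - 1 : ℕ) : ℝ)) * θ = (n - 1) * θ := by rw [hn1]
      have h7 : (j : ℝ) * θ + θ ≤ (n - 1) * θ := by
        have : (j : ℝ) + 2 ≤ n := by exact_mod_cast (by omega : j + 2 ≤ n)
        nlinarith
      have h8 : (i : ℝ) * θ = 0 := by rw [hi]; simp
      rw [h6]
      exact (disjoint_sliceGeodesic_inside (by linarith) ⟨by linarith, by linarith⟩
        ⟨by linarith, by linarith⟩).symm
    · rw [if_neg hi, if_neg (by omega)]
      exact disjoint_intervals hx0 hx h hij' hj2

end Candidates

/-! ### Lengths as products of half chords -/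

/-- Half the chord between the right endpoint of the `i`-th and the left endpoint of the `j`-th
interval. -/
noncomputable def halfChord {n : ℕ} (θ x : ℝ) (i j : Fin n) : ℝ :=
  |Real.sin ((leftEnd θ x j - rightEnd θ x i) / 2)|

section Chords

variable {n : ℕ} {θ x : ℝ} {i j : Fin n}

theorem leftEnd_sub_rightEnd (θ x : ℝ) (i j : Fin n) : leftEnd θ x j - rightEnd θ x i =
    (((j : ℕ) : ℝ) - (i : ℕ)) * θ - x := by
  rw [leftEnd, rightEnd]
  ring

variable (hx0 : 0 < x) (hx : x < θ) (h : ((n : ℝ) - 1) * θ + x < 2 * Real.pi)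

include hx0 hx h

theorem halfChord_of_lt (hij : i < j) :
    halfChord θ x i j = Real.sin (((((j : ℕ) : ℝ) - (i : ℕ)) * θ - x) / 2) := by
  have h1 : ((i : ℕ) : ℝ) + 1 ≤ (j : ℕ) := by exact_mod_cast (show (i : ℕ) < j from hij)
  have h2 := mul_le_of_lt hx0 hx j.2
  have h3 : 0 ≤ ((i : ℕ) : ℝ) * θ := mul_nonneg (Nat.cast_nonneg _) (by linarith)
  rw [halfChord, leftEnd_sub_rightEnd, abs_of_nonneg]
  exact Real.sin_nonneg_of_nonneg_of_le_pi (by nlinarith) (by linarith)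

theorem halfChord_of_le (hij : j ≤ i) :
    halfChord θ x i j = Real.sin (((((i : ℕ) : ℝ) - (j : ℕ)) * θ + x) / 2) := by
  have h1 : ((j : ℕ) : ℝ) ≤ (i : ℕ) := by exact_mod_cast (show (j : ℕ) ≤ i from hij)
  have h2 := mul_le_of_lt hx0 hx i.2
  have h3 : 0 ≤ ((j : ℕ) : ℝ) * θ := mul_nonneg (Nat.cast_nonneg _) (by linarith)
  rw [halfChord, leftEnd_sub_rightEnd, ← abs_neg, ← Real.sin_neg, abs_of_nonneg]
  · congr 1
    ring
  · exact Real.sin_nonneg_of_nonneg_of_le_pi (by nlinarith) (by linarith)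

theorem halfChord_pos (i j : Fin n) : 0 < halfChord θ x i j := by
  have h4 := mul_le_of_lt hx0 hx i.2
  have h2 := mul_le_of_lt hx0 hx j.2
  have h5 : 0 ≤ ((i : ℕ) : ℝ) * θ := mul_nonneg (Nat.cast_nonneg _) (by linarith)
  have h3 : 0 ≤ ((j : ℕ) : ℝ) * θ := mul_nonneg (Nat.cast_nonneg _) (by linarith)
  rcases lt_or_ge i j with hij | hij
  · have h1 : ((i : ℕ) : ℝ) + 1 ≤ (j : ℕ) := by exact_mod_cast (show (i : ℕ) < j from hij)
    rw [halfChord_of_lt hx0 hx h hij]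
    exact Real.sin_pos_of_pos_of_lt_pi (by nlinarith) (by linarith)
  · have h1 : ((j : ℕ) : ℝ) ≤ (i : ℕ) := by exact_mod_cast (show (j : ℕ) ≤ i from hij)
    rw [halfChord_of_le hx0 hx h hij]
    exact Real.sin_pos_of_pos_of_lt_pi (by nlinarith) (by linarith)

theorem candidateLength_eq (σ : Equiv.Perm (Fin n)) {ε : ℝ} (hε : 0 < ε) :
    candidateLength θ x σ ε = 2 * Real.log ((2 / ε) ^ n * ∏ i, halfChord θ x i (σ i)) := by
  have : (2 / ε) ^ n * ∏ i, halfChord θ x i (σ i) = ∏ i, (2 / ε * halfChord θ x i (σ i)) := by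
    rw [Finset.prod_mul_distrib, Finset.prod_const, Finset.card_univ, Fintype.card_fin]
  rw [this, Real.log_prod fun i _ => (mul_pos (div_pos two_pos hε) (halfChord_pos hx0 hx h i _)).ne',
    Finset.mul_sum]
  rfl

theorem halfChord_self (i : Fin n) : halfChord θ x i i = Real.sin (x / 2) := by
  rw [halfChord_of_le hx0 hx h le_rfl, sub_self, zero_mul, zero_add]

theorem halfChord_finRotate_of_lt (hi : (i : ℕ) + 1 < n) :
    halfChord θ x i (finRotate n i) = Real.sin ((θ - x) / 2) := by
  have hv := finRotate_val i
  rw [if_pos hi] at hv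
  rw [halfChord_of_lt hx0 hx h (show (i : ℕ) < finRotate n i by omega), hv]
  congr 2
  push_cast
  ring

theorem halfChord_finRotate_of_not_lt (hi : ¬ (i : ℕ) + 1 < n) :
    halfChord θ x i (finRotate n i) = Real.sin ((((n : ℝ) - 1) * θ + x) / 2) := by
  have hv := finRotate_val i
  rw [if_neg hi] at hv
  rw [halfChord_of_le hx0 hx h (show (finRotate n i : ℕ) ≤ i by omega), hv]
  have : ((i : ℕ) : ℝ) = n - 1 := by
    have : (i : ℕ) + 1 = n := by omega
    rw [eq_sub_iff_add_eq]
    exact_mod_cast this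
  rw [this, Nat.cast_zero, sub_zero]

theorem prod_halfChord_one : ∏ i : Fin n, halfChord θ x i ((1 : Equiv.Perm (Fin n)) i) =
    Real.sin (x / 2) ^ n := by
  simp [halfChord_self hx0 hx h]

theorem prod_halfChord_finRotate (hn : 0 < n) : ∏ i : Fin n, halfChord θ x i (finRotate n i) =
    Real.sin ((θ - x) / 2) ^ (n - 1) * Real.sin ((((n : ℝ) - 1) * θ + x) / 2) := by
  obtain ⟨m, rfl⟩ : ∃ m, n = m + 1 := ⟨n - 1, by omega⟩
  rw [Fin.prod_univ_castSucc, halfChord_finRotate_of_not_lt hx0 hx h (by simp)]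
  congr 1
  rw [Finset.prod_congr rfl fun i _ => halfChord_finRotate_of_lt hx0 hx h (by simp)]
  simp

theorem prod_halfChord_swap (hn : 2 ≤ n) {a b : Fin n} (ha : (a : ℕ) = 0)
    (hb : (b : ℕ) = n - 1) : ∏ i : Fin n, halfChord θ x i (Equiv.swap a b i) =
    Real.sin (x / 2) ^ (n - 2) * Real.sin ((((n : ℝ) - 1) * θ + x) / 2) *
      Real.sin ((((n : ℝ) - 1) * θ - x) / 2) := by
  obtain ⟨m, rfl⟩ : ∃ m, n = m + 2 := ⟨n - 2, by omega⟩
  obtain rfl : a = 0 := Fin.ext ha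
  obtain rfl : b = Fin.last (m + 1) := Fin.ext hb
  rw [Fin.prod_univ_succ, Fin.prod_univ_castSucc, Equiv.swap_apply_left, Fin.succ_last,
    Equiv.swap_apply_right, halfChord_of_lt hx0 hx h (Fin.last_pos),
    halfChord_of_le hx0 hx h (Fin.zero_le _)]
  have hmid : ∀ i : Fin m, halfChord θ x i.castSucc.succ
      (Equiv.swap 0 (Fin.last (m + 1)) i.castSucc.succ) = Real.sin (x / 2) := by
    intro i
    rw [Equiv.swap_apply_of_ne_of_ne (Fin.succ_ne_zero _)
      (by rw [Ne, Fin.ext_iff]; simp only [Fin.val_succ, Fin.val_castSucc, Fin.val_last]; omega),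
      halfChord_self hx0 hx h]
  rw [Finset.prod_congr rfl fun i _ => hmid i]
  simp only [Finset.prod_const, Finset.card_univ, Fintype.card_fin, Fin.val_last, Fin.val_zero]
  push_cast
  rw [show (m : ℝ) + 2 - 1 = m + 1 by ring, sub_zero]
  ring

/-- The lengths of the three distinguished candidate surfaces. -/
theorem phases (hn : 2 ≤ n) {a b : Fin n} (ha : (a : ℕ) = 0) (hb : (b : ℕ) = n - 1) :
    (IsRTCandidate θ x (finRotate n) ∧ ∀ ε > 0,
      candidateLength θ x (finRotate n) ε = 2 * Real.log ((2 / ε) ^ n *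
        (Real.sin ((θ - x) / 2) ^ (n - 1) * Real.sin ((((n : ℝ) - 1) * θ + x) / 2)))) ∧
    (IsRTCandidate θ x (1 : Equiv.Perm (Fin n)) ∧ ∀ ε > 0,
      candidateLength θ x (1 : Equiv.Perm (Fin n)) ε =
        2 * Real.log ((2 / ε) ^ n * Real.sin (x / 2) ^ n)) ∧
    (IsRTCandidate θ x (Equiv.swap a b) ∧ ∀ ε > 0,
      candidateLength θ x (Equiv.swap a b) ε =
        2 * Real.log ((2 / ε) ^ n * (Real.sin (x / 2) ^ (n - 2) *
          Real.sin ((((n : ℝ) - 1) * θ + x) / 2) *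
          Real.sin ((((n : ℝ) - 1) * θ - x) / 2)))) := by
  refine ⟨⟨isRTCandidate_finRotate hx0 hx h, fun ε hε => ?_⟩,
    ⟨isRTCandidate_one hx0 hx h, fun ε hε => ?_⟩,
    ⟨isRTCandidate_swap hx0 hx h hn ha hb, fun ε hε => ?_⟩⟩
  · rw [candidateLength_eq hx0 hx h _ hε, prod_halfChord_finRotate hx0 hx h (by omega)]
  · rw [candidateLength_eq hx0 hx h _ hε, prod_halfChord_one hx0 hx h]
  · rw [candidateLength_eq hx0 hx h _ hε, prod_halfChord_swap hx0 hx h hn ha hb]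

end Chords

/-! ### The homology region and the fully connected phase -/

/-- The point of the closed hemisphere above a point of the closed unit disc. -/
noncomputable def discLift (v : ℝ × ℝ) : E3 := !₂[v.1, v.2, √(1 - v.1 ^ 2 - v.2 ^ 2)]

theorem continuous_discLift : Continuous discLift := by
  refine (PiLp.continuous_toLp 2 _).comp (continuous_pi fun i => ?_)
  fin_cases i
  · exact continuous_fst
  · exact continuous_snd
  · exact ((continuous_const.sub (continuous_fst.pow 2)).sub (continuous_snd.pow 2)).sqrt

theorem discLift_mem_hemisphere {v : ℝ × ℝ} (hv : v.1 ^ 2 + v.2 ^ 2 ≤ 1) :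
    discLift v ∈ hemisphere := by
  refine ⟨?_, Real.sqrt_nonneg _⟩
  rw [discLift, EuclideanSpace.norm_eq, Fin.sum_univ_three, Real.sqrt_eq_one]
  simp only [Real.norm_eq_abs, sq_abs, Matrix.cons_val]
  rw [Real.sq_sqrt (by linarith)]
  ring

theorem circlePoint_eq_discLift (α : ℝ) : circlePoint α = discLift (Real.cos α, Real.sin α) := by
  have : 1 - Real.cos α ^ 2 - Real.sin α ^ 2 = 0 := by linarith [Real.sin_sq_add_cos_sq α]
  simp [discLift, circlePoint, this]

theorem proj_discLift (v : ℝ × ℝ) (φ : ℝ) :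
    proj (discLift v) φ = v.1 * Real.cos φ + v.2 * Real.sin φ := rfl

section ConnectedPhase

variable {n : ℕ} {θ x : ℝ} (hx0 : 0 < x) (hx : x < θ) (h : ((n : ℝ) - 1) * θ + x < 2 * Real.pi)

/-- The part of the unit disc on the inner side of the chords below the fully connected surface. -/
def innerDisc (n : ℕ) (θ x : ℝ) : Set (ℝ × ℝ) :=
  {v | v.1 ^ 2 + v.2 ^ 2 ≤ 1 ∧
    (∀ i : ℕ, i + 1 < n → v.1 * Real.cos (((i : ℝ) + 1 / 2) * θ) +
      v.2 * Real.sin (((i : ℝ) + 1 / 2) * θ) < Real.cos ((θ - x) / 2)) ∧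
    Real.cos ((((n : ℝ) - 1) * θ + x) / 2) <
      v.1 * Real.cos (((n : ℝ) - 1) * θ / 2) + v.2 * Real.sin (((n : ℝ) - 1) * θ / 2)}

theorem convex_innerDisc : Convex ℝ (innerDisc n θ x) := by
  rw [convex_iff_forall_pos]
  rintro ⟨v1, v2⟩ ⟨hv, hvi, hvo⟩ ⟨w1, w2⟩ ⟨hw, hwi, hwo⟩ a b ha hb hab
  simp only [innerDisc, Prod.smul_mk, Prod.mk_add_mk, smul_eq_mul, mem_ofPred_eq] at *
  refine ⟨?_, fun i hi => ?_, ?_⟩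
  · have e : (a * v1 + b * w1) ^ 2 + (a * v2 + b * w2) ^ 2 =
        a * (v1 ^ 2 + v2 ^ 2) + b * (w1 ^ 2 + w2 ^ 2) -
          a * b * ((v1 - w1) ^ 2 + (v2 - w2) ^ 2) := by
      obtain rfl : b = 1 - a := by linarith
      ring
    have := mul_nonneg (mul_pos ha hb).le (add_nonneg (sq_nonneg (v1 - w1)) (sq_nonneg (v2 - w2)))
    rw [e]
    nlinarith
  · have h1 := mul_lt_mul_of_pos_left (hvi i hi) ha
    have h2 := mul_lt_mul_of_pos_left (hwi i hi) hb
    have h3 : a * Real.cos ((θ - x) / 2) + b * Real.cos ((θ - x) / 2) = Real.cos ((θ - x) / 2) := by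
      rw [← add_mul, hab, one_mul]
    linarith
  · have h1 := mul_lt_mul_of_pos_left hvo ha
    have h2 := mul_lt_mul_of_pos_left hwo hb
    have h3 : a * Real.cos ((((n : ℝ) - 1) * θ + x) / 2) +
        b * Real.cos ((((n : ℝ) - 1) * θ + x) / 2) = Real.cos ((((n : ℝ) - 1) * θ + x) / 2) := by
      rw [← add_mul, hab, one_mul]
    linarith

include hx0 hx h

theorem mem_innerDisc_of_mem_interval {i : Fin n} {α : ℝ}
    (hα : α ∈ Ioo (leftEnd θ x i) (rightEnd θ x i)) :
    (Real.cos α, Real.sin α) ∈ innerDisc n θ x := by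
  have hi := mul_le_of_lt hx0 hx i.2
  have hi0 : 0 ≤ ((i : ℕ) : ℝ) * θ := mul_nonneg (Nat.cast_nonneg _) (by linarith)
  rw [leftEnd, rightEnd] at hα
  obtain ⟨hα1, hα2⟩ := hα
  refine ⟨by linarith [Real.sin_sq_add_cos_sq α], fun k hk => ?_, ?_⟩
  · change Real.cos α * _ + Real.sin α * _ < _
    rw [← Real.cos_sub]
    have hk1 := mul_le_of_lt hx0 hx hk
    push_cast at hk1
    have hk0 : 0 ≤ (k : ℝ) * θ := mul_nonneg k.cast_nonneg (by linarith)
    rcases Nat.lt_or_ge k i with hki | hki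
    · have h1 : (k : ℝ) * θ + θ ≤ (i : ℕ) * θ := by
        have : (k : ℝ) + 1 ≤ (i : ℕ) := by exact_mod_cast hki
        nlinarith
      exact cos_lt_cos_of_mem_Ioo (by linarith) (by linarith) (by linarith)
    · have h1 : ((i : ℕ) : ℝ) * θ ≤ k * θ := by
        have : ((i : ℕ) : ℝ) ≤ k := by exact_mod_cast hki
        nlinarith
      rw [← Real.cos_neg, neg_sub]
      exact cos_lt_cos_of_mem_Ioo (by linarith) (by linarith) (by linarith)
  · change _ < Real.cos α * _ + Real.sin α * _
    rw [← Real.cos_sub, ← Real.cos_abs (α - _)]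
    refine Real.cos_lt_cos_of_nonneg_of_le_pi (abs_nonneg _) (by linarith) ?_
    rw [abs_lt]
    constructor <;> linarith

omit hx0 hx h in
theorem discLift_mem_surfaceComplement {v : ℝ × ℝ} (hv : v ∈ innerDisc n θ x) :
    discLift v ∈ surfaceComplement θ x (finRotate n) := by
  obtain ⟨h1, h2, h3⟩ := hv
  refine ⟨discLift_mem_hemisphere h1, fun i hi => ?_⟩
  have hp := proj_midpoint_of_mem_sliceGeodesic hi
  rw [proj_discLift] at hp
  simp only [leftEnd, rightEnd, finRotate_val] at hp
  split_ifs at hp with hin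
  · refine (h2 i hin).ne ?_
    convert hp using 3 <;> push_cast <;> ring_nf
  · have hi' : ((i : ℕ) : ℝ) = n - 1 := by
      have : (i : ℕ) + 1 = n := by omega
      rw [eq_sub_iff_add_eq]
      exact_mod_cast this
    refine h3.ne' ?_
    rw [hi', ← Real.cos_neg ((_ - _) / 2)] at hp
    convert hp using 3 <;> push_cast <;> ring_nf

/-- The disc cut by the half-planes of the chords is convex and contains every interval. Its lift
joins all intervals within the complement, so the homology region is a single path component. -/
theorem isConnected_homologyRegion_finRotate (hn : 0 < n) :
    IsConnected (homologyRegion θ x (finRotate n)) := by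
  have hmem : (0 : ℝ) ∈ Ioo (leftEnd θ x (⟨0, hn⟩ : Fin n)) (rightEnd θ x (⟨0, hn⟩ : Fin n)) := by
    simp [leftEnd, rightEnd, hx0]
  have hlift : ∀ {i : Fin n} {α : ℝ}, α ∈ Ioo (leftEnd θ x i) (rightEnd θ x i) →
      JoinedIn (surfaceComplement θ x (finRotate n)) (circlePoint 0) (circlePoint α) := by
    intro i α hα
    have h0 := mem_innerDisc_of_mem_interval hx0 hx h hmem
    have h1 := mem_innerDisc_of_mem_interval hx0 hx h hα
    have hpc : IsPathConnected (discLift '' innerDisc n θ x) :=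
      (convex_innerDisc.isPathConnected ⟨_, h0⟩).image continuous_discLift
    have := hpc.joinedIn _ (mem_image_of_mem _ h0) _ (mem_image_of_mem _ h1)
    rw [← circlePoint_eq_discLift, ← circlePoint_eq_discLift] at this
    refine this.mono ?_
    rintro _ ⟨v, hv, rfl⟩
    exact discLift_mem_surfaceComplement hv
  have heq : homologyRegion θ x (finRotate n) =
      pathComponentIn (surfaceComplement θ x (finRotate n)) (circlePoint 0) := by
    ext p
    constructor
    · rintro ⟨i, α, hα, hp⟩
      exact (hlift hα).trans hp
    · intro hp
      exact ⟨_, 0, hmem, hp⟩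
  rw [heq]
  exact (isPathConnected_pathComponentIn (hlift hmem).source_mem).isConnected

theorem entanglementWedgeConnected_of_prod_lt (hn : 0 < n)
    (hlt : ∀ τ : Equiv.Perm (Fin n), τ ≠ finRotate n →
      ∏ i, halfChord θ x i (finRotate n i) < ∏ i, halfChord θ x i (τ i)) :
    EntanglementWedgeConnected n θ x := by
  refine ⟨finRotate n, ⟨isRTCandidate_finRotate hx0 hx h, fun τ _ hne ε hε => ?_⟩,
    isConnected_homologyRegion_finRotate hx0 hx h hn⟩
  rw [candidateLength_eq hx0 hx h _ hε, candidateLength_eq hx0 hx h _ hε]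
  have hpos : 0 < (2 / ε) ^ n := by positivity
  refine mul_lt_mul_of_pos_left (Real.log_lt_log ?_ ?_) two_pos
  · exact mul_pos hpos (Finset.prod_pos fun i _ => halfChord_pos hx0 hx h i _)
  · exact mul_lt_mul_of_pos_left (hlt τ hne) hpos

omit h in
-- From any right endpoint, the next left endpoint is at arc distance at most `θ - x ≤ x`, the
-- interval's own left endpoint at `x`, and all others are strictly farther on both sides. This
-- holds across the last gap too, because `2 * π ≤ n * θ`.
theorem halfChord_finRotate_le_and_lt (hθ : 2 * Real.pi ≤ n * θ) (hx2 : θ ≤ 2 * x)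
    (h : ((n : ℝ) - 1) * θ + x < 2 * Real.pi) (i j : Fin n) :
    halfChord θ x i (finRotate n i) ≤ halfChord θ x i j ∧
      (j ≠ i → j ≠ finRotate n i → halfChord θ x i (finRotate n i) < halfChord θ x i j) := by
  have hv := finRotate_val i
  by_cases hin : (i : ℕ) + 1 < n
  · rw [halfChord_finRotate_of_lt hx0 hx h hin]
    rw [if_pos hin] at hv
    have hi := mul_le_of_lt hx0 hx hin
    push_cast at hi
    have hj := mul_le_of_lt hx0 hx j.2
    have hi0 : 0 ≤ ((i : ℕ) : ℝ) * θ := mul_nonneg (Nat.cast_nonneg _) (by linarith)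
    have hj0 : 0 ≤ ((j : ℕ) : ℝ) * θ := mul_nonneg (Nat.cast_nonneg _) (by linarith)
    rcases lt_or_ge i j with hij | hij
    · have hij1 : (i : ℕ) < j := hij
      have h1 : ((i : ℕ) : ℝ) * θ + θ ≤ (j : ℕ) * θ := by
        have : ((i : ℕ) : ℝ) + 1 ≤ (j : ℕ) := by exact_mod_cast hij1
        nlinarith
      rw [halfChord_of_lt hx0 hx h hij]
      refine ⟨sin_half_le_sin_half (by linarith) (by linarith) (by linarith), fun _ hne => ?_⟩
      have h2 : ((i : ℕ) : ℝ) * θ + 2 * θ ≤ (j : ℕ) * θ := by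
        have : (j : ℕ) ≠ finRotate n i := fun h => hne (Fin.ext h)
        have : ((i : ℕ) : ℝ) + 2 ≤ (j : ℕ) := by exact_mod_cast (by omega : (i : ℕ) + 2 ≤ j)
        nlinarith
      exact sin_half_lt_sin_half (by linarith) (by linarith) (by linarith)
    · have hij1 : (j : ℕ) ≤ i := hij
      have h1 : ((j : ℕ) : ℝ) * θ ≤ (i : ℕ) * θ := by
        have : ((j : ℕ) : ℝ) ≤ (i : ℕ) := by exact_mod_cast hij1
        nlinarith
      rw [halfChord_of_le hx0 hx h hij]
      refine ⟨sin_half_le_sin_half (by linarith) (by linarith) (by linarith), fun hne _ => ?_⟩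
      have h2 : ((j : ℕ) : ℝ) * θ + θ ≤ (i : ℕ) * θ := by
        have : (j : ℕ) ≠ i := fun h => hne (Fin.ext h)
        have : ((j : ℕ) : ℝ) + 1 ≤ (i : ℕ) := by exact_mod_cast (by omega : (j : ℕ) + 1 ≤ i)
        nlinarith
      exact sin_half_lt_sin_half (by linarith) (by linarith) (by linarith)
  · rw [halfChord_finRotate_of_not_lt hx0 hx h hin]
    rw [if_neg hin] at hv
    have hi : ((i : ℕ) : ℝ) * θ = ((n : ℝ) - 1) * θ := by
      have : ((i : ℕ) : ℝ) + 1 = n := by exact_mod_cast (by omega : (i : ℕ) + 1 = n)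
      rw [← this]
      ring
    have hj0 : 0 ≤ ((j : ℕ) : ℝ) * θ := mul_nonneg (Nat.cast_nonneg _) (by linarith)
    have hj := mul_le_of_lt hx0 hx j.2
    rw [halfChord_of_le hx0 hx h (show (j : ℕ) ≤ i by omega)]
    -- The last chord is measured along the complementary arc, which is the gap between the last and
    -- first intervals.
    have e : Real.sin ((((n : ℝ) - 1) * θ + x) / 2) =
        Real.sin ((2 * Real.pi - (((n : ℝ) - 1) * θ + x)) / 2) := by
      rw [← Real.sin_pi_sub]
      congr 1
      ring
    rw [e]
    refine ⟨sin_half_le_sin_half (by linarith) (by linarith) (by linarith), fun hne hne' => ?_⟩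
    have h1 : θ ≤ ((j : ℕ) : ℝ) * θ := by
      have : (j : ℕ) ≠ finRotate n i := fun h => hne' (Fin.ext h)
      have : (1 : ℝ) ≤ (j : ℕ) := by exact_mod_cast (by omega : 1 ≤ (j : ℕ))
      nlinarith
    have h2 : ((j : ℕ) : ℝ) * θ + θ ≤ (i : ℕ) * θ := by
      have : (j : ℕ) ≠ i := fun h => hne (Fin.ext h)
      have : ((j : ℕ) : ℝ) + 1 ≤ (i : ℕ) := by exact_mod_cast (by omega : (j : ℕ) + 1 ≤ i)
      nlinarith
    exact sin_half_lt_sin_half (by linarith) (by linarith) (by linarith)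

theorem prod_halfChord_finRotate_lt (hn : 2 ≤ n) (hθ : 2 * Real.pi ≤ n * θ) (hx2 : θ ≤ 2 * x)
    {τ : Equiv.Perm (Fin n)} (hτ : τ ≠ finRotate n) (hτ1 : τ = 1 → 2 * Real.pi < n * θ) :
    ∏ i, halfChord θ x i (finRotate n i) < ∏ i, halfChord θ x i (τ i) := by
  have key := halfChord_finRotate_le_and_lt hx0 hx hθ hx2 h
  refine Finset.prod_lt_prod (fun i _ => halfChord_pos hx0 hx h i _) (fun i _ => (key i _).1) ?_
  by_cases hτ' : τ = 1
  · have hlt := hτ1 hτ'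
    -- If `2 * π < n * θ`, the last gap is shorter than `θ - x ≤ x`, so the tie with the identity is
    -- broken there.
    refine ⟨⟨n - 1, by omega⟩, Finset.mem_univ _, ?_⟩
    rw [hτ', Equiv.Perm.one_apply, halfChord_self hx0 hx h,
      halfChord_finRotate_of_not_lt hx0 hx h (by simp only; omega), ← Real.sin_pi_sub,
      show Real.pi - (((n : ℝ) - 1) * θ + x) / 2 =
        (2 * Real.pi - (((n : ℝ) - 1) * θ + x)) / 2 by ring]
    have h2 : (2 : ℝ) ≤ n := by exact_mod_cast hn
    have h3 : θ ≤ ((n : ℝ) - 1) * θ := by nlinarith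
    exact sin_half_lt_sin_half (by linarith) (by linarith) (by linarith)
  · by_contra! hall
    rcases perm_eq_one_or_finRotate hn (τ := τ) (fun i => by
      by_contra! hne
      exact absurd ((key i (τ i)).2 hne.1 hne.2) (not_lt.2 (hall i (Finset.mem_univ i)))) with
      h1 | h1
    · exact hτ' h1
    · exact hτ h1

end ConnectedPhase

/-! ### Connected wedge without connected graph -/

theorem continuous_prod_halfChord {n : ℕ} (τ : Equiv.Perm (Fin n)) :
    Continuous fun v : ℝ × ℝ => ∏ i, halfChord v.1 v.2 i (τ i) := by
  unfold halfChord leftEnd rightEnd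
  fun_prop

theorem eventually_prod_halfChord_lt {n : ℕ} {P : Equiv.Perm (Fin n) → Prop} {v₀ : ℝ × ℝ}
    (h : ∀ τ, P τ → ∏ i, halfChord v₀.1 v₀.2 i (finRotate n i) <
      ∏ i, halfChord v₀.1 v₀.2 i (τ i)) :
    ∀ᶠ v in 𝓝 v₀, ∀ τ, P τ → ∏ i, halfChord v.1 v.2 i (finRotate n i) <
      ∏ i, halfChord v.1 v.2 i (τ i) := by
  rw [eventually_all]
  intro τ
  by_cases hτ : P τ
  · have : IsOpen {v : ℝ × ℝ | ∏ i, halfChord v.1 v.2 i (finRotate n i) <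
        ∏ i, halfChord v.1 v.2 i (τ i)} :=
      isOpen_lt (continuous_prod_halfChord _) (continuous_prod_halfChord τ)
    filter_upwards [this.mem_nhds (h τ hτ)] with v hv _
    exact hv
  · exact Eventually.of_forall fun _ h => absurd h hτ

section Discrepancy

variable {n : ℕ}

theorem entanglementWedgeConnected_of_spacedGraph_connected {θ x : ℝ} (hn : 3 ≤ n) (hx0 : 0 < x)
    (hx : x < θ) (h : ((n : ℝ) - 1) * θ + x < 2 * Real.pi) (hθ : 2 * Real.pi / n < θ)
    (hconn : (spacedGraph n θ x).Connected) : EntanglementWedgeConnected n θ x := by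
  have hx2 := le_of_spacedGraph_connected (by omega) hx0 h.le hθ.le
    (lt_pi_of_three_le hn hx0 h.le).le hconn
  have hn3 : (3 : ℝ) ≤ n := by exact_mod_cast hn
  rw [div_lt_iff₀ (by linarith)] at hθ
  exact entanglementWedgeConnected_of_prod_lt hx0 hx h (by omega) fun τ hτ =>
    prod_halfChord_finRotate_lt hx0 hx h (by omega) (by linarith) hx2 hτ fun _ => by linarith

theorem exists_discrepancy_of_large {θ : ℝ} (hn : 3 ≤ n) (hθ : 2 * Real.pi / n < θ)
    (hθ' : θ < 4 * Real.pi / (2 * n - 1)) :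
    ∃ x : ℝ, 0 < x ∧ x < θ ∧ ((n : ℝ) - 1) * θ + x < 2 * Real.pi ∧
      EntanglementWedgeConnected n θ x ∧ ¬ (spacedGraph n θ x).Connected := by
  have hn3 : (3 : ℝ) ≤ n := by exact_mod_cast hn
  have hθ0 : 0 < θ := (div_pos Real.two_pi_pos (by linarith)).trans hθ
  have hθ1 := hθ
  rw [div_lt_iff₀ (by linarith)] at hθ1
  rw [lt_div_iff₀ (by linarith)] at hθ'
  -- At `x = θ / 2` the shift already wins strictly, while the graph disconnects just below this
  -- value. The upper bound on `θ` keeps the inputs disjoint at `x = θ / 2`.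
  have hev := eventually_prod_halfChord_lt (n := n) (P := fun τ => τ ≠ finRotate n)
    (v₀ := (θ, θ / 2)) fun τ hτ => prod_halfChord_finRotate_lt (by linarith) (by linarith)
      (by linarith) (by omega) (by linarith) (by linarith) hτ fun _ => by linarith
  have hcont : Continuous fun x : ℝ => (θ, x) := by fun_prop
  replace hev := (hcont.tendsto (θ / 2)).eventually hev
  have hev2 : ∀ᶠ x in 𝓝[<] (θ / 2), x ∈ Ioo 0 (θ / 2) := Ioo_mem_nhdsLT (by linarith)
  obtain ⟨x, hx1, hx2⟩ := ((hev.filter_mono nhdsWithin_le_nhds).and hev2).exists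
  have hlt : ((n : ℝ) - 1) * θ + x < 2 * Real.pi := by linarith [hx2.2]
  refine ⟨x, hx2.1, by linarith [hx2.2], hlt,
    entanglementWedgeConnected_of_prod_lt hx2.1 (by linarith [hx2.2]) hlt (by omega) hx1, ?_⟩
  rw [spacedGraph_connected_iff_of_large (by omega) hx2.1 hlt.le hθ.le
    (lt_pi_of_three_le hn hx2.1 hlt.le).le]
  linarith [hx2.2]

/-- The inequality of arithmetic and geometric means for `n - 1` equal numbers and one more,
obtained from Bernoulli's inequality. -/
theorem pow_mul_le_mean_pow {a b : ℝ} (hn : 0 < n) (ha : 0 < a) (hb : 0 ≤ b) :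
    a ^ (n - 1) * b ≤ ((((n : ℝ) - 1) * a + b) / n) ^ n := by
  have hn1 : (1 : ℝ) ≤ n := by exact_mod_cast hn
  have hne : (n : ℝ) ≠ 0 := by positivity
  have h1 : -2 ≤ (b - a) / (n * a) := by
    rw [le_div_iff₀ (by positivity)]
    nlinarith
  have h2 := one_add_mul_le_pow h1 n
  have h3 : 1 + (n : ℝ) * ((b - a) / (n * a)) = b / a := by
    field_simp
    ring
  have h4 : (((n : ℝ) - 1) * a + b) / n = a * (1 + (b - a) / (n * a)) := by
    field_simp
    ring
  rw [h3] at h2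
  rw [h4, mul_pow]
  calc a ^ (n - 1) * b = a ^ n * (b / a) := by
        rw [← Nat.sub_add_cancel hn, pow_succ]
        field_simp
        rw [Nat.add_sub_cancel]
        exact mul_comm _ _
    _ ≤ _ := mul_le_mul_of_nonneg_left h2 (by positivity)

/-- The hypothesis is `cos (t + x) > cos (t + A) * cos A` at the critical time `t`, with `t`
eliminated through its tangent. Being free of `arctan` and `arccos`, it is easy to expand. -/
theorem lt_criticalSize_of_pos {A D x : ℝ} (hA : 0 < A) (hD : 0 ≤ D) (h : D + 2 * A < Real.pi)
    (hx : x ≤ 2 * A)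
    (hpos : 0 < (Real.cos x - Real.cos A ^ 2) * criticalDen A D -
      Real.sin A * Real.sin D * (Real.sin x - Real.sin A * Real.cos A)) :
    x < criticalSize A D := by
  by_contra! hle
  have h0 := criticalTime_nonneg hA hD h
  have h1 := criticalTime_add_lt hA hD h
  have h2 := cos_criticalTime_add_criticalSize hA hD h
  have h3 := Real.cos_le_cos_of_nonneg_of_le_pi criticalTime_add_criticalSize_nonneg
    (by linarith) (by linarith : criticalTime A D + criticalSize A D ≤ criticalTime A D + x)
  rw [h2, Real.cos_add, Real.cos_add] at h3
  have h4 := sin_criticalTime_mul hA hD h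
  have h5 := mul_le_mul_of_nonneg_right h3 (criticalDen_pos hA hD h).le
  have h6 := mul_pos (cos_criticalTime_pos (A := A) (D := D)) hpos
  have e : Real.cos (criticalTime A D) * ((Real.cos x - Real.cos A ^ 2) * criticalDen A D -
      Real.sin A * Real.sin D * (Real.sin x - Real.sin A * Real.cos A)) =
      (Real.cos (criticalTime A D) * Real.cos x - Real.sin (criticalTime A D) * Real.sin x) *
        criticalDen A D - (Real.cos (criticalTime A D) * Real.cos A -
          Real.sin (criticalTime A D) * Real.sin A) * Real.cos A * criticalDen A D := by
    linear_combination (Real.sin x - Real.sin A * Real.cos A) * h4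
  linarith

/-- The quantity whose sign decides whether `x` is below the critical size, along a path that
starts at the transition between small and large spacing. -/
theorem eventually_criticalGap_pos {a k : ℝ} (ha : 0 < a) (ha' : a < Real.pi / 2) :
    ∀ᶠ s in 𝓝[>] (0 : ℝ), 0 <
      (Real.cos (a - k * s + s / 4) - Real.cos (a - k * s) ^ 2) *
        (Real.cos (a - k * s) * Real.sin (s + 2 * (a - k * s)) -
          2 * Real.cos (s + 2 * (a - k * s)) * Real.sin (a - k * s)) -
      Real.sin (a - k * s) * Real.sin (s + 2 * (a - k * s)) *
        (Real.sin (a - k * s + s / 4) - Real.sin (a - k * s) * Real.cos (a - k * s)) := by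
  have hA : HasDerivAt (fun s : ℝ => a - k * s) (-k) 0 := by
    simpa using ((hasDerivAt_id (0 : ℝ)).const_mul k).const_sub a
  have hX : HasDerivAt (fun s : ℝ => a - k * s + s / 4) (-k + 1 / 4) 0 :=
    hA.fun_add ((hasDerivAt_id (0 : ℝ)).div_const 4)
  have hE : HasDerivAt (fun s : ℝ => s + 2 * (a - k * s)) (1 + 2 * -k) 0 :=
    (hasDerivAt_id (0 : ℝ)).fun_add (hA.const_mul 2)
  have hder := ((hX.cos.fun_sub (hA.cos.fun_pow 2)).fun_mul ((hA.cos.fun_mul hE.sin).fun_sub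
    ((hE.cos.const_mul 2).fun_mul hA.sin))).fun_sub ((hA.sin.fun_mul hE.sin).fun_mul
      (hX.sin.fun_sub (hA.sin.fun_mul hA.cos)))
  -- The gap vanishes at `s = 0`, so its first derivative decides. The terms in `k` cancel; the
  -- slope `1 / 4` of `x - θ / 2` leaves `(1 - cos a) ^ 2 / 2`, positive for every `a` in the range.
  have hval := hder.congr_deriv (g' := (1 - Real.cos a) ^ 2 / 2) (by
    have hsq := Real.sin_sq_add_cos_sq a
    simp only [mul_zero, sub_zero, zero_div, add_zero, zero_add, Real.sin_two_mul,
      Real.cos_two_mul, Nat.cast_ofNat]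
    generalize Real.sin a = s at *
    generalize Real.cos a = c at *
    norm_num
    grind)
  have hc : Real.cos a < 1 := by
    rw [← Real.cos_zero]
    exact Real.cos_lt_cos_of_nonneg_of_le_pi le_rfl (by linarith) ha
  have hslope := (hasDerivAt_iff_tendsto_slope.1 hval).eventually
    (lt_mem_nhds (show 0 < (1 - Real.cos a) ^ 2 / 2 by
      have : 0 < 1 - Real.cos a := by linarith
      positivity))
  have hsub : 𝓝[>] (0 : ℝ) ≤ 𝓝[≠] 0 := nhdsWithin_mono _ fun y hy => ne_of_gt hy
  filter_upwards [hslope.filter_mono hsub, self_mem_nhdsWithin] with s hs hs0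
  rw [slope_def_field, sub_zero] at hs
  have h0 := (div_pos_iff_of_pos_right (show 0 < s from hs0)).1 hs
  have hzero : (Real.cos (a - k * 0 + 0 / 4) - Real.cos (a - k * 0) ^ 2) *
        (Real.cos (a - k * 0) * Real.sin (0 + 2 * (a - k * 0)) -
          2 * Real.cos (0 + 2 * (a - k * 0)) * Real.sin (a - k * 0)) -
      Real.sin (a - k * 0) * Real.sin (0 + 2 * (a - k * 0)) *
        (Real.sin (a - k * 0 + 0 / 4) - Real.sin (a - k * 0) * Real.cos (a - k * 0)) = 0 := by
    have hsq := Real.sin_sq_add_cos_sq a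
    simp only [mul_zero, sub_zero, zero_div, add_zero, zero_add, Real.sin_two_mul,
      Real.cos_two_mul]
    grind
  linarith

/-- In half-angles the gaps are `n - 1` copies of `u` and one `u + s`, with mean `u + s / n`. The
mean inequality and strict concavity of the sine bound the product by `sin (u + s / n) ^ n`, and `u
+ s / n` is at most half of `x` exactly because `s / n ≤ s / 4`. This is where `4 ≤ n` enters. -/
theorem prod_halfChord_finRotate_lt_one {a s : ℝ} (hn : 4 ≤ n) (ha : n * a = Real.pi) (hs : 0 < s)
    (hs' : s < a / 4) :
    Real.sin ((2 * (a - s / n) - (a - s / n + s / 4)) / 2) ^ (n - 1) *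
        Real.sin ((((n : ℝ) - 1) * (2 * (a - s / n)) + (a - s / n + s / 4)) / 2) <
      Real.sin ((a - s / n + s / 4) / 2) ^ n := by
  have hn4 : (4 : ℝ) ≤ n := by exact_mod_cast hn
  have hn0 : (n : ℝ) ≠ 0 := by positivity
  have ha0 : 0 < a := by linarith
  have haπ : 4 * a ≤ Real.pi := by nlinarith
  have hsn : s / n ≤ s / 4 := div_le_div_of_nonneg_left hs.le (by norm_num) hn4
  have hsn0 : 0 < s / n := by positivity
  set u := (2 * (a - s / n) - (a - s / n + s / 4)) / 2 with hu
  have hw : Real.sin ((((n : ℝ) - 1) * (2 * (a - s / n)) + (a - s / n + s / 4)) / 2) =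
      Real.sin (u + s) := by
    rw [← Real.sin_pi_sub, ← ha, hu]
    congr 1
    field_simp
    ring
  rw [hw]
  have hsu : 0 < Real.sin u := Real.sin_pos_of_pos_of_lt_pi (by linarith) (by linarith)
  have hsw : 0 < Real.sin (u + s) := Real.sin_pos_of_pos_of_lt_pi (by linarith) (by linarith)
  refine (pow_mul_le_mean_pow (by omega) hsu hsw.le).trans_lt ?_
  refine pow_lt_pow_left₀ ?_ ?_ (by omega)
  · have hconc := strictConcaveOn_sin_Icc.2 (show u ∈ Icc 0 Real.pi from ⟨by linarith, by linarith⟩)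
      (show u + s ∈ Icc 0 Real.pi from ⟨by linarith, by linarith⟩) (by linarith)
      (show 0 < ((n : ℝ) - 1) / n from div_pos (by linarith) (by linarith))
      (show 0 < 1 / (n : ℝ) from div_pos one_pos (by linarith)) (by field_simp; ring)
    simp only [smul_eq_mul] at hconc
    have e1 : (((n : ℝ) - 1) * Real.sin u + Real.sin (u + s)) / n =
        ((n : ℝ) - 1) / n * Real.sin u + 1 / n * Real.sin (u + s) := by ring
    have e2 : ((n : ℝ) - 1) / n * u + 1 / n * (u + s) = u + s / n := by
      field_simp
      ring
    rw [e1]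
    rw [e2] at hconc
    refine hconc.trans_le ?_
    exact Real.sin_le_sin_of_le_of_le_pi_div_two (by linarith) (by linarith) (by linarith)
  · have : 0 ≤ ((n : ℝ) - 1) * Real.sin u := mul_nonneg (by linarith) hsu.le
    positivity

theorem exists_discrepancy_of_small (hn : 4 ≤ n) : ∃ θ x : ℝ, 0 < x ∧ x < θ ∧
    θ < 2 * Real.pi / n ∧ EntanglementWedgeConnected n θ x ∧ ¬ (spacedGraph n θ x).Connected := by
  have hn4 : (4 : ℝ) ≤ n := by exact_mod_cast hn
  have hn0 : (n : ℝ) ≠ 0 := by positivity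
  set a := Real.pi / n with ha
  have han : n * a = Real.pi := mul_div_cancel₀ _ hn0
  have ha0 : 0 < a := div_pos Real.pi_pos (by linarith)
  have haπ : 4 * a ≤ Real.pi := by nlinarith
  have hev := eventually_prod_halfChord_lt (n := n) (P := fun τ => τ ≠ finRotate n ∧ τ ≠ 1)
    (v₀ := (2 * a, a)) fun τ hτ => prod_halfChord_finRotate_lt (by linarith) (by linarith)
      (by linarith) (by omega) (by linarith) (by linarith) hτ.1 fun h => absurd h hτ.2
  -- Along this path `n * θ / 2 = π - s`, and `x` exceeds `θ / 2` by `s / 4`. At `s = 0` all gaps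
  -- and intervals are equal, so only the identity ties with the shift; the other candidates stay
  -- longer for small `s`.
  have hcont : Tendsto (fun s : ℝ => ((2 * (a - s / n), a - s / n + s / 4) : ℝ × ℝ)) (𝓝 0)
      (𝓝 (2 * a, a)) := by
    have : Continuous fun s : ℝ => ((2 * (a - s / n), a - s / n + s / 4) : ℝ × ℝ) := by fun_prop
    simpa using this.tendsto 0
  replace hev := hcont.eventually hev
  have hev2 : ∀ᶠ s in 𝓝[>] (0 : ℝ), s ∈ Ioo 0 (a / 4) := Ioo_mem_nhdsGT (by linarith)
  obtain ⟨s, ⟨hs1, hs2⟩, hs0, hsa⟩ := (((hev.filter_mono nhdsWithin_le_nhds).and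
    (eventually_criticalGap_pos (a := a) (k := 1 / n) ha0 (by linarith))).and hev2).exists
  rw [one_div_mul_eq_div] at hs2
  have hsn : s / n ≤ s / 4 := div_le_div_of_nonneg_left hs0.le (by norm_num) hn4
  have hsn0 : 0 < s / n := div_pos hs0 (by linarith)
  have hns : (n : ℝ) * (a - s / n) = Real.pi - s := by
    rw [mul_sub, han, mul_div_cancel₀ _ hn0]
  have hx0 : 0 < a - s / n + s / 4 := by linarith
  have hx : a - s / n + s / 4 < 2 * (a - s / n) := by linarith
  have hdisj : ((n : ℝ) - 1) * (2 * (a - s / n)) + (a - s / n + s / 4) < 2 * Real.pi := by linarith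
  have hθ : 2 * (a - s / n) < 2 * Real.pi / n := by rw [mul_div_assoc]; linarith
  refine ⟨2 * (a - s / n), a - s / n + s / 4, hx0, hx, hθ, ?_, fun hconn => ?_⟩
  · refine entanglementWedgeConnected_of_prod_lt hx0 hx hdisj (by omega) fun τ hτ => ?_
    by_cases hτ1 : τ = 1
    · rw [hτ1, prod_halfChord_finRotate hx0 hx hdisj (by omega), prod_halfChord_one hx0 hx hdisj]
      exact prod_halfChord_finRotate_lt_one hn han hs0 hsa
    · exact hs1 τ ⟨hτ, hτ1⟩
  · have hle := thresholdSize_le_of_spacedGraph_connected (by omega) (by linarith) hθ hx0 hconn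
    have hA : 0 < a - s / n := by linarith
    have hlt : a - s / n + s / 4 < thresholdSize n (2 * (a - s / n)) := by
      have e1 : 2 * (a - s / n) / 2 = a - s / n := by ring
      have e2 : middleDist n (2 * (a - s / n)) = Real.pi - (s + 2 * (a - s / n)) := by
        rw [middleDist, e1]
        linarith
      rw [thresholdSize, e2, e1]
      refine lt_criticalSize_of_pos hA (by linarith) (by linarith) hx.le ?_
      rw [criticalDen, Real.sin_pi_sub, Real.cos_pi_sub]
      linarith
    linarith

end Discrepancy

/-! ### Assembly -/

theorem mainTheorem4 (n : ℕ) (hn : 2 ≤ n) :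
    -- disjoint inputs: the configuration is as required by the connected wedge theorem,
    -- and `V̂_j` is the causal diamond of width `x` with past tip `c_j`
    (∀ θ x : ℝ, 0 < x → x < θ → ((n : ℝ) - 1) * θ + x < 2 * Real.pi →
      BoundaryHypotheses (inputs n θ x) (outputs n θ) ∧
      ∀ j : Fin n, inputRegion (inputs n θ x) (outputs n θ) j =
        causalFuture equator (inputs n θ x j) ∩
          causalPast equator (boundaryEvent 0 ((j : ℝ) * θ))) ∧
    -- large spacing
    (∀ θ x : ℝ, 0 < x → x ≤ θ → ((n : ℝ) - 1) * θ + x ≤ 2 * Real.pi →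
      2 * Real.pi / n ≤ θ → θ ≤ Real.pi →
      ((spacedGraph n θ x).Connected ↔ θ ≤ 2 * x) ∧
      (θ ≤ 2 * x → ∀ j k : Fin n,
        (twoToAll (inputs n θ x) (outputs n θ) hemisphere j k).Nonempty) ∧
      (∀ j k : Fin n, j < k → ¬ ((j : ℕ) = 0 ∧ (k : ℕ) = n - 1) →
        ((twoToAll (inputs n θ x) (outputs n θ) hemisphere j k).Nonempty ↔ θ ≤ 2 * x))) ∧
    -- small spacing
    (∀ θ : ℝ, 0 < θ → θ < 2 * Real.pi / n →
      0 < thresholdDen n θ ∧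
      ∃ x₀ ∈ Ioc 0 θ,
        (∀ x ∈ Ioc 0 θ, Real.tan (x + ((n : ℝ) - 2) / 4 * θ) =
          thresholdNum n θ / thresholdDen n θ ↔ x = x₀) ∧
        ∀ x ∈ Ioc 0 θ,
          ((spacedGraph n θ x).Connected ↔
            (causalFuture hemisphere (inputPoint θ x 1) ∩
              causalFuture hemisphere (inputPoint θ x 2) ∩
              causalPastSet hemisphere (ridge (outputPoint n θ ((n + 1) / 2))
                (outputPoint n θ ((n + 1) / 2 + 1)))).Nonempty) ∧
          ((spacedGraph n θ x).Connected ↔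
            (causalFuture hemisphere (inputPoint θ x 1) ∩
              causalFuture hemisphere (inputPoint θ x 2) ∩
              causalPast hemisphere (outputPoint n θ ((n + 1) / 2)) ∩
              causalPast hemisphere (outputPoint n θ ((n + 1) / 2 + 1))).Nonempty) ∧
          ((spacedGraph n θ x).Connected ↔ x₀ ≤ x)) ∧
    -- the fully connected, fully disconnected and partially connected candidates
    (∀ θ x : ℝ, 0 < x → x < θ → ((n : ℝ) - 1) * θ + x < 2 * Real.pi →
      (IsRTCandidate θ x (finRotate n) ∧ ∀ ε > 0,
        candidateLength θ x (finRotate n) ε = 2 * Real.log ((2 / ε) ^ n *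
          (Real.sin ((θ - x) / 2) ^ (n - 1) * Real.sin ((((n : ℝ) - 1) * θ + x) / 2)))) ∧
      (IsRTCandidate θ x (1 : Equiv.Perm (Fin n)) ∧ ∀ ε > 0,
        candidateLength θ x (1 : Equiv.Perm (Fin n)) ε =
          2 * Real.log ((2 / ε) ^ n * Real.sin (x / 2) ^ n)) ∧
      (IsRTCandidate θ x
          (Equiv.swap (⟨0, by omega⟩ : Fin n) (⟨n - 1, by omega⟩ : Fin n)) ∧ ∀ ε > 0,
        candidateLength θ x
          (Equiv.swap (⟨0, by omega⟩ : Fin n) (⟨n - 1, by omega⟩ : Fin n)) ε =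
          2 * Real.log ((2 / ε) ^ n * (Real.sin (x / 2) ^ (n - 2) *
            Real.sin ((((n : ℝ) - 1) * θ + x) / 2) *
            Real.sin ((((n : ℝ) - 1) * θ - x) / 2))))) ∧
    -- large spacing: scattering is strictly more restrictive than a connected wedge
    (3 ≤ n →
      (∀ θ x : ℝ, 0 < x → x < θ → ((n : ℝ) - 1) * θ + x < 2 * Real.pi →
        2 * Real.pi / n < θ → (spacedGraph n θ x).Connected →
        EntanglementWedgeConnected n θ x) ∧
      (∀ θ : ℝ, 2 * Real.pi / n < θ → θ < 4 * Real.pi / (2 * n - 1) →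
        ∃ x : ℝ, 0 < x ∧ x < θ ∧ ((n : ℝ) - 1) * θ + x < 2 * Real.pi ∧
          EntanglementWedgeConnected n θ x ∧ ¬ (spacedGraph n θ x).Connected)) ∧
    -- small spacing: the same discrepancy occurs for `n ≥ 4`
    (4 ≤ n → ∃ θ x : ℝ, 0 < x ∧ x < θ ∧ θ < 2 * Real.pi / n ∧
      EntanglementWedgeConnected n θ x ∧ ¬ (spacedGraph n θ x).Connected) ∧
    -- the `n`-to-`n` connected wedge theorem has no converse for `n ≥ 3`
    (3 ≤ n → ∃ θ x : ℝ, 0 < x ∧ x < θ ∧ ((n : ℝ) - 1) * θ + x < 2 * Real.pi ∧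
      BoundaryHypotheses (inputs n θ x) (outputs n θ) ∧
      EntanglementWedgeConnected n θ x ∧ ¬ (spacedGraph n θ x).Connected) := by
  refine ⟨fun θ x hx0 hx h => ⟨boundaryHypotheses hn hx0 hx h, inputRegion_eq hn hx0 hx h⟩,
    fun θ x hx0 _ h hθ hθ' => ⟨spacedGraph_connected_iff_of_large hn hx0 h hθ hθ',
      fun hx2 => twoToAll_nonempty_of_le hn hx2 hθ, fun j k hjk hends =>
        ⟨le_of_twoToAll_nonempty hx0 h hjk hends, fun hx2 => twoToAll_nonempty_of_le hn hx2 hθ j k⟩⟩,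
    fun θ hθ hθn => smallSpacing hn hθ hθn, fun θ x hx0 hx h => phases hx0 hx h hn rfl rfl,
    fun hn3 => ⟨fun θ x hx0 hx h hθ hconn =>
        entanglementWedgeConnected_of_spacedGraph_connected hn3 hx0 hx h hθ hconn,
      fun θ hθ hθ' => exists_discrepancy_of_large hn3 hθ hθ'⟩,
    exists_discrepancy_of_small, fun hn3 => ?_⟩
  have hn3' : (3 : ℝ) ≤ n := by exact_mod_cast hn3
  -- The window for `θ` in the large-spacing counterexamples is never empty, so any `θ` in it will
  -- do.
  obtain ⟨θ, hθ, hθ'⟩ := exists_between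
    (show 2 * Real.pi / n < 4 * Real.pi / (2 * n - 1) by
      rw [div_lt_div_iff₀ (by linarith) (by linarith)]
      nlinarith [Real.pi_pos])
  obtain ⟨x, hx0, hx, h, hE, hΓ⟩ := exists_discrepancy_of_large hn3 hθ hθ'
  exact ⟨θ, x, hx0, hx, h, boundaryHypotheses hn hx0 hx h, hE, hΓ⟩
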